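/- Let $G$ be a finitely generated fully residually free group (for every finite set of non-trivial elements of $G$ there is a homomorphism from $G$ to a free group that kills none of them). Write $a^b=b^{-1}ab$ and $[a,b]=a^{-1}b^{-1}ab$. Consider an orientable quadratic equation over $G$ in the variables $X=\{z_1,\dots,z_m,x_1,y_1,\dots,x_n,y_n\}$, written as $$S=\prod_{i=1}^{m}z_i^{-1}c_iz_i\ \prod_{i=1}^{n}[x_i,y_i]\ d^{-1}=1,\qquad c_i,d\in G,\quad c_i\neq 1,$$ where either $d\neq 1$ and $m+n\ge 1$, or $d=1$, $m=0$ and $n\ge 1$ (the coefficient $d$ is then said not to occur). Its atoms, in order, are $r_1,\dots,r_{m+n}=z_1^{-1}c_1z_1,\dots,z_m^{-1}c_mz_m,[x_1,y_1],\dots,[x_n,y_n]$. A solution of $S=1$ in $G$ is a homomorphism $\beta:G[X]=G*F(X)\to G$ that is the identity on $G$ and satisfies $\beta(S)=1$; it is commutative if $[\beta(r_i),\beta(r_{i+1})]=1$ for all $i<m+n$, and in general position if $[\beta(r_i),\beta(r_{i+1})]\neq 1$ for all $i<m+n$. Let $\kappa(S)=m+2n+\varepsilon$, with $\varepsilon=1$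 if $d\ne1$ and $\varepsilon=0$ if $d=1$. The equation is regular if $\kappa(S)\ge 4$ and it has a non-commutative solution in $G$, or if it is $[x_1,y_1]=d$ with $d\neq 1$. Let $R(S)$ be the set of all elements of $G[X]$ that are sent to $1$ by every solution of $S=1$ in $G$, and $G_{R(S)}=G[X]/R(S)$. For a group $H$ and $u\in H$ let $H(u,t)=\langle H,t\mid t^{-1}ht=h\ (h\in C_H(u))\rangle$ be the extension of the centralizer of $u$. Given a solution $\beta$, construct a chain of extensions of centralizers, starting with $H=G$ and the $G$-homomorphism $\alpha=\beta:G[X]\to H$, by successive steps. Each step replaces $H$ by $H(u,t)$, for the indicated element $u$ and a new letter $t$, and replaces $\alpha$ by the $G$-homomorphism with the indicated values on $X$ (writing $v$ for the old value $\alpha(v)$ of a variable $v$; variables not mentioned keep their values). One round consists of the following steps in this order: 1. for $i=1,\dots,m-1$: $u=c_i^{z_i}c_{i+1}^{z_{i+1}}$; $\ z_i\mapsto z_it$, $z_{i+1}\mapsto z_{i+1}t$; 2. if $m,n>0$: $u=c_m^{z_m}x_1^{-1}$; $\ z_m\mapsto z_mt$, $x_1\mapsto x_1^{t}$, $y_1\mapsto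 t^{-1}y_1$; 3. for $i=1,\dots,n$, in succession: $u=x_i$, $y_i\mapsto ty_i$; then $u=y_i$, $x_i\mapsto tx_i$; then $u=x_i$, $y_i\mapsto ty_i$; then, if $i<n$, $u=y_ix_{i+1}^{-1}$, $x_i\mapsto t^{-1}x_i$, $y_i\mapsto y_i^{t}$, $x_{i+1}\mapsto x_{i+1}^{t}$, $y_{i+1}\mapsto t^{-1}y_{i+1}$. Carry out two rounds, the second one starting from the group and the homomorphism that the first one ends with. Let $G(U,T)$ be the last group and $\hat\lambda_\beta:G[X]\to G(U,T)$ the last homomorphism. **Proposition.** If $S=1$ is regular and $\beta$ is a solution of $S=1$ in $G$ in general position, then $\hat\lambda_\beta$ induces a homomorphism $\lambda_\beta:G_{R(S)}\to G(U,T)$, and $\lambda_\beta$ is injective. -/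

import Mathlib

universe u

/-- `G` is fully residually free: every finite set of non-trivial elements survives in some
homomorphism from `G` to a free group. -/
def IsFullyResiduallyFree (G : Type u) [Group G] : Prop :=
  ∀ A : Finset G, (∀ g ∈ A, g ≠ 1) →
    ∃ (ι : Type) (f : G →* FreeGroup ι), ∀ g ∈ A, f g ≠ 1

/-- The variables `x_1, y_1, …, x_n, y_n, z_1, …, z_m`. -/
inductive QVar (m n : ℕ) : Type
  | x (i : Fin n)
  | y (i : Fin n)
  | z (i : Fin m)

/-- The free product `G[X] = G * F(X)`. -/
abbrev GX (G : Type u) [Group G] (m n : ℕ) : Type u :=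
  Monoid.Coprod G (FreeGroup (QVar m n))

namespace GX

variable {G : Type u} [Group G] {m n : ℕ}

/-- A constant of `G`, as an element of `G[X]`. -/
def const (g : G) : GX G m n := Monoid.Coprod.inl g

/-- A variable, as an element of `G[X]`. -/
def var (v : QVar m n) : GX G m n := Monoid.Coprod.inr (FreeGroup.of v)

end GX

/-- The data of an orientable quadratic equation
`∏ z_i⁻¹ c_i z_i ∏ [x_i, y_i] = d` in the variables `z_1, …, z_m, x_1, y_1, …, x_n, y_n`. -/
structure QuadEq (G : Type u) (m n : ℕ) where
  /-- the coefficients `c_i` -/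
  c : Fin m → G
  /-- the right-hand side -/
  d : G

namespace QuadEq

variable {G : Type u} [Group G] {m n : ℕ}

/-- The atoms `r_1, …, r_{m+n}`: first `z_i⁻¹ c_i z_i`, then `[x_i, y_i] = x_i⁻¹ y_i⁻¹ x_i y_i`. -/
def atom (E : QuadEq G m n) : Fin (m + n) → GX G m n :=
  Fin.append
    (fun i => (GX.var (.z i))⁻¹ * GX.const (E.c i) * GX.var (.z i))
    (fun i => (GX.var (.x i))⁻¹ * (GX.var (.y i))⁻¹ * GX.var (.x i) * GX.var (.y i))

/-- The left-hand side `S = r_1 ⋯ r_{m+n} d⁻¹` of the equation `S = 1`. -/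
def word (E : QuadEq G m n) : GX G m n :=
  (List.ofFn E.atom).prod * GX.const E.d⁻¹

/-- The equation is standard: the `c_i` are non-trivial, and either the coefficient `d` occurs
(that is, `d ≠ 1`) and there is at least one atom, or `d` does not occur and the equation is
`[x_1, y_1] ⋯ [x_n, y_n] = 1` with `n > 0`. -/
def IsStandard (E : QuadEq G m n) : Prop :=
  (∀ i, E.c i ≠ 1) ∧ ((E.d ≠ 1 ∧ 0 < m + n) ∨ (E.d = 1 ∧ m = 0 ∧ 0 < n))

/-- A solution of `S = 1` in `G`: a `G`-homomorphism `G[X] → G` that sends `S` to `1`. -/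
def IsSolution (E : QuadEq G m n) (β : GX G m n →* G) : Prop :=
  (∀ g : G, β (GX.const g) = g) ∧ β E.word = 1

/-- The images of any two neighbouring atoms commute. -/
def IsCommutative (E : QuadEq G m n) (β : GX G m n →* G) : Prop :=
  ∀ (i : ℕ) (h : i + 1 < m + n),
    Commute (β (E.atom ⟨i, Nat.lt_of_succ_lt h⟩)) (β (E.atom ⟨i + 1, h⟩))

/-- The images of no two neighbouring atoms commute. -/
def InGeneralPosition (E : QuadEq G m n) (β : GX G m n →* G) : Prop :=
  ∀ (i : ℕ) (h : i + 1 < m + n),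
    ¬ Commute (β (E.atom ⟨i, Nat.lt_of_succ_lt h⟩)) (β (E.atom ⟨i + 1, h⟩))

open Classical in
/-- `κ(S) = |X| + ε(S)`, where `ε(S)` is `1` or `0` as the coefficient `d` occurs or not. -/
noncomputable def kappa (E : QuadEq G m n) : ℕ :=
  (m + 2 * n) + (if E.d = 1 then 0 else 1)

/-- The standard equation is regular: `κ(S) ≥ 4` and there is a non-commutative solution in `G`,
or it is of the form `[x, y] = d` with `d ≠ 1`. -/
def IsRegular (E : QuadEq G m n) : Prop :=
  E.IsStandard ∧
    ((4 ≤ E.kappa ∧ ∃ β, E.IsSolution β ∧ ¬ E.IsCommutative β) ∨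
      (m = 0 ∧ n = 1 ∧ E.d ≠ 1))

/-- The radical `R(S)`: the words that vanish at every solution of `S = 1` in `G`
(all of `G[X]` if there is no solution). -/
def radical (E : QuadEq G m n) : Subgroup (GX G m n) :=
  ⨅ β : {β : GX G m n →* G // E.IsSolution β}, β.1.ker

instance (E : QuadEq G m n) : E.radical.Normal :=
  Subgroup.normal_iInf_normal fun β => MonoidHom.normal_ker β.1

/-- The coordinate group `G_{R(S)} = G[X] / R(S)`. -/
abbrev CoordinateGroup (E : QuadEq G m n) : Type u :=
  GX G m n ⧸ E.radical

end QuadEq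

/-- The extension of the centralizer of `w` in `H`:
`H(w, t) = ⟨H, t | t⁻¹ h t = h for all h ∈ C_H(w)⟩`. -/
abbrev CentralizerExtension (H : Type u) [Group H] (w : H) : Type u :=
  HNNExtension H (Subgroup.centralizer {w}) (Subgroup.centralizer {w}) (MulEquiv.refl _)

/-- The kinds of steps in the construction of `G(U, T)`. Indices start at `0`. -/
inductive Move (m n : ℕ) : Type
  /-- `z_i ↦ z_i t`, `z_{i+1} ↦ z_{i+1} t`, where `t` extends the centralizer of the value of
  `c_i^{z_i} c_{i+1}^{z_{i+1}}` -/
  | zz (i : Fin (m - 1))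
  /-- `z_m ↦ z_m t`, `x_1 ↦ x_1^t`, `y_1 ↦ t⁻¹ y_1`, where `t` extends the centralizer of the
  value of `c_m^{z_m} x_1⁻¹` (`z_m` is the last `z`-variable, `x_1`, `y_1` are the first ones) -/
  | zx (hm : 0 < m) (hn : 0 < n)
  /-- `y_i ↦ t y_i`, where `t` extends the centralizer of the value of `x_i` -/
  | twistY (i : Fin n)
  /-- `x_i ↦ t x_i`, where `t` extends the centralizer of the value of `y_i` -/
  | twistX (i : Fin n)
  /-- `x_i ↦ t⁻¹ x_i`, `y_i ↦ y_i^t`, `x_{i+1} ↦ x_{i+1}^t`, `y_{i+1} ↦ t⁻¹ y_{i+1}`, where `t`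
  extends the centralizer of the value of `y_i x_{i+1}⁻¹` -/
  | xx (i : Fin (n - 1))

namespace Move

variable {m n : ℕ}

/-- The element of `G[X]` whose value has its centralizer extended. -/
def period {G : Type u} [Group G] (E : QuadEq G m n) : Move m n → GX G m n
  | zz i => E.atom ⟨i, by omega⟩ * E.atom ⟨i + 1, by omega⟩
  | zx hm hn => E.atom ⟨m - 1, by omega⟩ * (GX.var (.x ⟨0, hn⟩))⁻¹
  | twistY i => GX.var (.x i)
  | twistX i => GX.var (.y i)
  | xx i => GX.var (.y ⟨i, by omega⟩) * (GX.var (.x ⟨i + 1, by omega⟩))⁻¹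

/-- The new values of the variables, in terms of the old values `v` and the new letter `t`. -/
def act {K : Type u} [Group K] (t : K) (v : QVar m n → K) : Move m n → QVar m n → K
  | zz i, .z j => if j.1 = i.1 ∨ j.1 = i.1 + 1 then v (.z j) * t else v (.z j)
  | zz _, w => v w
  | zx _ _, .z j => if j.1 = m - 1 then v (.z j) * t else v (.z j)
  | zx _ _, .x j => if j.1 = 0 then t⁻¹ * v (.x j) * t else v (.x j)
  | zx _ _, .y j => if j.1 = 0 then t⁻¹ * v (.y j) else v (.y j)
  | twistY i, .y j => if j = i then t * v (.y j) else v (.y j)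
  | twistY _, w => v w
  | twistX i, .x j => if j = i then t * v (.x j) else v (.x j)
  | twistX _, w => v w
  | xx i, .x j =>
      if j.1 = i.1 then t⁻¹ * v (.x j)
      else if j.1 = i.1 + 1 then t⁻¹ * v (.x j) * t else v (.x j)
  | xx i, .y j =>
      if j.1 = i.1 then t⁻¹ * v (.y j) * t
      else if j.1 = i.1 + 1 then t⁻¹ * v (.y j) else v (.y j)
  | xx _, w => v w

/-- The steps of one round of the construction, in order; there are `m - 1`, `4n - 1` or
`m + 4n - 1` of them as `n = 0`, `m = 0` or `m, n > 0`. -/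
def round (m n : ℕ) : List (Move m n) :=
  (List.finRange (m - 1)).map zz ++
  (if h : 0 < m ∧ 0 < n then [zx h.1 h.2] else []) ++
  (List.finRange n).flatMap fun i =>
    [twistY i, twistX i, twistY i] ++
      (if h : i.1 < n - 1 then [xx ⟨i.1, h⟩] else [])

end Move

/-- A stage of the construction: a group `H` with a homomorphism `G → H` and values in `H` of the
variables, that is, a `G`-homomorphism `G[X] → H`. -/
structure Stage (G : Type u) [Group G] (m n : ℕ) where
  /-- the group `H` -/
  carrier : Type u
  [group : Group carrier]
  /-- the canonical homomorphism `G → H` -/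
  incl : G →* carrier
  /-- the values of the variables -/
  val : QVar m n → carrier

namespace Stage

variable {G : Type u} [Group G] {m n : ℕ}

instance (s : Stage G m n) : Group s.carrier := s.group

/-- The `G`-homomorphism `G[X] → H` given by the values of the variables. -/
def hom (s : Stage G m n) : GX G m n →* s.carrier :=
  Monoid.Coprod.lift s.incl (FreeGroup.lift s.val)

/-- The initial stage: `H = G`, with the values of the variables given by `β`. -/
def start (β : GX G m n →* G) : Stage G m n where
  carrier := G
  incl := MonoidHom.id G
  val := fun w => β (GX.var w)

/-- One step: extend the centralizer of the value of the period by a new letter `t` and change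
the values of the variables. -/
def step (E : QuadEq G m n) (s : Stage G m n) (k : Move m n) : Stage G m n where
  carrier := CentralizerExtension s.carrier (s.hom (k.period E))
  incl := HNNExtension.of.comp s.incl
  val := k.act HNNExtension.t (fun w => HNNExtension.of (s.val w))

end Stage

namespace QuadEq

variable {G : Type u} [Group G] {m n : ℕ}

/-- The last stage of the construction: two successive rounds, starting from `β`. -/
def finalStage (E : QuadEq G m n) (β : GX G m n →* G) : Stage G m n :=
  (Move.round m n ++ Move.round m n).foldl (Stage.step E) (Stage.start β)

/-- The group `G(U, T)`, obtained from `G` by a finite chain of extensions of centralizers. -/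
abbrev GUT (E : QuadEq G m n) (β : GX G m n →* G) : Type u :=
  (E.finalStage β).carrier

/-- The homomorphism `λ_β`, on the level of `G[X]`. -/
def lambdaHom (E : QuadEq G m n) (β : GX G m n →* G) : GX G m n →* E.GUT β :=
  (E.finalStage β).hom

end QuadEq

/-! Let `N` be the normal closure of `S` in `G[X]`. A step never changes the value of `S`, because
the new letter commutes with exactly the piece of `S` that it meets; so every stage kills `N`. The
core of the proof is the opposite inclusion: the last homomorphism kills nothing outside `N`. If the
group of a stage is separated by retractions onto `G`, then the stage also kills `R(S)`, because a
retraction composed with its homomorphism is a solution. These facts together give `R(S) = N = ker`.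

Separation. A free group has a representation in `SL₂` over an algebraically closed field of
characteristic zero in which no non-trivial element has trace `±2`
(`exists_isAnisotropicRep_freeGroup`). Traces of commutators then show that commutation is
transitive on non-trivial elements and that `u` commutes with `g u g⁻¹` only if it commutes with
`g`. A degree count in the eigenvalue gives the big powers property
(`IsAnisotropicRep.finite_setOf_prod_eq_one`). Hence `t ↦ w ^ N` with `N` large separates finite
subsets of `H(w, t)`: an extension of a centralizer of a non-trivial element is again fully
residually free and retracts onto `H`.

Rearrangement. Dropping a step (`t ↦ 1`) and exchanging two steps on disjoint sets of atoms are
realized by homomorphisms between the resulting stages, and these can only enlarge kernels. It is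
therefore enough to bound the kernel for a convenient rearrangement of part of the two rounds. This
rearrangement is cut into blocks, one for each atom but the last. In a block, steps at the next atom
first put a new letter into the period, so that the period commutes with no non-trivial element of
an older group; the link of the two atoms then makes the variables of the current atom free over
everything before them (`GX.IsGood`). The tool is Britton's lemma, in the form of the injectivity
criterion `CentralizerExtension.eq_one_of_mem_closure_of_map_eq_one`.

End. Modulo `N` the equation turns one last variable into the stable letter of an HNN extension of a
free product `B` of `G` and a free group, with cyclic associated subgroups. With a handle the
relation is `y⁻¹ x y = x w`; without handles `z = z_m` conjugates `Q` to `g`, where `Q` and `g` lie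
in `B`. The associated subgroups are full centralizers in the free product, so the last step, which
extends a centralizer in a group that contains `B` faithfully, creates no pinch that is not already
present in `G[X] / N`. -/

/-- A representation by `2 × 2` matrices of determinant one in which no non-trivial element
has trace `±2`. -/
def IsAnisotropicRep {H : Type*} [Group H] {K : Type*} [Field K]
    (ρ : H →* Matrix (Fin 2) (Fin 2) K) : Prop :=
  (∀ g, (ρ g).det = 1) ∧ ∀ g, g ≠ 1 → (ρ g).trace ^ 2 ≠ 4

/-! ### Matrices without trace `±2`: eigenlines, centralizers and commutation. -/

section Diagonalization

variable {K : Type*} [Field K]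

theorem exists_conj_eq_diagonal_of_trace_sq_ne_four [IsAlgClosed K] [CharZero K]
    (U : Matrix (Fin 2) (Fin 2) K) (hdet : U.det = 1) (htr : U.trace ^ 2 ≠ 4) :
    ∃ P Q : Matrix (Fin 2) (Fin 2) K, P * Q = 1 ∧ Q * P = 1 ∧
      ∃ l r : K, l * r = 1 ∧ l ≠ r ∧ Q * U * P = !![l, 0; 0, r] := by
  obtain ⟨s, hs⟩ := IsAlgClosed.exists_pow_nat_eq (U.trace ^ 2 - 4) (n := 2) (by norm_num)
  have hs0 : s ≠ 0 := by
    rintro rfl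
    apply htr
    linear_combination -hs
  have h2 : (2 : K) ≠ 0 := two_ne_zero
  obtain ⟨l, hl⟩ : ∃ l, l = (U.trace + s) / 2 := ⟨_, rfl⟩
  obtain ⟨r, hr⟩ : ∃ r, r = (U.trace - s) / 2 := ⟨_, rfl⟩
  have hsum : l + r = U.trace := by rw [hl, hr]; ring
  have hprod : l * r = 1 := by rw [hl, hr]; linear_combination (-1 / 4) * hs
  have hne : l ≠ r := by
    intro h
    apply hs0
    have : s = l - r := by rw [hl, hr]; ring
    rw [this, h, sub_self]
  have hlr : l - r ≠ 0 := sub_ne_zero.2 hne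
  rw [Matrix.trace_fin_two] at hsum
  rw [Matrix.det_fin_two] at hdet
  obtain ⟨a, b, c, d, rfl⟩ : ∃ a b c d, U = !![a, b; c, d] :=
    ⟨_, _, _, _, Matrix.eta_fin_two U⟩
  simp only [Matrix.of_apply, Matrix.cons_val', Matrix.cons_val_zero, Matrix.cons_val_one,
    Matrix.cons_val_fin_one] at hsum hdet
  have ha : a = l + r - d := by linear_combination -hsum
  -- This is the characteristic polynomial evaluated at `d`. The columns of `P` below are
  -- eigenvectors for `l` and `r`, read off from whichever off-diagonal entry is non-zero.
  have key : (l - d) * (d - r) = b * c := by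
    subst ha
    linear_combination -hprod + hdet
  by_cases hc : c = 0
  · by_cases hb : b = 0
    · subst hc hb
      have : (l - d) * (d - r) = 0 := by rw [key]; ring
      rcases mul_eq_zero.1 this with h | h
      · obtain rfl : l = d := sub_eq_zero.1 h
        obtain rfl : a = r := by rw [ha]; ring
        exact ⟨!![0, 1; 1, 0], !![0, 1; 1, 0], by simp [Matrix.one_fin_two],
          by simp [Matrix.one_fin_two], l, a, hprod, hne, by simp⟩
      · obtain rfl : d = r := sub_eq_zero.1 h
        obtain rfl : a = l := by rw [ha]; ring
        exact ⟨1, 1, by simp, by simp, a, d, hprod, hne, by simp⟩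
    · refine ⟨!![b, b; l - a, r - a],
        (b * (r - l))⁻¹ • !![r - a, -b; a - l, b], ?_, ?_, l, r, hprod, hne, ?_⟩
      all_goals
        have hrl : r - l ≠ 0 := sub_ne_zero.2 hne.symm
        subst hc
        ext i j
        fin_cases i <;> fin_cases j <;> simp [Matrix.mul_apply, Fin.sum_univ_two]
        all_goals field_simp
        all_goals subst ha
        all_goals first
          | ring1
          | linear_combination key
          | linear_combination -key
  · refine ⟨!![l - d, r - d; c, c],
      (c * (l - r))⁻¹ • !![c, d - r; -c, l - d], ?_, ?_, l, r, hprod, hne, ?_⟩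
    all_goals
      ext i j
      fin_cases i <;> fin_cases j <;> simp [Matrix.mul_apply, Fin.sum_univ_two]
      all_goals field_simp
      all_goals subst ha
      all_goals first
        | ring1
        | linear_combination key
        | linear_combination -key

end Diagonalization

section Anisotropic

variable {H : Type*} [Group H] {K : Type*} [Field K] {ρ : H →* Matrix (Fin 2) (Fin 2) K}

namespace IsAnisotropicRep

theorem eq_one_of_trace (hρ : IsAnisotropicRep ρ) {g : H} (h : (ρ g).trace ^ 2 = 4) : g = 1 := by
  by_contra hg
  exact hρ.2 g hg h

theorem apply_inv (hρ : IsAnisotropicRep ρ) (g : H) :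
    ρ g⁻¹ = !![ρ g 1 1, -ρ g 0 1; -ρ g 1 0, ρ g 0 0] := by
  have h1 : ρ g⁻¹ * ρ g = 1 := by rw [← map_mul]; simp
  have h2 : ρ g * !![ρ g 1 1, -ρ g 0 1; -ρ g 1 0, ρ g 0 0] = 1 := by
    have := hρ.1 g
    rw [Matrix.det_fin_two] at this
    ext i j
    fin_cases i <;> fin_cases j <;> simp [Matrix.mul_apply, Fin.sum_univ_two]
    all_goals first | ring1 | linear_combination this
  calc ρ g⁻¹ = ρ g⁻¹ * (ρ g * !![ρ g 1 1, -ρ g 0 1; -ρ g 1 0, ρ g 0 0]) := by rw [h2, mul_one]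
    _ = _ := by rw [← mul_assoc, h1, one_mul]

theorem conj (hρ : IsAnisotropicRep ρ) {P Q : Matrix (Fin 2) (Fin 2) K} (hPQ : P * Q = 1)
    (hQP : Q * P = 1) :
    ∃ ρ' : H →* Matrix (Fin 2) (Fin 2) K, IsAnisotropicRep ρ' ∧ ∀ g, ρ' g = Q * ρ g * P := by
  refine ⟨⟨⟨fun g => Q * ρ g * P, by simp [hQP]⟩, fun a b => ?_⟩, ⟨fun g => ?_, fun g hg => ?_⟩,
    fun g => rfl⟩
  · simp only [map_mul]
    calc Q * (ρ a * ρ b) * P = Q * ρ a * 1 * ρ b * P := by simp only [mul_assoc, one_mul]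
      _ = _ := by rw [← hPQ]; simp only [mul_assoc]
  · change (Q * ρ g * P).det = 1
    rw [Matrix.det_mul, Matrix.det_mul, hρ.1, mul_one, ← Matrix.det_mul, hQP, Matrix.det_one]
  · change (Q * ρ g * P).trace ^ 2 ≠ 4
    rw [Matrix.trace_mul_comm, ← mul_assoc, hPQ, one_mul]
    exact hρ.2 g hg

/-- For the converse direction no faithfulness is needed: the commutator has trace `2`, hence is
trivial. All commutation statements below are obtained in this way. -/
theorem commute_iff_of_diagonal (hρ : IsAnisotropicRep ρ) {u : H} {l r : K}
    (hne : l ≠ r) (hu : ρ u = !![l, 0; 0, r]) (g : H) :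
    Commute g u ↔ ρ g 0 1 = 0 ∧ ρ g 1 0 = 0 := by
  have hlr : l - r ≠ 0 := sub_ne_zero.2 hne
  constructor
  · intro h
    have h1 : ρ g * ρ u = ρ u * ρ g := by rw [← map_mul, h.eq, map_mul]
    rw [hu] at h1
    have h2 := congrFun (congrFun h1 0) 1
    have h3 := congrFun (congrFun h1 1) 0
    simp [Matrix.mul_apply, Fin.sum_univ_two] at h2 h3
    constructor
    · have : (l - r) * ρ g 0 1 = 0 := by linear_combination -h2
      exact (mul_eq_zero.1 this).resolve_left hlr
    · have : (l - r) * ρ g 1 0 = 0 := by linear_combination h3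
      exact (mul_eq_zero.1 this).resolve_left hlr
  · rintro ⟨h1, h2⟩
    have hd := hρ.1 g
    have hdu := hρ.1 u
    rw [Matrix.det_fin_two] at hd hdu
    have : g * u * g⁻¹ * u⁻¹ = 1 := by
      apply hρ.eq_one_of_trace
      rw [map_mul, map_mul, map_mul, hρ.apply_inv, hρ.apply_inv, Matrix.trace_fin_two]
      rw [hu] at hdu ⊢
      simp [Matrix.mul_apply, Fin.sum_univ_two, h1, h2] at hd hdu ⊢
      have : ∀ x w : K, x * w = 1 → x * l * w * r + w * r * x * l = 2 := by
        intro x w h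
        linear_combination (2 * l * r) * h + 2 * hdu
      rw [this _ _ hd]; norm_num
    have h4 : g * u * g⁻¹ = u := mul_inv_eq_one.1 this
    exact mul_inv_eq_iff_eq_mul.1 h4

/-- If `g` fixes an eigenline of `u`, then `g` and `u` are simultaneously triangular and their
commutator has trace `2`. -/
theorem commute_of_mul_eq_zero (hρ : IsAnisotropicRep ρ) {u : H} {l r : K} (hlr : l * r = 1)
    (hu : ρ u = !![l, 0; 0, r]) {g : H} (h : ρ g 0 1 * ρ g 1 0 = 0) :
    Commute g u := by
  have hd := hρ.1 g
  rw [Matrix.det_fin_two] at hd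
  have : g * u * g⁻¹ * u⁻¹ = 1 := by
    apply hρ.eq_one_of_trace
    rw [map_mul, map_mul, map_mul, hρ.apply_inv, hρ.apply_inv, Matrix.trace_fin_two, hu]
    simp [Matrix.mul_apply, Fin.sum_univ_two]
    have h3 : ∀ x y z w : K, y * z = 0 → x * w - y * z = 1 →
        (x * l * w + -(y * r * z)) * r + (-(z * l * y) + w * r * x) * l = 2 := by
      intro x y z w h0 h1
      linear_combination (2 * l * r) * h1 + 2 * hlr + (2 * l * r - l ^ 2 - r ^ 2) * h0
    rw [h3 _ _ _ _ h hd]; norm_num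
  have h4 : g * u * g⁻¹ = u := mul_inv_eq_one.1 this
  exact mul_inv_eq_iff_eq_mul.1 h4

/-- The only alternative to commuting is that `g` exchanges the two eigenlines of `u`. Then `g * g`
has trace `-2`, so it is trivial and has trace `2`, which is absurd in characteristic zero. -/
theorem commute_of_commute_conj_of_diagonal [CharZero K] (hρ : IsAnisotropicRep ρ) {u : H}
    {l r : K} (hlr : l * r = 1) (hne : l ≠ r) (hu : ρ u = !![l, 0; 0, r]) {g : H}
    (h : Commute (g * u * g⁻¹) u) : Commute g u := by
  have hd := hρ.1 g
  rw [Matrix.det_fin_two] at hd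
  have h1 := (hρ.commute_iff_of_diagonal hne hu _).1 h
  rw [map_mul, map_mul, hρ.apply_inv, hu] at h1
  simp [Matrix.mul_apply, Fin.sum_univ_two] at h1
  obtain ⟨h1, h2⟩ := h1
  have hlr' : l - r ≠ 0 := sub_ne_zero.2 hne
  apply hρ.commute_of_mul_eq_zero hlr hu
  by_contra hqr
  have hq : ρ g 0 1 ≠ 0 := left_ne_zero_of_mul hqr
  have hr : ρ g 1 0 ≠ 0 := right_ne_zero_of_mul hqr
  have hp : ρ g 0 0 = 0 := by
    have : (l - r) * ρ g 0 1 * ρ g 0 0 = 0 := by linear_combination -h1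
    exact (mul_eq_zero.1 this).resolve_left (mul_ne_zero hlr' hq)
  have hs : ρ g 1 1 = 0 := by
    have : (l - r) * ρ g 1 0 * ρ g 1 1 = 0 := by linear_combination h2
    exact (mul_eq_zero.1 this).resolve_left (mul_ne_zero hlr' hr)
  have h4 : (ρ (g * g)).trace = -2 := by
    rw [map_mul, Matrix.trace_fin_two]
    simp [Matrix.mul_apply, Fin.sum_univ_two, hp, hs] at hd ⊢
    linear_combination (-2) * hd
  have h5 : g * g = 1 := hρ.eq_one_of_trace (by rw [h4]; norm_num)
  rw [h5, map_one, Matrix.trace_one] at h4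
  norm_num at h4

/-- The off-diagonal entries of `g u g⁻¹` are non-zero multiples of the products of the two entries
in a row of `g`. If some entry of `g` vanished, `g u g⁻¹` would be triangular, hence would commute
with `u`, and so would `g`. Non-vanishing of all entries is what keeps leading coefficients alive in
the big powers argument. -/
theorem entry_ne_zero_of_not_commute [CharZero K] (hρ : IsAnisotropicRep ρ) {u : H}
    {l r : K} (hlr : l * r = 1) (hne : l ≠ r) (hu : ρ u = !![l, 0; 0, r]) {g : H}
    (h : ¬ Commute g u) (i j : Fin 2) : ρ g i j ≠ 0 := by
  have key : (ρ g 0 0 * ρ g 0 1) * (ρ g 1 0 * ρ g 1 1) ≠ 0 := by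
    intro h0
    apply h
    apply hρ.commute_of_commute_conj_of_diagonal hlr hne hu
    apply hρ.commute_of_mul_eq_zero hlr hu
    rw [map_mul, map_mul, hρ.apply_inv, hu]
    simp only [Matrix.mul_apply, Fin.sum_univ_two]
    simp
    have : ∀ x y z w : K, (x * y) * (z * w) = 0 →
        (-(x * l * y) + y * r * x) * (z * l * w + -(w * r * z)) = 0 := by
      intro x y z w h
      linear_combination (-(l - r) ^ 2) * h
    have h3 := this _ _ _ _ h0
    exact mul_eq_zero.1 h3
  have k1 := left_ne_zero_of_mul key
  have k2 := right_ne_zero_of_mul key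
  fin_cases i <;> fin_cases j
  · exact left_ne_zero_of_mul k1
  · exact right_ne_zero_of_mul k1
  · exact left_ne_zero_of_mul k2
  · exact right_ne_zero_of_mul k2

theorem exists_diagonal [IsAlgClosed K] [CharZero K] (hρ : IsAnisotropicRep ρ) {u : H}
    (hu : u ≠ 1) : ∃ ρ' : H →* Matrix (Fin 2) (Fin 2) K, IsAnisotropicRep ρ' ∧
      ∃ l r : K, l * r = 1 ∧ l ≠ r ∧ ρ' u = !![l, 0; 0, r] := by
  obtain ⟨P, Q, hPQ, hQP, l, r, h1, h2, h3⟩ :=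
    exists_conj_eq_diagonal_of_trace_sq_ne_four (ρ u) (hρ.1 u) (hρ.2 u hu)
  obtain ⟨ρ', h4, h5⟩ := hρ.conj hPQ hQP
  exact ⟨ρ', h4, l, r, h1, h2, by rw [h5, h3]⟩

theorem commute_trans [IsAlgClosed K] [CharZero K] (hρ : IsAnisotropicRep ρ) {u a b : H}
    (hu : u ≠ 1) (ha : Commute a u) (hb : Commute b u) : Commute a b := by
  obtain ⟨ρ', h4, l, r, h1, h2, h3⟩ := hρ.exists_diagonal hu
  have ha' := (h4.commute_iff_of_diagonal h2 h3 a).1 ha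
  have hb' := (h4.commute_iff_of_diagonal h2 h3 b).1 hb
  have hda := h4.1 a
  have hdb := h4.1 b
  rw [Matrix.det_fin_two] at hda hdb
  have : a * b * a⁻¹ * b⁻¹ = 1 := by
    apply h4.eq_one_of_trace
    rw [map_mul, map_mul, map_mul, h4.apply_inv, h4.apply_inv, Matrix.trace_fin_two]
    simp [Matrix.mul_apply, Fin.sum_univ_two, ha'.1, ha'.2, hb'.1, hb'.2] at hda hdb ⊢
    have : ∀ x y z w : K, x * y = 1 → z * w = 1 → x * z * y * w + y * w * x * z = 2 := by
      intro x y z w h1 h2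
      linear_combination (2 * z * w) * h1 + 2 * h2
    rw [this _ _ _ _ hda hdb]; norm_num
  have h4 : a * b * a⁻¹ = b := mul_inv_eq_one.1 this
  exact mul_inv_eq_iff_eq_mul.1 h4

theorem commute_of_commute_conj [IsAlgClosed K] [CharZero K] (hρ : IsAnisotropicRep ρ) {u g : H}
    (hu : u ≠ 1) (h : Commute (g * u * g⁻¹) u) : Commute g u := by
  obtain ⟨ρ', h4, l, r, h1, h2, h3⟩ := hρ.exists_diagonal hu
  exact h4.commute_of_commute_conj_of_diagonal h1 h2 h3 h

end IsAnisotropicRep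

end Anisotropic

/-! ### Big powers: a degree count in the eigenvalue. -/

open Polynomial in
-- After multiplication by `τ`, the diagonal factor with sign `e` multiplies the coordinate `σ e` by
-- `τ ^ 2` and fixes the other one. Thus the coordinate `σ e` dominates, and the next matrix passes
-- the top coefficient on through its entry at `(σ a.1, σ b.1)`, which the chain condition makes
-- non-zero.
theorem exists_polynomial_vector_of_chain {K : Type*} [Field K]
    (L : List (ℤˣ × Matrix (Fin 2) (Fin 2) K)) (hL : L ≠ [])
    (hdet : ∀ x ∈ L, x.2.det = 1) (σ : ℤˣ → Fin 2) (hσ1 : σ 1 = 0) (hσ2 : σ (-1) = 1)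
    (hch : L.IsChain (fun a b => a.2 (σ a.1) (σ b.1) ≠ 0)) :
    ∃ (w : Fin 2 → K) (W : Fin 2 → K[X]),
      (∀ τ : K, τ ≠ 0 → ∀ i, (W i).eval τ = τ ^ L.length *
        ((L.map (fun x : ℤˣ × Matrix (Fin 2) (Fin 2) K =>
          !![τ ^ (x.1 : ℤ), 0; 0, τ ^ (-(x.1 : ℤ))] * x.2)).prod.mulVec w) i) ∧
      ∀ x ∈ L.head?, (W (σ x.1)).coeff (2 * L.length) ≠ 0 ∧
        ∀ i, (W i).natDegree ≤ 2 * L.length ∧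
          (i ≠ σ x.1 → (W i).natDegree < 2 * L.length) := by
  have hD : ∀ (τ : K), τ ≠ 0 → ∀ (e : ℤˣ) (v : Fin 2 → K) (i : Fin 2),
      τ * ((!![τ ^ (e : ℤ), 0; 0, τ ^ (-(e : ℤ))] : Matrix (Fin 2) (Fin 2) K).mulVec v) i =
        if i = σ e then τ ^ 2 * v i else v i := by
    intro τ hτ e v i
    rcases Int.units_eq_one_or e with rfl | rfl <;> fin_cases i <;>
      simp [Matrix.mulVec, dotProduct, Fin.sum_univ_two, hσ1, hσ2, hτ, sq, mul_assoc]
  induction L with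
  | nil => exact absurd rfl hL
  | cons x L ih =>
    rcases eq_or_ne L [] with rfl | hL'
    -- The vector is chosen such that the last matrix maps it to the dominant basis vector; so no
    -- condition on the last matrix is needed.
    · refine ⟨x.2.adjugate.mulVec (Pi.single (σ x.1) 1),
        fun i => if i = σ x.1 then X ^ 2 else 0, ?_, ?_⟩
      · intro τ hτ i
        simp only [List.length_cons, List.length_nil, zero_add, pow_one, List.map_cons,
          List.map_nil, List.prod_cons, List.prod_nil, mul_one]
        rw [← Matrix.mulVec_mulVec, Matrix.mulVec_mulVec _ x.2, Matrix.mul_adjugate,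
          hdet x (by simp), one_smul, Matrix.one_mulVec, hD τ hτ]
        split_ifs with h
        · subst h; simp
        · simp [h]
      · intro y hy
        obtain rfl : x = y := by simpa using hy
        refine ⟨by simp, fun i => ⟨?_, fun hi => ?_⟩⟩
        · dsimp only; split_ifs <;> simp
        · simp [hi]
    · obtain ⟨w, W, h1, h2⟩ := ih hL' (fun y hy => hdet y (List.mem_cons_of_mem _ hy))
        (List.isChain_cons.1 hch).2
      obtain ⟨y, hy⟩ : ∃ y, y ∈ L.head? := by
        cases L with
        | nil => exact absurd rfl hL'
        | cons y _ => exact ⟨y, by simp⟩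
      obtain ⟨h3, h4⟩ := h2 y hy
      have hxy := (List.isChain_cons.1 hch).1 y hy
      let V : Fin 2 → K[X] := fun i => ∑ j, C (x.2 i j) * W j
      have hVdeg : ∀ i, (V i).natDegree ≤ 2 * L.length := fun i =>
        natDegree_sum_le_of_forall_le _ _ fun j _ => (natDegree_C_mul_le _ _).trans (h4 j).1
      have hVc : (V (σ x.1)).coeff (2 * L.length) ≠ 0 := by
        have : (V (σ x.1)).coeff (2 * L.length) =
            x.2 (σ x.1) (σ y.1) * (W (σ y.1)).coeff (2 * L.length) := by
          simp only [V, finsetSum_coeff, coeff_C_mul]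
          refine Finset.sum_eq_single _ (fun j _ hj => ?_) (by simp)
          rw [coeff_eq_zero_of_natDegree_lt ((h4 j).2 hj), mul_zero]
        rw [this]
        exact mul_ne_zero hxy h3
      have hVe : ∀ τ i, (V i).eval τ = (x.2.mulVec fun j => (W j).eval τ) i := by
        intro τ i
        simp [V, Matrix.mulVec, dotProduct]
      refine ⟨w, fun i => if i = σ x.1 then X ^ 2 * V i else V i, ?_, ?_⟩
      · intro τ hτ i
        have h5 : (fun j => (W j).eval τ) = τ ^ L.length •
            ((L.map (fun x : ℤˣ × Matrix (Fin 2) (Fin 2) K =>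
            !![τ ^ (x.1 : ℤ), 0; 0, τ ^ (-(x.1 : ℤ))] * x.2)).prod.mulVec w) := by
          ext j; rw [h1 τ hτ j]; simp
        rw [List.map_cons, List.prod_cons, ← Matrix.mulVec_mulVec, ← Matrix.mulVec_mulVec,
          List.length_cons, pow_succ τ, mul_assoc, hD τ hτ]
        have h6 : (V i).eval τ = τ ^ L.length *
            (x.2.mulVec ((L.map (fun x : ℤˣ × Matrix (Fin 2) (Fin 2) K =>
            !![τ ^ (x.1 : ℤ), 0; 0, τ ^ (-(x.1 : ℤ))] * x.2)).prod.mulVec w)) i := by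
          rw [hVe, h5, Matrix.mulVec_smul]; simp
        beta_reduce
        split_ifs with h
        · rw [eval_mul, h6]; simp; ring
        · rw [h6]
      · intro z hz
        obtain rfl : x = z := by simpa using hz
        refine ⟨?_, fun i => ⟨?_, fun hi => ?_⟩⟩
        · simp only [if_true, List.length_cons]
          rw [show 2 * (L.length + 1) = 2 * L.length + 2 by ring, coeff_X_pow_mul]
          exact hVc
        · have := hVdeg i
          simp only [List.length_cons]
          split_ifs
          · refine natDegree_mul_le.trans ?_
            rw [natDegree_X_pow]; omega
          · omega
        · have := hVdeg i
          simp only [hi, if_false, List.length_cons]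
          omega

/-- Powers of `u` with large exponents do not create relations. -/
theorem IsAnisotropicRep.finite_setOf_prod_eq_one {H : Type*} [Group H] [IsMulTorsionFree H]
    {K : Type*} [Field K] [IsAlgClosed K] [CharZero K] {ρ : H →* Matrix (Fin 2) (Fin 2) K}
    (hρ : IsAnisotropicRep ρ) {u : H} (hu : u ≠ 1) (h : H) (L : List (ℤˣ × H)) (hL : L ≠ [])
    (hch : L.IsChain (fun a b => Commute a.2 u → a.1 = b.1)) :
    {N : ℕ | h * (L.map (fun x => (u ^ N) ^ (x.1 : ℤ) * x.2)).prod = 1}.Finite := by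
  obtain ⟨ρ, hρ, l, r, hlr, hne, hd⟩ := hρ.exists_diagonal hu
  have hl0 : l ≠ 0 := left_ne_zero_of_mul_eq_one hlr
  have hr : r = l⁻¹ := (eq_inv_of_mul_eq_one_right hlr)
  have hpow : ∀ z : ℤ, ρ (u ^ z) = !![l ^ z, 0; 0, l ^ (-z)] := by
    have hn : ∀ n : ℕ, ρ (u ^ n) = !![l ^ n, 0; 0, (l ^ n)⁻¹] := by
      intro n
      induction n with
      | zero => simp [Matrix.one_fin_two]
      | succ n ih =>
        rw [pow_succ, map_mul, ih, hd, hr]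
        ext i j
        fin_cases i <;> fin_cases j <;>
          simp [Matrix.mul_apply, Fin.sum_univ_two, pow_succ, mul_comm]
    intro z
    obtain ⟨n, rfl | rfl⟩ := z.eq_nat_or_neg
    · rw [zpow_natCast, hn]; simp
    · rw [zpow_neg, hρ.apply_inv, zpow_natCast, hn]; simp
  let σ : ℤˣ → Fin 2 := fun e => if e = 1 then 0 else 1
  have hσ1 : σ 1 = 0 := by simp [σ]
  have hσ2 : σ (-1) = 1 := by simp [σ]
  let L' : List (ℤˣ × Matrix (Fin 2) (Fin 2) K) := L.map fun x => (x.1, ρ x.2)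
  obtain ⟨w, W, h1, h2⟩ := exists_polynomial_vector_of_chain L' (by simpa [L'] using hL)
    (by
      intro x hx
      obtain ⟨y, _, rfl⟩ := List.mem_map.1 hx
      exact hρ.1 _) σ hσ1 hσ2
    -- An element that commutes with `u` is diagonal, and then the signs agree, so a diagonal entry
    -- is asked for; for any other element all entries are non-zero.
    (by
      refine List.isChain_map_of_isChain _ (fun a b hab => ?_) hch
      dsimp only
      by_cases hc : Commute a.2 u
      · have hc' := (hρ.commute_iff_of_diagonal hne hd _).1 hc
        have hdet := hρ.1 a.2
        rw [Matrix.det_fin_two, hc'.1, zero_mul, sub_zero] at hdet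
        rw [← hab hc]
        have h00 := left_ne_zero_of_mul_eq_one hdet
        have h11 := right_ne_zero_of_mul_eq_one hdet
        rcases Int.units_eq_one_or a.1 with h | h <;> rw [h]
        · rw [hσ1]; exact h00
        · rw [hσ2]; exact h11
      · exact hρ.entry_ne_zero_of_not_commute hlr hne hd hc _ _)
  obtain ⟨x, hx⟩ : ∃ x, x ∈ L'.head? := by
    cases L with
    | nil => exact absurd rfl hL
    | cons y _ => exact ⟨(y.1, ρ y.2), by simp [L']⟩
  obtain ⟨h3, h4⟩ := h2 x hx
  classical
  have hlen : 0 < L'.length := by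
    cases L with
    | nil => exact absurd rfl hL
    | cons y _ => simp [L']
  let c : K := ((ρ h⁻¹).mulVec w) (σ x.1)
  -- If the product is `1` for the exponent `N`, then `l ^ N` is a root of `p`. The term subtracted
  -- has degree at most the length, half of the degree of `W (σ x.1)`, so it cannot cancel the
  -- leading term.
  let p : Polynomial K := W (σ x.1) - Polynomial.C c * Polynomial.X ^ L'.length
  have hp : p ≠ 0 := by
    intro h0
    have : p.coeff (2 * L'.length) = (W (σ x.1)).coeff (2 * L'.length) := by
      simp only [p, Polynomial.coeff_sub, Polynomial.coeff_C_mul, Polynomial.coeff_X_pow]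
      rw [if_neg (by omega)]; simp
    rw [h0] at this
    exact h3 (by rw [← this]; simp)
  have hinj : Function.Injective fun N : ℕ => l ^ N := by
    intro N M hNM
    have : u ^ ((N : ℤ) - M) = 1 := by
      apply hρ.eq_one_of_trace
      have : l ^ ((N : ℤ) - M) = 1 := by
        rw [zpow_sub₀ hl0]
        simp only at hNM
        rw [zpow_natCast, zpow_natCast, hNM, div_self (pow_ne_zero _ hl0)]
      rw [hpow, Matrix.trace_fin_two, zpow_neg, this]
      norm_num
    have := (IsMulTorsionFree.zpow_eq_one_iff_right hu).1 this
    omega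
  refine Set.Finite.subset (Set.Finite.preimage hinj.injOn
    (s := (p.roots.toFinset : Set K)) (Finset.finite_toSet _)) ?_
  intro N hN
  simp only [Set.mem_ofPred_eq] at hN
  simp only [Set.mem_preimage, Finset.mem_coe, Multiset.mem_toFinset, Polynomial.mem_roots hp,
    Polynomial.IsRoot]
  have h5 := h1 (l ^ N) (pow_ne_zero _ hl0) (σ x.1)
  have h6 : (L'.map (fun x : ℤˣ × Matrix (Fin 2) (Fin 2) K =>
      !![(l ^ N) ^ (x.1 : ℤ), 0; 0, (l ^ N) ^ (-(x.1 : ℤ))] * x.2)).prod =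
      ρ h⁻¹ := by
    have : (L.map (fun x => (u ^ N) ^ (x.1 : ℤ) * x.2)).prod = h⁻¹ := by
      rw [eq_comm, inv_eq_iff_mul_eq_one]; exact hN
    rw [← this, map_list_prod, List.map_map, List.map_map]
    congr 1
    refine List.map_congr_left fun y _ => ?_
    simp only [Function.comp, map_mul]
    rw [← zpow_natCast u, ← zpow_mul, hpow, ← zpow_natCast l, ← zpow_mul, ← zpow_mul]
    simp
  rw [h6] at h5
  simp only [p, Polynomial.eval_sub, Polynomial.eval_mul, Polynomial.eval_C, Polynomial.eval_pow,
    Polynomial.eval_X]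
  rw [h5]; ring

/-! ### An anisotropic representation of a free group. -/

open Polynomial in
/-- `T` times a matrix with eigenvalues `T` and `T⁻¹`, on `(p, 1)` and `(q, 1)`. -/
noncomputable def hyperbolicMatrix {k : Type*} [Field k] (p q : k) :
    Matrix (Fin 2) (Fin 2) k[X] :=
  C (p - q)⁻¹ • !![C p * X ^ 2 - C q, -(C (p * q) * (X ^ 2 - 1)); X ^ 2 - 1, -(C q * X ^ 2) + C p]

section FreeGroupRep

open Polynomial

variable {k : Type*} [Field k]

theorem hyperbolicMatrix_det {p q : k} (h : p ≠ q) : (hyperbolicMatrix p q).det = X ^ 2 := by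
  have h' : p - q ≠ 0 := sub_ne_zero.2 h
  have hC : C (p - q)⁻¹ * (C p - C q) = (1 : k[X]) := by
    rw [← C_sub, ← C_mul, inv_mul_cancel₀ h', C_1]
  rw [hyperbolicMatrix, Matrix.det_smul, Matrix.det_fin_two]
  simp only [Fintype.card_fin, Matrix.of_apply, Matrix.cons_val', Matrix.cons_val_zero,
    Matrix.cons_val_one, Matrix.cons_val_fin_one, C_mul]
  linear_combination X ^ 2 * (C (p - q)⁻¹ * (C p - C q) + 1) * hC

theorem hyperbolicMatrix_mul_swap {p q : k} (h : p ≠ q) :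
    hyperbolicMatrix p q * hyperbolicMatrix q p = (X ^ 2 : k[X]) • 1 := by
  have h' : p - q ≠ 0 := sub_ne_zero.2 h
  have hC : C (p - q)⁻¹ * (C p - C q) = (1 : k[X]) := by
    rw [← C_sub, ← C_mul, inv_mul_cancel₀ h', C_1]
  have hC' : C (q - p)⁻¹ = - C (p - q)⁻¹ := by
    rw [← C_neg, ← inv_neg, neg_sub]
  rw [hyperbolicMatrix, hyperbolicMatrix, hC']
  ext1 i j
  fin_cases i <;> fin_cases j <;>
    simp [Matrix.mul_apply, Fin.sum_univ_two]
  all_goals first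
    | linear_combination X ^ 2 * (C (p - q)⁻¹ * (C p - C q) + 1) * hC
    | ring1

theorem hyperbolicMatrix_natDegree_le (p q : k) (i j : Fin 2) :
    (hyperbolicMatrix p q i j).natDegree ≤ 2 := by
  fin_cases i <;> fin_cases j <;> simp [hyperbolicMatrix] <;> compute_degree

/-- The top coefficient is the projection onto the attracting line, spanned by `(p, 1)`, along the
repelling line, spanned by `(q, 1)`. Having rank one, such coefficients are easy to multiply along a
word. -/
theorem hyperbolicMatrix_coeff (p q : k) :
    (hyperbolicMatrix p q).map (fun f => f.coeff 2) =
      Matrix.vecMulVec ![p, 1] ![(p - q)⁻¹, -((p - q)⁻¹ * q)] := by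
  ext i j
  fin_cases i <;> fin_cases j <;>
    simp [hyperbolicMatrix, Matrix.vecMulVec, coeff_one, -map_sub, -map_mul] <;> ring

variable {ι : Type*} (a : ι × Bool → k)

/-- The matrix of a letter. -/
noncomputable def letterMatrix (l : ι × Bool) : Matrix (Fin 2) (Fin 2) k[X] :=
  hyperbolicMatrix (a l) (a (l.1, !l.2))

theorem natDegree_prod_letterMatrix_le (L : List (ι × Bool)) (i j : Fin 2) :
    ((L.map (letterMatrix a)).prod i j).natDegree ≤ 2 * L.length := by
  induction L generalizing i with
  | nil => rw [List.map_nil, List.prod_nil, Matrix.one_apply]; split_ifs <;> simp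
  | cons l L ih =>
    rw [List.map_cons, List.prod_cons, Matrix.mul_apply, List.length_cons]
    refine natDegree_sum_le_of_forall_le _ _ fun c _ => natDegree_mul_le.trans ?_
    have := ih c
    have := hyperbolicMatrix_natDegree_le (a l) (a (l.1, !l.2)) i c
    rw [letterMatrix]
    omega

theorem coeff_prod_letterMatrix (L : List (ι × Bool)) :
    (L.map (letterMatrix a)).prod.map (fun f => f.coeff (2 * L.length)) =
      (L.map fun l => Matrix.vecMulVec ![a l, 1]
        ![(a l - a (l.1, !l.2))⁻¹, -((a l - a (l.1, !l.2))⁻¹ * a (l.1, !l.2))]).prod := by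
  induction L with
  | nil =>
    ext i j
    by_cases h : i = j <;> simp [h]
  | cons l L ih =>
    rw [List.map_cons, List.map_cons, List.prod_cons, List.prod_cons, ← ih,
      ← hyperbolicMatrix_coeff]
    ext i j
    rw [Matrix.map_apply, Matrix.mul_apply, Matrix.mul_apply, finsetSum_coeff]
    refine Finset.sum_congr rfl fun c _ => ?_
    rw [letterMatrix, Matrix.map_apply, Matrix.map_apply, List.length_cons, mul_add, mul_one,
      add_comm,
      coeff_mul_add_eq_of_natDegree_le (hyperbolicMatrix_natDegree_le _ _ _ _)
        (natDegree_prod_letterMatrix_le a L c j)]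

variable {a}

/-- In a product of rank-one projections each consecutive pair contributes a scalar, which vanishes
only if the attracting point of a letter is the repelling point of the letter before it. Since the
points are distinct, this would mean that the two letters are inverse to each other, which
reducedness excludes. -/
theorem exists_prod_vecMulVec_eq_smul (ha : Function.Injective a) (l : ι × Bool)
    (L : List (ι × Bool)) (hL : (l :: L).IsChain (fun x y => x.1 = y.1 → x.2 = y.2)) :
    ∃ c : k, c ≠ 0 ∧ ∀ l' ∈ (l :: L).getLast?, ((l :: L).map fun l => Matrix.vecMulVec ![a l, 1]
        ![(a l - a (l.1, !l.2))⁻¹, -((a l - a (l.1, !l.2))⁻¹ * a (l.1, !l.2))]).prod =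
      c • Matrix.vecMulVec ![a l, 1] ![(a l' - a (l'.1, !l'.2))⁻¹,
        -((a l' - a (l'.1, !l'.2))⁻¹ * a (l'.1, !l'.2))] := by
  induction L generalizing l with
  | nil => exact ⟨1, one_ne_zero, by simp⟩
  | cons x L ih =>
    obtain ⟨c, hc, h⟩ := ih x (List.isChain_cons.1 hL).2
    have hlx : l.1 = x.1 → l.2 = x.2 := (List.isChain_cons.1 hL).1 x (by simp)
    have h1 : a l - a (l.1, !l.2) ≠ 0 := by
      rw [sub_ne_zero]
      intro h
      have := congrArg Prod.snd (ha h)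
      simp at this
    have h2 : a x - a (l.1, !l.2) ≠ 0 := by
      rw [sub_ne_zero]
      intro h
      have h' := ha h
      have h3 := hlx (by rw [h'])
      rw [h'] at h3
      simp at h3
    refine ⟨c * ((a l - a (l.1, !l.2))⁻¹ * (a x - a (l.1, !l.2))), by positivity, ?_⟩
    intro l' hl'
    rw [List.map_cons, List.prod_cons, h l' (by simpa using hl'), Matrix.mul_smul,
      Matrix.vecMulVec_mul_vecMulVec, Matrix.vecMulVec_smul, smul_smul]
    congr 2
    simp
    ring

end FreeGroupRep

section

open Polynomial

/-- The trace of the product of rank-one matrices is one more scalar of the same kind, for the last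
and the first letter; this is where cyclic reducedness is used. The trace thus has degree at least
twice the length, and its square cannot be a monomial of degree at most twice the length. -/
theorem trace_prod_letterMatrix_ne {k : Type*} [Field k] {ι : Type*} {a : ι × Bool → k}
    (ha : Function.Injective a)
    {L : List (ι × Bool)} (hL : FreeGroup.IsCyclicallyReduced L) (h0 : L ≠ []) :
    (L.map (letterMatrix a)).prod.trace ^ 2 ≠ C 4 * X ^ (2 * L.length) := by
  obtain ⟨l, L, rfl⟩ := List.exists_cons_of_ne_nil h0
  obtain ⟨c, hc, h⟩ := exists_prod_vecMulVec_eq_smul ha l L hL.1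
  obtain ⟨l', hl'⟩ : ∃ l', l' ∈ (l :: L).getLast? := ⟨_, List.getLast?_eq_some_getLast h0⟩
  have hne := hL.2 l' hl' l (by simp)
  have key : (((l :: L).map (letterMatrix a)).prod.trace).coeff (2 * (l :: L).length) ≠ 0 := by
    have h1 := coeff_prod_letterMatrix a (l :: L)
    rw [h l' hl'] at h1
    have h2 := congrArg Matrix.trace h1
    rw [Matrix.trace_fin_two, Matrix.map_apply, Matrix.map_apply, ← coeff_add,
      ← Matrix.trace_fin_two, Matrix.trace_smul, Matrix.trace_vecMulVec] at h2
    rw [h2]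
    have h1 : a l' - a (l'.1, !l'.2) ≠ 0 := by
      rw [sub_ne_zero]
      intro h
      have := congrArg Prod.snd (ha h)
      simp at this
    have h2 : a l - a (l'.1, !l'.2) ≠ 0 := by
      rw [sub_ne_zero]
      intro h
      have h' := ha h
      have h3 := hne (by rw [h'])
      rw [h'] at h3
      simp at h3
    have h3 : ![a l, 1] ⬝ᵥ ![(a l' - a (l'.1, !l'.2))⁻¹, -((a l' - a (l'.1, !l'.2))⁻¹ *
        a (l'.1, !l'.2))] = (a l' - a (l'.1, !l'.2))⁻¹ * (a l - a (l'.1, !l'.2)) := by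
      simp [dotProduct]; ring
    rw [h3, smul_eq_mul]
    positivity
  intro heq
  have hdeg : 2 * (l :: L).length ≤ ((l :: L).map (letterMatrix a)).prod.trace.natDegree :=
    le_natDegree_of_ne_zero key
  have := congrArg natDegree heq
  rw [natDegree_pow] at this
  have h4 := natDegree_C_mul_X_pow_le (4 : k) (2 * (l :: L).length)
  simp only [List.length_cons] at *
  omega

/-- Each letter gets its own indeterminate as attracting point and the point of the inverse letter
as repelling point; a further indeterminate `T` is the common eigenvalue. Traces are invariant under
conjugation, so it suffices to treat cyclically reduced words. -/
theorem exists_isAnisotropicRep_freeGroup (ι : Type u) :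
    ∃ (K : Type u) (_ : Field K) (_ : IsAlgClosed K) (_ : CharZero K)
      (ρ : FreeGroup ι →* Matrix (Fin 2) (Fin 2) K), IsAnisotropicRep ρ := by
  classical
  let k := FractionRing (MvPolynomial (ι × Bool) ℚ)
  let a : ι × Bool → k := fun l => algebraMap (MvPolynomial (ι × Bool) ℚ) k (MvPolynomial.X l)
  have ha : Function.Injective a := (IsFractionRing.injective _ _).comp
    (MvPolynomial.X_injective)
  let K := AlgebraicClosure (FractionRing k[X])
  let f : k[X] →+* K := (algebraMap (FractionRing k[X]) K).comp (algebraMap k[X] _)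
  have hf : Function.Injective f := (algebraMap (FractionRing k[X]) K).injective.comp
    (IsFractionRing.injective _ _)
  have : CharZero k := algebraRat.charZero k
  have : CharZero K := algebraRat.charZero K
  let T : K := f X
  have hT : T ≠ 0 := by
    intro h
    exact X_ne_zero (hf (h.trans (map_zero f).symm))
  have hab : ∀ l : ι × Bool, a l ≠ a (l.1, !l.2) := by
    intro l h
    have := congrArg Prod.snd (ha h)
    simp at this
  let A : ι × Bool → Matrix (Fin 2) (Fin 2) K := fun l => T⁻¹ • (letterMatrix a l).map f
  have hdetA : ∀ l, (A l).det = 1 := by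
    intro l
    have : ((letterMatrix a l).map f).det = T ^ 2 := by
      rw [← RingHom.mapMatrix_apply, ← RingHom.map_det, letterMatrix,
        hyperbolicMatrix_det (hab l), map_pow]
    simp only [A, Matrix.det_smul, this, Fintype.card_fin]
    rw [inv_pow, inv_mul_cancel₀ (pow_ne_zero _ hT)]
  have hAA : ∀ l : ι × Bool, A l * A (l.1, !l.2) = 1 := by
    intro l
    have : (letterMatrix a l).map f * (letterMatrix a (l.1, !l.2)).map f = T ^ 2 • 1 := by
      rw [← Matrix.map_mul, letterMatrix, letterMatrix]
      simp only [Bool.not_not]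
      rw [hyperbolicMatrix_mul_swap (hab l)]
      ext i j
      simp only [Matrix.map_apply, Matrix.smul_apply, smul_eq_mul, map_mul, map_pow,
        Matrix.one_apply]
      split_ifs <;> simp [T]
    simp only [A, Matrix.smul_mul, Matrix.mul_smul, this, smul_smul]
    rw [show T⁻¹ * (T⁻¹ * T ^ 2) = 1 by rw [← mul_assoc, ← sq, inv_pow, inv_mul_cancel₀ (pow_ne_zero _ hT)],
      one_smul]
  let U : ι → (Matrix (Fin 2) (Fin 2) K)ˣ := fun i =>
    ⟨A (i, true), A (i, false), hAA (i, true), hAA (i, false)⟩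
  let ρ : FreeGroup ι →* Matrix (Fin 2) (Fin 2) K :=
    (Units.coeHom _).comp (FreeGroup.lift U)
  have hρ : ∀ L : List (ι × Bool), ρ (FreeGroup.mk L) =
      T⁻¹ ^ L.length • (L.map (letterMatrix a)).prod.map f := by
    intro L
    induction L with
    | nil =>
      rw [← FreeGroup.one_eq_mk, map_one]
      simp
    | cons l L ih =>
      have h1 : FreeGroup.mk (l :: L) = FreeGroup.mk [l] * FreeGroup.mk L := by
        rw [FreeGroup.mul_mk]; rfl
      have h2 : ρ (FreeGroup.mk [l]) = A l := by
        obtain ⟨i, b⟩ := l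
        cases b <;> simp [ρ, U, FreeGroup.lift_mk]
      rw [h1, map_mul, ih, h2, List.map_cons, List.prod_cons, Matrix.map_mul, List.length_cons]
      simp only [A, Matrix.smul_mul, Matrix.mul_smul, smul_smul, pow_succ']
      rw [mul_comm]
  refine ⟨K, inferInstance, inferInstance, inferInstance, ρ, fun g => ?_, fun g hg => ?_⟩
  · obtain ⟨L, rfl⟩ : ∃ L, FreeGroup.mk L = g := ⟨g.toWord, FreeGroup.mk_toWord⟩
    induction L with
    | nil => rw [← FreeGroup.one_eq_mk, map_one, Matrix.det_one]
    | cons l L ih =>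
      have h1 : FreeGroup.mk (l :: L) = FreeGroup.mk [l] * FreeGroup.mk L := by
        rw [FreeGroup.mul_mk]; rfl
      have h2 : ρ (FreeGroup.mk [l]) = A l := by
        obtain ⟨i, b⟩ := l
        cases b <;> simp [ρ, U, FreeGroup.lift_mk]
      rw [h1, map_mul, Matrix.det_mul, h2, ih, hdetA, mul_one]
  · obtain ⟨L, hLr, rfl⟩ : ∃ L, FreeGroup.IsReduced L ∧ FreeGroup.mk L = g :=
      ⟨g.toWord, FreeGroup.isReduced_toWord, FreeGroup.mk_toWord⟩
    have hc := FreeGroup.reduceCyclically.conj_conjugator_reduceCyclically L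
    have hcr := FreeGroup.reduceCyclically.isCyclicallyReduced hLr
    generalize FreeGroup.reduceCyclically L = M at hc hcr
    generalize FreeGroup.reduceCyclically.conjugator L = N at hc
    have h1 : FreeGroup.mk L = FreeGroup.mk N * FreeGroup.mk M * (FreeGroup.mk N)⁻¹ := by
      rw [← hc, FreeGroup.inv_mk, FreeGroup.mul_mk, FreeGroup.mul_mk]
    have hM : M ≠ [] := by
      rintro rfl
      apply hg
      rw [h1, ← FreeGroup.one_eq_mk, mul_one, mul_inv_cancel]
    have h2 : (ρ (FreeGroup.mk L)).trace = (ρ (FreeGroup.mk M)).trace := by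
      rw [h1, map_mul, map_mul, Matrix.trace_mul_comm, ← mul_assoc, ← map_mul, inv_mul_cancel,
        map_one, one_mul]
    rw [h2, hρ]
    intro h3
    apply trace_prod_letterMatrix_ne ha hcr hM
    apply hf
    rw [Matrix.trace_smul] at h3
    have h4 : ((M.map (letterMatrix a)).prod.map f).trace =
        f (M.map (letterMatrix a)).prod.trace := by
      rw [Matrix.trace_fin_two, Matrix.trace_fin_two, map_add]; rfl
    rw [h4, smul_eq_mul, mul_pow] at h3
    have h5 : (f (M.map (letterMatrix a)).prod.trace) ^ 2 = 4 * T ^ (2 * M.length) := by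
      have h5 : T⁻¹ ^ M.length * T ^ M.length = 1 := by
        rw [← mul_pow, inv_mul_cancel₀ hT, one_pow]
      rw [← h3, pow_mul' T]
      linear_combination (-f (M.map (letterMatrix a)).prod.trace ^ 2) *
        (T⁻¹ ^ M.length * T ^ M.length + 1) * h5
    rw [map_pow, h5, map_mul, map_pow, map_ofNat C 4, map_ofNat f 4]

end

/-! ### Commutation in fully residually free groups. -/

section FullyResiduallyFree

theorem FreeGroup.commute_trans {ι : Type*} {u a b : FreeGroup ι} (hu : u ≠ 1)
    (ha : Commute a u) (hb : Commute b u) : Commute a b := by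
  obtain ⟨K, _, _, _, ρ, hρ⟩ := exists_isAnisotropicRep_freeGroup ι
  exact hρ.commute_trans hu ha hb

theorem FreeGroup.commute_of_commute_conj {ι : Type*} {u g : FreeGroup ι} (hu : u ≠ 1)
    (h : Commute (g * u * g⁻¹) u) : Commute g u := by
  obtain ⟨K, _, _, _, ρ, hρ⟩ := exists_isAnisotropicRep_freeGroup ι
  exact hρ.commute_of_commute_conj hu h

theorem mul_inv_mul_inv_eq_one_iff_commute {H : Type*} [Group H] {a b : H} :
    a * b * a⁻¹ * b⁻¹ = 1 ↔ Commute a b := by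
  rw [mul_inv_eq_one, mul_inv_eq_iff_eq_mul]; rfl

namespace IsFullyResiduallyFree

variable {H : Type u} [Group H]

/-- A failure is witnessed by two non-trivial elements, `u` and a commutator; a homomorphism to a
free group that keeps both would carry the failure there. -/
theorem commute_trans (hH : IsFullyResiduallyFree H) {u a b : H} (hu : u ≠ 1)
    (ha : Commute a u) (hb : Commute b u) : Commute a b := by
  classical
  by_contra hab
  obtain ⟨ι, f, hf⟩ := hH {u, a * b * a⁻¹ * b⁻¹} (by
    intro g hg
    rcases Finset.mem_insert.1 hg with rfl | hg
    · exact hu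
    · rw [Finset.mem_singleton.1 hg]
      exact fun h => hab (mul_inv_mul_inv_eq_one_iff_commute.1 h))
  refine hf (a * b * a⁻¹ * b⁻¹) (by simp) ?_
  have := FreeGroup.commute_trans (hf u (by simp)) (ha.map f) (hb.map f)
  simpa using mul_inv_mul_inv_eq_one_iff_commute.2 this

theorem commute_of_commute_conj (hH : IsFullyResiduallyFree H) {u g : H} (hu : u ≠ 1)
    (h : Commute (g * u * g⁻¹) u) : Commute g u := by
  classical
  by_contra hab
  obtain ⟨ι, f, hf⟩ := hH {u, g * u * g⁻¹ * u⁻¹} (by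
    intro x hx
    rcases Finset.mem_insert.1 hx with rfl | hx
    · exact hu
    · rw [Finset.mem_singleton.1 hx]
      exact fun h => hab (mul_inv_mul_inv_eq_one_iff_commute.1 h))
  refine hf (g * u * g⁻¹ * u⁻¹) (by simp) ?_
  have := FreeGroup.commute_of_commute_conj (u := f u) (g := f g) (hf u (by simp))
    (by simpa using h.map f)
  simpa using mul_inv_mul_inv_eq_one_iff_commute.2 this

end IsFullyResiduallyFree

/-! ### Extensions of centralizers: residual freeness and consequences of Britton's lemma. -/

namespace CentralizerExtension

open HNNExtension

variable {H : Type u} [Group H] {w : H}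

/-- The homomorphism from an extension of a centralizer given by the image of the base group and
the image of the new letter. -/
def lift {K : Type*} [Group K] (f : H →* K) (x : K) (hx : ∀ h, Commute h w → Commute x (f h)) :
    CentralizerExtension H w →* K :=
  HNNExtension.lift f x fun a => hx a (Subgroup.mem_centralizer_singleton_iff.1 a.2)

@[simp]
theorem lift_of {K : Type*} [Group K] (f : H →* K) (x : K)
    (hx : ∀ h, Commute h w → Commute x (f h)) (h : H) : lift f x hx (of h) = f h :=
  HNNExtension.lift_of _ _ _ _

@[simp]
theorem lift_t {K : Type*} [Group K] (f : H →* K) (x : K)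
    (hx : ∀ h, Commute h w → Commute x (f h)) : lift f x hx t = x :=
  HNNExtension.lift_t _ _ _

theorem commute_t_of {h : H} (hh : Commute h w) :
    Commute (t : CentralizerExtension H w) (of h) :=
  t_mul_of (φ := MulEquiv.refl _) ⟨h, Subgroup.mem_centralizer_singleton_iff.2 hh⟩

theorem mem_toSubgroup {h : H} (e : ℤˣ) :
    h ∈ toSubgroup (Subgroup.centralizer {w}) (Subgroup.centralizer {w}) e ↔ Commute h w := by
  rcases Int.units_eq_one_or e with rfl | rfl <;>
    exact Subgroup.mem_centralizer_singleton_iff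

/-- The retraction that maps the new letter to `w ^ N`. -/
def retraction (w : H) (N : ℕ) : CentralizerExtension H w →* H :=
  lift (MonoidHom.id H) (w ^ N) fun _ hh => (hh.symm.pow_left N)

@[simp]
theorem retraction_of (N : ℕ) (h : H) : retraction w N (of h) = h := lift_of _ _ _ _

theorem exists_reduced_list (g : CentralizerExtension H w) :
    ∃ (h : H) (L : List (ℤˣ × H)), L.IsChain (fun a b => Commute a.2 w → a.1 = b.1) ∧
      g = of h * (L.map fun x => (t : CentralizerExtension H w) ^ (x.1 : ℤ) * of x.2).prod := by
  obtain ⟨d⟩ := NormalWord.TransversalPair.nonempty H (Subgroup.centralizer {w})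
    (Subgroup.centralizer {w})
  let W := NormalWord.equiv (MulEquiv.refl _) d g
  refine ⟨W.head, W.toList, ?_, ?_⟩
  · refine W.chain.imp fun a b h1 h2 => h1 ((mem_toSubgroup _).2 h2)
  · exact ((NormalWord.equiv (MulEquiv.refl _) d).symm_apply_apply g).symm

/-- Reducedness of finitely many words depends on finitely many elements of `H` being non-trivial. A
homomorphism to a free group that preserves this turns the words into products with powers of `f w`
to which the big powers property applies, so that only finitely many `N` are bad for each element.
-/
theorem exists_retraction_of_finset (hH : IsFullyResiduallyFree H) (hw : w ≠ 1)
    (A : Finset (CentralizerExtension H w)) (hA : ∀ g ∈ A, g ≠ 1) :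
    ∃ (N : ℕ) (ι : Type) (f : H →* FreeGroup ι), ∀ g ∈ A, f (retraction w N g) ≠ 1 := by
  classical
  choose hd L hch hprod using exists_reduced_list (w := w)
  -- The commutators with `w` are included so that a letter whose image commutes with `f w` already
  -- commutes with `w`. The heads matter only for elements whose reduced word has no letter `t`.
  let S : Finset H := insert w (A.biUnion fun g => insert (hd g)
    ((L g).map fun x => x.2 * w * x.2⁻¹ * w⁻¹).toFinset)
  obtain ⟨ι, f, hf⟩ := hH (S.filter (· ≠ 1)) (fun g hg => (Finset.mem_filter.1 hg).2)
  have hf' : ∀ s ∈ S, f s = 1 → s = 1 := by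
    intro s hs h1
    by_contra h2
    exact hf s (Finset.mem_filter.2 ⟨hs, h2⟩) h1
  have hfw : f w ≠ 1 := fun h => hw (hf' w (Finset.mem_insert_self _ _) h)
  obtain ⟨K, _, _, _, ρ, hρ⟩ := exists_isAnisotropicRep_freeGroup ι
  have hfin : ∀ g ∈ A, {N : ℕ | f (retraction w N g) = 1}.Finite := by
    intro g hg
    have hval : ∀ N, f (retraction w N g) = f (hd g) *
        (((L g).map fun x => (x.1, f x.2)).map fun x => (f w ^ N) ^ (x.1 : ℤ) * x.2).prod := by
      intro N
      conv_lhs => rw [hprod g]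
      simp only [map_mul, map_list_prod, List.map_map, retraction_of]
      congr 2
      refine List.map_congr_left fun x _ => ?_
      simp [retraction]
    by_cases hL : L g = []
    · have : g = of (hd g) := by
        conv_lhs => rw [hprod g, hL]
        simp
      convert Set.finite_empty
      ext N
      simp only [Set.mem_ofPred_eq, Set.mem_empty_iff_false, iff_false]
      rw [hval, hL]
      simp only [List.map_nil, List.prod_nil, mul_one]
      intro h
      have := hf' _ (Finset.mem_insert_of_mem
        (Finset.mem_biUnion.2 ⟨g, hg, Finset.mem_insert_self _ _⟩)) h
      apply hA g hg
      rw [‹g = _›, this, map_one]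
    · simp only [hval]
      refine hρ.finite_setOf_prod_eq_one hfw _ _ (by simpa using hL) ?_
      rw [List.isChain_map]
      refine (hch g).imp_of_mem_imp fun a b ha _ hab hc => hab ?_
      rw [← mul_inv_mul_inv_eq_one_iff_commute]
      refine hf' _ (Finset.mem_insert_of_mem (Finset.mem_biUnion.2 ⟨g, hg,
        Finset.mem_insert_of_mem (List.mem_toFinset.2 (List.mem_map.2 ⟨a, ha, rfl⟩))⟩)) ?_
      simpa using mul_inv_mul_inv_eq_one_iff_commute.2 hc
  obtain ⟨N, hN⟩ := (Set.Finite.biUnion A.finite_toSet hfin).exists_notMem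
  exact ⟨N, ι, f, fun g hg h => hN (Set.mem_biUnion hg h)⟩

theorem isFullyResiduallyFree (hH : IsFullyResiduallyFree H) (hw : w ≠ 1) :
    IsFullyResiduallyFree (CentralizerExtension H w) := by
  intro A hA
  obtain ⟨N, ι, f, hf⟩ := exists_retraction_of_finset hH hw A hA
  exact ⟨ι, f.comp (retraction w N), hf⟩

theorem exists_retraction_ne_one (hH : IsFullyResiduallyFree H) (hw : w ≠ 1)
    {g : CentralizerExtension H w} (hg : g ≠ 1) : ∃ N, retraction w N g ≠ 1 := by
  obtain ⟨N, ι, f, hf⟩ := exists_retraction_of_finset hH hw {g} (by simpa using hg)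
  exact ⟨N, fun h => hf g (Finset.mem_singleton_self _) (by rw [h, map_one])⟩

theorem of_injective : Function.Injective (of : H →* CentralizerExtension H w) :=
  HNNExtension.of_injective _

theorem of_eq_one_iff {h : H} : (of h : CentralizerExtension H w) = 1 ↔ h = 1 := by
  rw [← map_one (of : H →* CentralizerExtension H w)]
  exact of_injective.eq_iff

theorem commute_of_of_iff {a b : H} :
    Commute (of a : CentralizerExtension H w) (of b) ↔ Commute a b := by
  simp only [Commute, SemiconjBy, ← map_mul]
  exact of_injective.eq_iff

/-- **Britton's lemma**. -/
theorem eq_nil_of_prod_mem_range (h : H) (L : List (ℤˣ × H))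
    (hch : L.IsChain (fun a b => Commute a.2 w → a.1 = b.1))
    (hmem : of h * (L.map fun x => (t : CentralizerExtension H w) ^ (x.1 : ℤ) * of x.2).prod ∈
      (of : H →* CentralizerExtension H w).range) : L = [] :=
  ReducedWord.toList_eq_nil_of_mem_of_range (MulEquiv.refl _)
    ⟨h, L, hch.imp fun _ _ h1 h2 => h1 ((mem_toSubgroup _).1 h2)⟩ hmem

theorem commute_t_zpow_of {h : H} (hh : Commute h w) (e : ℤ) :
    Commute ((t : CentralizerExtension H w) ^ e) (of h) :=
  (commute_t_of hh).zpow_left e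

theorem commute_and_eq_of_conj_eq_of {e : ℤˣ} {h g : H}
    (heq : (t : CentralizerExtension H w) ^ (e : ℤ) * of h * t ^ (-(e : ℤ)) = of g) :
    Commute h w ∧ h = g := by
  have hc : Commute h w := by
    by_contra hc
    have := eq_nil_of_prod_mem_range (w := w) 1 [(e, h), (-e, 1)] (by simp [hc])
      ⟨g, by rw [← heq]; simp⟩
    simp at this
  refine ⟨hc, of_injective (w := w) ?_⟩
  rw [← heq, (commute_t_zpow_of hc e).eq, mul_assoc, ← zpow_add]
  simp

/-- An element of the base group that commutes with `a * t ^ (-e) * b * t ^ e`, where `b` does not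
commute with `w`, is trivial. -/
theorem not_commute_of_mul_conj (hH : IsFullyResiduallyFree H) (e : ℤˣ) {a b g : H}
    (hb : ¬ Commute b w) (hg : g ≠ 1) :
    ¬ Commute (of g : CentralizerExtension H w)
      (of a * (t ^ (-(e : ℤ)) * of b * t ^ (e : ℤ))) := by
  intro hc
  have hw : w ≠ 1 := by
    rintro rfl
    exact hb (Commute.one_right b)
  -- The assumed commutation, with all occurrences of `t` on one side. By Britton's lemma the left
  -- side contains a pinch, and as `b` is not in the centralizer of `w` the pinch must be at `g`.
  have h1 : t ^ (-(e : ℤ)) * of b * t ^ (e : ℤ) * of g * t ^ (-(e : ℤ)) * of b⁻¹ * t ^ (e : ℤ) =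
      (of (a⁻¹ * g * a) : CentralizerExtension H w) := by
    have := hc.eq
    simp only [map_mul, map_inv, zpow_neg, mul_assoc] at this ⊢
    rw [eq_inv_mul_iff_mul_eq]
    simp only [← mul_assoc] at this ⊢
    rw [← this]
    group
  have hgw : Commute g w := by
    by_contra hgw
    have := eq_nil_of_prod_mem_range (w := w) 1 [(-e, b), (e, g), (-e, b⁻¹), (e, 1)]
      (by simp [hb, hgw])
      ⟨a⁻¹ * g * a, by rw [← h1]; simp [mul_assoc]⟩
    simp at this
  have h2 : t ^ (e : ℤ) * of g * t ^ (-(e : ℤ)) = (of g : CentralizerExtension H w) := by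
    rw [(commute_t_zpow_of hgw _).eq, mul_assoc, ← zpow_add]; simp
  have h3 : t ^ ((-e : ℤˣ) : ℤ) * of (b * g * b⁻¹) * t ^ (-((-e : ℤˣ) : ℤ)) =
      (of (a⁻¹ * g * a) : CentralizerExtension H w) := by
    rw [← h1, map_mul, map_mul]
    conv_lhs => rw [← h2]
    simp [mul_assoc]
  -- After removal of the pinch at `g`, the remaining pinch shows that `b g b⁻¹` commutes with `w`,
  -- hence with `g`; then `b` commutes with `g` and with `w`, a contradiction.
  have h4 := (commute_and_eq_of_conj_eq_of h3).1
  have h5 : Commute (b * g * b⁻¹) g := hH.commute_trans hw h4 hgw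
  have h6 : Commute b g := hH.commute_of_commute_conj hg h5
  exact hb (hH.commute_trans hg h6 hgw.symm)

/-- In the rearranged relation the exponents of `t` are `1, -1, -1, 1`. The arbitrary element `h`
stands between equal signs or outside, so only `a` and `b` have to avoid the centralizer of `w`. -/
theorem not_commute_of_mul_t {a b h : H} (ha : ¬ Commute a w) (hb : ¬ Commute b w) :
    ¬ Commute (of h * t : CentralizerExtension H w) (of a * (t⁻¹ * of b * t)) := by
  intro hc
  have h1 : t * of a * t⁻¹ * of (b * h⁻¹) * t⁻¹ * of b⁻¹ * t =
      (of (h⁻¹ * a) : CentralizerExtension H w) := by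
    have := hc.eq
    simp only [map_mul, map_inv, mul_assoc] at this ⊢
    rw [eq_inv_mul_iff_mul_eq]
    simp only [← mul_assoc] at this ⊢
    rw [mul_left_inj] at this
    rw [this]
    group
  have := eq_nil_of_prod_mem_range (w := w) 1 [(1, a), (-1, b * h⁻¹), (-1, b⁻¹), (1, 1)]
    (by simp [ha, hb])
    ⟨h⁻¹ * a, by rw [← h1]; simp [mul_assoc]⟩
  simp at this

/-- The relation reads `t⁻¹ g t = a g a⁻¹`, a pinch that forces `g` to commute with `w`; then `t`
disappears. This is why a twisted handle variable has a small centralizer. -/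
theorem commute_of_commute_t_mul {a g : H}
    (hc : Commute (of g : CentralizerExtension H w) (t * of a)) : Commute g w ∧ Commute g a := by
  have h1 : t ^ ((-1 : ℤˣ) : ℤ) * of g * t ^ (-((-1 : ℤˣ) : ℤ)) =
      (of (a * g * a⁻¹) : CentralizerExtension H w) := by
    have := hc.eq
    simp only [map_mul, map_inv, Units.val_neg, Units.val_one, zpow_neg, zpow_one, inv_inv]
    rw [eq_mul_inv_iff_mul_eq, mul_assoc, mul_assoc, inv_mul_eq_iff_eq_mul, this, mul_assoc]
  obtain ⟨h2, h3⟩ := commute_and_eq_of_conj_eq_of h1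
  exact ⟨h2, by rw [eq_mul_inv_iff_mul_eq] at h3; exact h3⟩

theorem commute_of_commute_conj_inv_mul {a b : H}
    (hc : Commute (t⁻¹ * of a * t : CentralizerExtension H w) (t⁻¹ * of b)) : Commute a b := by
  have h1 : t ^ ((-1 : ℤˣ) : ℤ) * of a * t ^ (-((-1 : ℤˣ) : ℤ)) =
      (of (b⁻¹ * a * b) : CentralizerExtension H w) := by
    have := hc.eq
    simp only [map_mul, map_inv, Units.val_neg, Units.val_one, zpow_neg, zpow_one, inv_inv]
    rw [mul_assoc (of b)⁻¹, eq_inv_mul_iff_mul_eq]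
    simpa only [mul_assoc, mul_inv_cancel_left, mul_right_inj] using this.symm
  obtain ⟨_, h3⟩ := commute_and_eq_of_conj_eq_of h1
  rw [mul_assoc, eq_inv_mul_iff_mul_eq] at h3
  exact h3.symm

end CentralizerExtension

end FullyResiduallyFree

/-! ### The injectivity criterion. -/

namespace CentralizerExtension

open HNNExtension

variable {H : Type u} [Group H] {w : H}

/-- Criterion for a homomorphism to an extension of a centralizer to be injective: the source is
generated by a subgroup mapped injectively to the base group, and letters `s j` mapped to elements
`p j * t * q j`, such that every pinch comes from the source. -/
theorem eq_one_of_mem_closure_of_map_eq_one {Γ J : Type*} [Group Γ]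
    (f : Γ →* CentralizerExtension H w) (φ : Γ →* H) (B : Subgroup Γ) (s : J → Γ) (p q : J → H)
    (hB : ∀ b ∈ B, f b = of (φ b)) (hs : ∀ j, f (s j) = of (p j) * t * of (q j))
    (hinj : ∀ b ∈ B, φ b = 1 → b = 1)
    (hq : ∀ i j, ∀ b ∈ B, Commute (q i * φ b * (q j)⁻¹) w → s i * b * (s j)⁻¹ ∈ B)
    (hp : ∀ i j, ∀ b ∈ B, Commute ((p i)⁻¹ * φ b * p j) w → (s i)⁻¹ * b * s j ∈ B) :
    ∀ γ ∈ Subgroup.closure (B ∪ Set.range s), f γ = 1 → γ = 1 := by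
  -- The image of `s j ^ e` is `l e j * t ^ e * r e j`; passing to the inverse exchanges the roles
  -- of `p` and `q`. The relation `R` says that no pinch occurs in the image between two consecutive
  -- syllables.
  let r : ℤˣ → J → H := fun e j => if e = 1 then q j else (p j)⁻¹
  let l : ℤˣ → J → H := fun e j => if e = 1 then p j else (q j)⁻¹
  let R : ℤˣ × J × Γ → ℤˣ × J × Γ → Prop := fun x y =>
    Commute (r x.1 x.2.1 * φ x.2.2 * l y.1 y.2.1) w → x.1 = y.1
  let P : List (ℤˣ × J × Γ) → Γ := fun L => (L.map fun x => s x.2.1 ^ (x.1 : ℤ) * x.2.2).prod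
  have hne : (-1 : ℤˣ) ≠ 1 := by decide
  have hpinch : ∀ e i j, ∀ b ∈ B, Commute (r e i * φ b * l (-e) j) w →
      s i ^ (e : ℤ) * b * s j ^ (-(e : ℤ)) ∈ B := by
    intro e i j b hb hc
    rcases Int.units_eq_one_or e with rfl | rfl
    · simpa using hq i j b hb (by simpa [r, l, hne] using hc)
    · simpa using hp i j b hb (by simpa [r, l, hne] using hc)
  have hfs : ∀ (e : ℤˣ) j, f (s j ^ (e : ℤ)) = of (l e j) * t ^ (e : ℤ) * of (r e j) := by
    intro e j
    rw [map_zpow, hs]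
    rcases Int.units_eq_one_or e with rfl | rfl
    · simp [r, l]
    · simp [r, l, hne, mul_assoc]
  have hstep : ∀ (e : ℤˣ) j, ∀ b ∈ B, ∀ L : List (ℤˣ × J × Γ), (∀ x ∈ L, x.2.2 ∈ B) →
      L.IsChain R → ∃ b' ∈ B, ∃ L' : List (ℤˣ × J × Γ), (∀ x ∈ L', x.2.2 ∈ B) ∧
        L'.IsChain R ∧ s j ^ (e : ℤ) * (b * P L) = b' * P L' := by
    intro e j b hb L hL hch
    by_cases hred : ((e, j, b) :: L).IsChain R
    · refine ⟨1, B.one_mem, (e, j, b) :: L, ?_, hred, by simp [P, mul_assoc]⟩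
      intro x hx
      rcases List.mem_cons.1 hx with rfl | hx
      · exact hb
      · exact hL x hx
    · cases L with
      | nil => exact absurd (List.isChain_singleton _) hred
      | cons x L =>
        rw [List.isChain_cons_cons, not_and_or] at hred
        have h1 : ¬ R (e, j, b) x := hred.resolve_right (not_not.2 hch)
        simp only [R, Classical.not_imp] at h1
        obtain ⟨h1, h2⟩ := h1
        have h3 : x.1 = -e := (Int.units_ne_iff_eq_neg.1 (Ne.symm h2))
        rw [h3] at h1
        refine ⟨s j ^ (e : ℤ) * b * s x.2.1 ^ (-(e : ℤ)) * x.2.2,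
          B.mul_mem (hpinch e j _ b hb h1) (hL x (by simp)), L,
          fun y hy => hL y (List.mem_cons_of_mem _ hy), (List.isChain_cons.1 hch).2, ?_⟩
        simp [P, h3, mul_assoc]
  -- Whenever the image has a pinch, the corresponding subword of the source lies in `B` and can be
  -- absorbed; so every element is spelled by a word whose image is already reduced.
  have hrep : ∀ γ ∈ Subgroup.closure (B ∪ Set.range s), ∃ b ∈ B, ∃ L : List (ℤˣ × J × Γ),
      (∀ x ∈ L, x.2.2 ∈ B) ∧ L.IsChain R ∧ γ = b * P L := by
    intro γ hγ
    induction hγ using Subgroup.closure_induction_left with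
    | one => exact ⟨1, B.one_mem, [], by simp, List.isChain_nil, by simp [P]⟩
    | mul_left x hx y _ ih =>
      obtain ⟨b, hb, L, hL, hch, rfl⟩ := ih
      rcases hx with hx | ⟨j, rfl⟩
      · exact ⟨x * b, B.mul_mem hx hb, L, hL, hch, by rw [mul_assoc]⟩
      · simpa using hstep 1 j b hb L hL hch
    | inv_mul_cancel x hx y _ ih =>
      obtain ⟨b, hb, L, hL, hch, rfl⟩ := ih
      rcases hx with hx | ⟨j, rfl⟩
      · exact ⟨x⁻¹ * b, B.mul_mem (B.inv_mem hx) hb, L, hL, hch, by rw [mul_assoc]⟩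
      · simpa using hstep (-1) j b hb L hL hch
  -- The left factor of the first syllable of the image, which is merged into the coefficient in
  -- front of it. The default `1` is for the empty word.
  let lead : List (ℤˣ × J × Γ) → H := fun L => (L.head?.map fun x => l x.1 x.2.1).getD 1
  have hconv : ∀ L : List (ℤˣ × J × Γ), (∀ x ∈ L, x.2.2 ∈ B) → L.IsChain R →
      ∃ M : List (ℤˣ × H), M.length = L.length ∧ M.head?.map Prod.fst = L.head?.map Prod.fst ∧
        M.IsChain (fun a b => Commute a.2 w → a.1 = b.1) ∧
        f (P L) = of (lead L) *
          (M.map fun x => (t : CentralizerExtension H w) ^ (x.1 : ℤ) * of x.2).prod := by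
    intro L
    induction L with
    | nil => exact fun _ _ => ⟨[], rfl, rfl, List.isChain_nil, by simp [P, lead]⟩
    | cons x L ih =>
      intro hL hch
      obtain ⟨M, h1, h2, h3, h4⟩ := ih (fun y hy => hL y (List.mem_cons_of_mem _ hy))
        (List.isChain_cons.1 hch).2
      refine ⟨(x.1, r x.1 x.2.1 * φ x.2.2 * lead L) :: M, by simp [h1], by simp, ?_, ?_⟩
      · refine List.isChain_cons.2 ⟨fun y hy hc => ?_, h3⟩
        cases L with
        | nil =>
          simp only [List.length_nil, List.length_eq_zero_iff] at h1
          simp [h1] at hy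
        | cons z L =>
          have h5 := (List.isChain_cons.1 hch).1 z (by simp) hc
          rw [Option.mem_def.1 hy] at h2
          simp only [Option.map_some, List.head?_cons, Option.some.injEq] at h2
          rw [h2]; exact h5
      · have : P (x :: L) = s x.2.1 ^ (x.1 : ℤ) * x.2.2 * P L := by simp [P]
        rw [this, map_mul, map_mul, hfs, hB _ (hL x (by simp)), h4]
        simp [lead, mul_assoc]
  intro γ hγ hf
  obtain ⟨b, hb, L, hL, hch, rfl⟩ := hrep γ hγ
  obtain ⟨M, h1, -, h3, h4⟩ := hconv L hL hch
  have hM : M = [] := by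
    refine eq_nil_of_prod_mem_range (w := w) (φ b * lead L) M h3 ⟨1, ?_⟩
    rw [map_one, ← hf, map_mul, h4, hB b hb, map_mul, mul_assoc]
  rw [hM] at h1
  have hL0 : L = [] := List.length_eq_zero_iff.1 h1.symm
  rw [hL0] at hf ⊢
  simp only [P, List.map_nil, List.prod_nil, mul_one] at hf ⊢
  rw [hB b hb, of_eq_one_iff] at hf
  exact hinj b hb hf

end CentralizerExtension

/-! ### Cyclic centralizers in a free product with an infinite cyclic group. -/

/-- The free product of `M` with an infinite cyclic group, as an HNN extension. -/
abbrev FreeLetterExtension (M : Type*) [Group M] : Type _ :=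
  HNNExtension M ⊥ ⊥ (MulEquiv.refl _)

namespace FreeLetterExtension

open HNNExtension

variable {M : Type*} [Group M]

theorem map_fst_eq_of_prod_eq {h h' : M} {L L' : List (ℤˣ × M)}
    (hch : L.IsChain (fun a b => a.2 = 1 → a.1 = b.1))
    (hch' : L'.IsChain (fun a b => a.2 = 1 → a.1 = b.1))
    (heq : of h * (L.map fun x => (t : FreeLetterExtension M) ^ (x.1 : ℤ) * of x.2).prod =
      of h' * (L'.map fun x => (t : FreeLetterExtension M) ^ (x.1 : ℤ) * of x.2).prod) :
    L.map Prod.fst = L'.map Prod.fst :=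
  (ReducedWord.map_fst_eq_and_of_prod_eq (MulEquiv.refl _)
    (w₁ := ⟨h, L, hch.imp fun a _ h1 h2 => h1 (by
      rcases Int.units_eq_one_or a.1 with h | h <;> rw [h] at h2 <;> exact h2)⟩)
    (w₂ := ⟨h', L', hch'.imp fun a _ h1 h2 => h1 (by
      rcases Int.units_eq_one_or a.1 with h | h <;> rw [h] at h2 <;> exact h2)⟩) heq).1

theorem exists_reduced_list (g : FreeLetterExtension M) :
    ∃ (h : M) (L : List (ℤˣ × M)), L.IsChain (fun a b => a.2 = 1 → a.1 = b.1) ∧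
      g = of h * (L.map fun x => (t : FreeLetterExtension M) ^ (x.1 : ℤ) * of x.2).prod := by
  obtain ⟨d⟩ := NormalWord.TransversalPair.nonempty M ⊥ ⊥
  let W := NormalWord.equiv (MulEquiv.refl _) d g
  refine ⟨W.head, W.toList, ?_, ((NormalWord.equiv (MulEquiv.refl _) d).symm_apply_apply g).symm⟩
  refine W.chain.imp fun a b h1 h2 => h1 ?_
  rw [h2]
  exact Subgroup.one_mem _

end FreeLetterExtension

namespace FreeLetterExtension

open HNNExtension

variable {M : Type*} [Group M]

/-- The element of the extension spelled by a word. -/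
def wordProd (h : M) (L : List (ℤˣ × M)) : FreeLetterExtension M :=
  of h * (L.map fun x => t ^ (x.1 : ℤ) * of x.2).prod

/-- A word is reduced if it has no subword `t t⁻¹` or `t⁻¹ t`. -/
def IsReducedWord (L : List (ℤˣ × M)) : Prop :=
  L.IsChain (fun a b => a.2 = 1 → a.1 = b.1)

theorem wordProd_cons (h : M) (e : ℤˣ) (a : M) (L : List (ℤˣ × M)) :
    wordProd h ((e, a) :: L) = of h * t ^ (e : ℤ) * wordProd a L := by
  simp [wordProd, mul_assoc]

theorem wordProd_append (h : M) (L : List (ℤˣ × M)) (L' : List (ℤˣ × M)) :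
    wordProd h (L ++ L') = wordProd h L * wordProd 1 L' := by
  simp [wordProd, mul_assoc]

theorem of_mul_wordProd (g h : M) (L : List (ℤˣ × M)) :
    of g * wordProd h L = wordProd (g * h) L := by
  simp [wordProd, mul_assoc]

theorem exists_isReducedWord_or_length_lt (h : M) (L : List (ℤˣ × M)) :
    IsReducedWord L ∨ ∃ (h' : M) (L' : List (ℤˣ × M)), IsReducedWord L' ∧
      L'.length < L.length ∧ wordProd h' L' = wordProd h L := by
  induction L generalizing h with
  | nil => exact Or.inl List.isChain_nil
  | cons x L ih =>
    obtain ⟨e, a⟩ := x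
    have key : ∀ (a' : M) (L' : List (ℤˣ × M)), IsReducedWord L' →
        IsReducedWord ((e, a') :: L') ∨ ∃ (h' : M) (L'' : List (ℤˣ × M)), IsReducedWord L'' ∧
          L''.length < L'.length + 1 ∧ wordProd h' L'' = wordProd h ((e, a') :: L') := by
      intro a' L' hL'
      by_cases hred : IsReducedWord ((e, a') :: L')
      · exact Or.inl hred
      · right
        cases L' with
        | nil => exact absurd (List.isChain_singleton _) hred
        | cons x L' =>
          rw [IsReducedWord, List.isChain_cons_cons, not_and_or] at hred
          have h1 := hred.resolve_right (not_not.2 hL')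
          rw [Classical.not_imp] at h1
          obtain ⟨h1, h2⟩ := h1
          dsimp only at h1 h2
          obtain ⟨e', b⟩ := x
          have h3 : e' = -e := Int.units_ne_iff_eq_neg.1 (Ne.symm h2)
          refine ⟨h * b, L', (List.isChain_cons.1 hL').2, by simp, ?_⟩
          rw [h1, wordProd_cons, wordProd_cons, h3, ← of_mul_wordProd h]
          have : wordProd b L' = of b * wordProd 1 L' := by rw [of_mul_wordProd, mul_one]
          simp [this, mul_assoc]
    rcases ih a with hL | ⟨a', L', h1, h2, h3⟩
    · exact key a L hL
    · right
      have h4 : wordProd h ((e, a') :: L') = wordProd h ((e, a) :: L) := by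
        rw [wordProd_cons, wordProd_cons, h3]
      rcases key a' L' h1 with h5 | ⟨h', L'', h5, h6, h7⟩
      · exact ⟨h, _, h5, by simpa using h2, h4⟩
      · exact ⟨h', L'', h5, by simp; omega, h7.trans h4⟩

/-- A reduced word is a shortest spelling, so the other word, being no longer, is reduced as well.
Heads of reduced spellings agree modulo an associated subgroup, which is trivial here. -/
theorem eq_of_wordProd_eq {h h' : M} {L L' : List (ℤˣ × M)} (hL : IsReducedWord L)
    (hlen : L'.length ≤ L.length) (heq : wordProd h L = wordProd h' L') :
    h = h' ∧ L.map Prod.fst = L'.map Prod.fst := by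
  have hL' : IsReducedWord L' := by
    rcases exists_isReducedWord_or_length_lt h' L' with h1 | ⟨h'', L'', h1, h2, h3⟩
    · exact h1
    · have := congrArg List.length (map_fst_eq_of_prod_eq hL h1 (heq.trans h3.symm))
      simp only [List.length_map] at this
      omega
  have h1 := map_fst_eq_of_prod_eq hL hL' heq
  refine ⟨?_, h1⟩
  have h2 := (ReducedWord.map_fst_eq_and_of_prod_eq (MulEquiv.refl _)
    (w₁ := ⟨h, L, hL.imp fun a _ h1 h2 => h1 (by
      rcases Int.units_eq_one_or a.1 with h | h <;> rw [h] at h2 <;> exact h2)⟩)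
    (w₂ := ⟨h', L', hL'.imp fun a _ h1 h2 => h1 (by
      rcases Int.units_eq_one_or a.1 with h | h <;> rw [h] at h2 <;> exact h2)⟩) heq).2
  cases L with
  | nil =>
    have : L' = [] := by simpa using h1
    subst this
    simp only [wordProd, List.map_nil, List.prod_nil, mul_one] at heq
    exact of_injective _ heq
  | cons x L =>
    have h3 := h2 x.1 (by simp)
    have h4 : h⁻¹ * h' = 1 := by
      rcases Int.units_eq_one_or x.1 with h | h <;> rw [h] at h3 <;> exact h3
    exact inv_mul_eq_one.1 h4

theorem exists_isReducedWord (g : FreeLetterExtension M) :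
    ∃ h L, IsReducedWord L ∧ g = wordProd h L := exists_reduced_list g

/-- If the head `h` is not `1`, then `t g` begins with the reduced `t h`, so it has head `1`,
whereas `g t` has head `h`. So `h = 1`, and the first power of `t` can be stripped off. -/
theorem mem_zpowers_t_of_commute {g : FreeLetterExtension M} (hg : Commute g t) :
    g ∈ Subgroup.zpowers (t : FreeLetterExtension M) := by
  obtain ⟨h, L, hL, rfl⟩ := exists_isReducedWord g
  induction L generalizing h with
  | nil =>
    have h1 : wordProd 1 [((1 : ℤˣ), h)] = wordProd h [((1 : ℤˣ), (1 : M))] := by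
      simpa [wordProd] using hg.eq.symm
    have h2 := (eq_of_wordProd_eq (List.isChain_singleton _) (by simp) h1).1
    rw [← h2]
    simp [wordProd]
  | cons x L ih =>
    have h0 : h = 1 := by
      by_contra h0
      have h1 : wordProd 1 (((1 : ℤˣ), h) :: x :: L) =
          wordProd h ((x :: L) ++ [((1 : ℤˣ), (1 : M))]) := by
        rw [wordProd_cons, wordProd_append]
        simpa [wordProd] using hg.eq.symm
      exact h0 (eq_of_wordProd_eq (List.isChain_cons_cons.2 ⟨fun h => absurd h h0, hL⟩)
        (by simp) h1).1.symm
    subst h0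
    obtain ⟨e, a⟩ := x
    have h1 : wordProd 1 ((e, a) :: L) = t ^ (e : ℤ) * wordProd a L := by
      rw [wordProd_cons]; simp
    rw [h1] at hg ⊢
    refine Subgroup.mul_mem _ (Subgroup.zpow_mem_zpowers _ _) (ih a (List.isChain_cons.1 hL).2 ?_)
    have h2 : Commute ((t : FreeLetterExtension M) ^ (-(e : ℤ))) t :=
      (Commute.refl _).zpow_left _
    have := h2.mul_left hg
    rwa [← mul_assoc, ← zpow_add, neg_add_cancel, zpow_zero, one_mul] at this

/-- Induction on the length of a spelling of `g`: comparison of `w g` with `g w` shows that `g` is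
trivial or that multiplication by `w` or `w⁻¹`, or by both in turn, leads to a shorter element of
the centralizer or to `1`. -/
theorem mem_zpowers_of_commute_conj_mul {c c' : M} (hc : c ≠ 1) (hc' : c' ≠ 1)
    {g : FreeLetterExtension M} (hg : Commute g (t⁻¹ * of c * t * of c')) :
    g ∈ Subgroup.zpowers (t⁻¹ * of c * t * of c' : FreeLetterExtension M) := by
  set w : FreeLetterExtension M := t⁻¹ * of c * t * of c' with hw
  have hw1 : w = wordProd 1 [((-1 : ℤˣ), c), ((1 : ℤˣ), c')] := by
    simp [wordProd, hw, mul_assoc]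
  have hww : Commute w w := Commute.refl w
  have hrec : ∀ {x : FreeLetterExtension M}, w⁻¹ * x ∈ Subgroup.zpowers w →
      x ∈ Subgroup.zpowers w := by
    intro x hx
    have := Subgroup.mul_mem _ (Subgroup.mem_zpowers w) hx
    rwa [mul_inv_cancel_left] at this
  have hrec' : ∀ {x : FreeLetterExtension M}, w * x ∈ Subgroup.zpowers w →
      x ∈ Subgroup.zpowers w := by
    intro x hx
    have := Subgroup.mul_mem _ (Subgroup.inv_mem _ (Subgroup.mem_zpowers w)) hx
    rwa [inv_mul_cancel_left] at this
  have hword : ∀ (h : M) L, w * wordProd h L =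
      wordProd 1 (((-1 : ℤˣ), c) :: ((1 : ℤˣ), c' * h) :: L) := by
    intro h L
    rw [wordProd_cons, wordProd_cons, ← of_mul_wordProd]
    simp [hw, mul_assoc]
  have hbound : ∀ n : ℕ, ∀ (h : M) (L : List (ℤˣ × M)), L.length ≤ n →
      Commute (wordProd h L) w → wordProd h L ∈ Subgroup.zpowers w := by
    intro n
    induction n using Nat.strong_induction_on with
    | _ n ih =>
    intro h L hLn hcomm
    have hshort : ∀ (h' : M) (L' : List (ℤˣ × M)), L'.length < n → Commute (wordProd h' L') w →
        wordProd h' L' ∈ Subgroup.zpowers w := fun h' L' hl => ih _ hl h' L' le_rfl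
    -- An element that begins with `t⁻¹` begins with all of `t⁻¹ c t`; multiplication by `w⁻¹` then
    -- removes two letters.
    have hneg : ∀ (a : M) (L' : List (ℤˣ × M)), IsReducedWord (((-1 : ℤˣ), a) :: L') →
        L'.length + 1 ≤ n → Commute (wordProd 1 (((-1 : ℤˣ), a) :: L')) w →
        wordProd 1 (((-1 : ℤˣ), a) :: L') ∈ Subgroup.zpowers w := by
      intro a L' hred hl hcm
      have h1 : wordProd c (((1 : ℤˣ), c') :: ((-1 : ℤˣ), a) :: L') =
          wordProd a (L' ++ [((-1 : ℤˣ), c), ((1 : ℤˣ), c')]) := by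
        have h2 := hcm.eq.symm
        rw [hword, mul_one, hw1, ← wordProd_append, List.cons_append,
          wordProd_cons 1 (-1) c, wordProd_cons 1 (-1) a] at h2
        rw [wordProd_cons, wordProd_cons]
        rw [wordProd_cons, wordProd_cons] at h2
        exact mul_left_cancel h2
      obtain ⟨h2, h3⟩ := eq_of_wordProd_eq
        (List.isChain_cons_cons.2 ⟨fun h => absurd h hc', hred⟩) (by simp) h1
      cases L' with
      | nil => simp at h3
      | cons x L' =>
        obtain ⟨e, b⟩ := x
        simp only [List.map_cons, List.cons_append, List.cons.injEq] at h3
        rw [← h3.1, ← h2] at hcm ⊢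
        have h4 : w⁻¹ * wordProd 1 (((-1 : ℤˣ), c) :: ((1 : ℤˣ), b) :: L') =
            wordProd (c'⁻¹ * b) L' := by
          rw [inv_mul_eq_iff_eq_mul, hword]; simp
        apply hrec
        rw [h4]
        refine hshort _ _ (by simp at hl; omega) ?_
        rw [← h4]
        exact hww.inv_left.mul_left hcm
    have hgen : ∀ (h : M) (L : List (ℤˣ × M)), IsReducedWord L → L.length ≤ n →
        Commute (wordProd h L) w → wordProd h L ∈ Subgroup.zpowers w := by
      intro h L hL hl hcm
      by_cases hred : IsReducedWord (((1 : ℤˣ), c' * h) :: L)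
      · have h1 : wordProd 1 (((-1 : ℤˣ), c) :: ((1 : ℤˣ), c' * h) :: L) =
            wordProd h (L ++ [((-1 : ℤˣ), c), ((1 : ℤˣ), c')]) := by
          rw [← hword, wordProd_append, ← hw1, hcm.eq]
        obtain ⟨h2, h3⟩ := eq_of_wordProd_eq
          (List.isChain_cons_cons.2 ⟨fun h => absurd h hc, hred⟩) (by simp) h1
        subst h2
        cases L with
        | nil => simp [wordProd]
        | cons x L =>
          obtain ⟨e, a⟩ := x
          simp only [List.map_cons, List.cons_append, List.cons.injEq] at h3
          rw [← h3.1] at hcm hL ⊢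
          exact hneg a L hL hl hcm
      -- If `w g` is not reduced as it stands, the cancellation happens at `c' * h = 1` and the new
      -- word begins with `t⁻¹`, without being longer than the old one.
      · cases L with
        | nil => exact absurd (List.isChain_singleton _) hred
        | cons x L =>
          obtain ⟨e, a⟩ := x
          rw [IsReducedWord, List.isChain_cons_cons, not_and_or] at hred
          have h1 := hred.resolve_right (not_not.2 hL)
          rw [Classical.not_imp] at h1
          obtain ⟨h1, h2⟩ := h1
          dsimp only at h1 h2
          have h3 : e = -1 := Int.units_ne_iff_eq_neg.1 (Ne.symm h2)
          subst h3
          have h4 : w * wordProd h (((-1 : ℤˣ), a) :: L) =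
              wordProd 1 (((-1 : ℤˣ), c * a) :: L) := by
            rw [hword, h1, wordProd_cons, wordProd_cons, wordProd_cons, wordProd_cons,
              ← of_mul_wordProd c a]
            simp [wordProd, mul_assoc]
          have h5 : Commute (wordProd 1 (((-1 : ℤˣ), c * a) :: L)) w := by
            rw [← h4]
            exact hww.mul_left hcm
          apply hrec'
          rw [h4]
          rcases exists_isReducedWord_or_length_lt 1 (((-1 : ℤˣ), c * a) :: L) with
            h6 | ⟨h', L', h6, h7, h8⟩
          · exact hneg _ _ h6 (by simpa using hl) h5
          · rw [← h8] at h5 ⊢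
            exact hshort _ _ (lt_of_lt_of_le h7 (by simpa using hl)) h5
    rcases exists_isReducedWord_or_length_lt h L with h1 | ⟨h', L', h1, h2, h3⟩
    · exact hgen h L h1 hLn hcomm
    · rw [← h3] at hcomm ⊢
      exact hgen h' L' h1 (by omega) hcomm
  obtain ⟨h, L, hL, rfl⟩ := exists_isReducedWord g
  exact hbound _ h L le_rfl hg

end FreeLetterExtension

/-! ### Substitutions and centralizers in `G[X]`. -/

namespace GX

variable {G : Type u} [Group G] {m n : ℕ}

/-- The subgroup of `G[X]` generated by the constants and the variables in `Y`. -/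
def generated (G : Type u) [Group G] (Y : Set (QVar m n)) : Subgroup (GX G m n) :=
  Subgroup.closure (Set.range const ∪ var '' Y)

theorem const_mem_generated (g : G) (Y : Set (QVar m n)) : const g ∈ generated G Y :=
  Subgroup.subset_closure (Or.inl ⟨g, rfl⟩)

theorem var_mem_generated {w : QVar m n} {Y : Set (QVar m n)} (hw : w ∈ Y) :
    var w ∈ generated G Y :=
  Subgroup.subset_closure (Or.inr ⟨w, hw, rfl⟩)

theorem generated_mono {Y Y' : Set (QVar m n)} (h : Y ⊆ Y') : generated G Y ≤ generated G Y' :=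
  Subgroup.closure_mono (Set.union_subset_union_right _ (Set.image_mono h))

theorem generated_le {Y : Set (QVar m n)} {K : Subgroup (GX G m n)} (hc : ∀ g, const g ∈ K)
    (hv : ∀ w ∈ Y, var w ∈ K) : generated G Y ≤ K := by
  rw [generated, Subgroup.closure_le]
  rintro _ (⟨g, rfl⟩ | ⟨w, hw, rfl⟩)
  · exact hc g
  · exact hv w hw

theorem eq_of_mem_generated {K : Type*} [Group K] {f g : GX G m n →* K} {Y : Set (QVar m n)}
    (hc : ∀ a, f (const a) = g (const a)) (hv : ∀ w ∈ Y, f (var w) = g (var w))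
    {γ : GX G m n} (hγ : γ ∈ generated G Y) : f γ = g γ := by
  have : generated G Y ≤ MonoidHom.eqLocus f g := generated_le hc hv
  exact this hγ

theorem hom_ext {K : Type*} [Group K] {f g : GX G m n →* K}
    (hc : ∀ a, f (const a) = g (const a)) (hv : ∀ w, f (var w) = g (var w)) : f = g := by
  refine Monoid.Coprod.hom_ext (MonoidHom.ext hc) (FreeGroup.ext_hom _ _ hv)

theorem generated_univ : generated G (Set.univ : Set (QVar m n)) = ⊤ := by
  rw [eq_top_iff]
  intro γ _
  induction γ using Monoid.Coprod.induction_on with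
  | inl g => exact const_mem_generated g _
  | inr g =>
    have : (⊤ : Subgroup (FreeGroup (QVar m n))) ≤
        (generated G (Set.univ : Set (QVar m n))).comap Monoid.Coprod.inr := by
      rw [← FreeGroup.closure_range_of, Subgroup.closure_le]
      rintro _ ⟨w, rfl⟩
      exact var_mem_generated (Set.mem_univ w)
    exact this (Subgroup.mem_top g)
  | mul x y hx hy => exact Subgroup.mul_mem _ (hx trivial) (hy trivial)

open Classical in
/-- The homomorphism that agrees with `f` on constants and variables other than `v`, and sends `v`
to `a`. -/
noncomputable def substAlong {K : Type*} [Group K] (f : GX G m n →* K) (v : QVar m n) (a : K) :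
    GX G m n →* K :=
  Monoid.Coprod.lift (f.comp Monoid.Coprod.inl)
    (FreeGroup.lift fun w => if w = v then a else f (var w))

section substAlong

variable {K : Type*} [Group K] (f : GX G m n →* K) (v : QVar m n) (a : K)

@[simp] theorem substAlong_const (g : G) : substAlong f v a (const g) = f (const g) := by
  simp [substAlong, const]

@[simp] theorem substAlong_var_self : substAlong f v a (var v) = a := by
  simp [substAlong, var]

theorem substAlong_var_of_ne {w : QVar m n} (hw : w ≠ v) :
    substAlong f v a (var w) = f (var w) := by
  simp [substAlong, var, hw]

theorem substAlong_of_mem {γ : GX G m n} (hγ : γ ∈ generated G {w | w ≠ v}) :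
    substAlong f v a γ = f γ :=
  eq_of_mem_generated (substAlong_const f v a) (fun _ hw => substAlong_var_of_ne f v a hw) hγ

end substAlong

-- A way to treat `v` as a free letter without splitting `G[X]` as a free product: `G[X]` is a
-- retract of `G[X] * ⟨t⟩`, by an embedding that sends `v` to `t` and fixes what does not involve
-- `v`. Statements on commutation are transported by `φ` and brought back by `ψ`.
open HNNExtension in
theorem exists_freeLetter (v : QVar m n) :
    ∃ (φ : GX G m n →* FreeLetterExtension (GX G m n))
      (ψ : FreeLetterExtension (GX G m n) →* GX G m n),
      (∀ γ, ψ (φ γ) = γ) ∧ φ (var v) = t ∧ (∀ γ ∈ generated G {w | w ≠ v}, φ γ = of γ) ∧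
      ψ t = var v ∧ ∀ γ, ψ (of γ) = γ := by
  let φ : GX G m n →* FreeLetterExtension (GX G m n) := substAlong of v t
  let ψ : FreeLetterExtension (GX G m n) →* GX G m n :=
    HNNExtension.lift (MonoidHom.id _) (var v) (by
      rintro ⟨a, ha⟩
      obtain rfl := Subgroup.mem_bot.1 ha
      simp)
  have hψt : ψ t = var v := by simp [ψ]
  have hψof : ∀ γ, ψ (of γ) = γ := fun γ => by simp [ψ]
  have hφt : φ (var v) = t := substAlong_var_self _ _ _
  refine ⟨φ, ψ, fun γ => ?_, hφt, fun γ hγ => substAlong_of_mem _ _ _ hγ, hψt, hψof⟩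
  have : ψ.comp φ = MonoidHom.id _ := by
    refine hom_ext (fun a => ?_) (fun w => ?_)
    · simp [φ, hψof]
    · by_cases hw : w = v
      · subst hw; simp [hφt, hψt]
      · simp [φ, substAlong_var_of_ne _ _ _ hw, hψof]
  exact DFunLike.congr_fun this γ

theorem mem_zpowers_var_of_commute {v : QVar m n} {γ : GX G m n} (h : Commute γ (var v)) :
    γ ∈ Subgroup.zpowers (var v : GX G m n) := by
  obtain ⟨φ, ψ, h1, h2, -, h4, -⟩ := exists_freeLetter (G := G) v
  have h5 := h.map φ
  rw [h2] at h5
  obtain ⟨k, hk⟩ := FreeLetterExtension.mem_zpowers_t_of_commute h5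
  refine ⟨k, ?_⟩
  have h6 := congrArg ψ hk
  simpa [h4, h1] using h6

theorem mem_zpowers_conj_mul_of_commute {v : QVar m n} {c c' γ : GX G m n}
    (hc : c ∈ generated G {w | w ≠ v}) (hc' : c' ∈ generated G {w | w ≠ v}) (hc1 : c ≠ 1)
    (hc1' : c' ≠ 1) (h : Commute γ ((var v)⁻¹ * c * var v * c')) :
    γ ∈ Subgroup.zpowers ((var v)⁻¹ * c * var v * c') := by
  obtain ⟨φ, ψ, h1, h2, h3, h4, h5⟩ := exists_freeLetter (G := G) v
  have h6 := h.map φ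
  simp only [map_mul, map_inv, h2, h3 c hc, h3 c' hc'] at h6
  obtain ⟨k, hk⟩ := FreeLetterExtension.mem_zpowers_of_commute_conj_mul hc1 hc1' h6
  refine ⟨k, ?_⟩
  have h7 := congrArg ψ hk
  simpa [h4, h1, h5] using h7

/-- The changes of variable `v ↦ v w⁻¹` and `v ↦ v w` are mutually inverse, because `w` does not
involve `v`. They reduce centralizers of words in `v * w` to those of words in `v`. -/
theorem substAlong_substAlong (v : QVar m n) {w : GX G m n} (hw : w ∈ generated G {w | w ≠ v})
    (γ : GX G m n) :
    substAlong (MonoidHom.id _) v (var v * w)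
      (substAlong (MonoidHom.id _) v (var v * w⁻¹) γ) = γ := by
  have : (substAlong (MonoidHom.id _) v (var v * w)).comp
      (substAlong (MonoidHom.id _) v (var v * w⁻¹)) = MonoidHom.id (GX G m n) := by
    refine hom_ext (fun a => by simp) (fun z => ?_)
    by_cases hz : z = v
    · subst hz
      simp [substAlong_of_mem _ _ _ hw]
    · simp [substAlong_var_of_ne _ _ _ hz]
  exact DFunLike.congr_fun this γ

theorem mem_zpowers_var_mul_of_commute {v : QVar m n} {w γ : GX G m n}
    (hw : w ∈ generated G {w | w ≠ v}) (h : Commute γ (var v * w)) :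
    γ ∈ Subgroup.zpowers (var v * w) := by
  have h1 := h.map (substAlong (MonoidHom.id _) v (var v * w⁻¹))
  have h2 : substAlong (MonoidHom.id _) v (var v * w⁻¹) (var v * w) = var v := by
    simp [substAlong_of_mem _ _ _ hw]
  rw [h2] at h1
  obtain ⟨k, hk⟩ := mem_zpowers_var_of_commute h1
  refine ⟨k, ?_⟩
  have h3 := congrArg (substAlong (MonoidHom.id _) v (var v * w)) hk
  simpa [substAlong_substAlong v hw] using h3

theorem mem_zpowers_conj_var_mul_of_commute {v : QVar m n} {w c c' γ : GX G m n}
    (hw : w ∈ generated G {w | w ≠ v})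
    (hc : c ∈ generated G {w | w ≠ v}) (hc' : c' ∈ generated G {w | w ≠ v}) (hc1 : c ≠ 1)
    (hc1' : c' ≠ 1) (h : Commute γ ((var v * w)⁻¹ * c * (var v * w) * c')) :
    γ ∈ Subgroup.zpowers ((var v * w)⁻¹ * c * (var v * w) * c') := by
  have h1 := h.map (substAlong (MonoidHom.id _) v (var v * w⁻¹))
  have h2 : substAlong (MonoidHom.id _) v (var v * w⁻¹) ((var v * w)⁻¹ * c * (var v * w) * c') =
      (var v)⁻¹ * c * var v * c' := by
    simp [substAlong_of_mem _ _ _ hw, substAlong_of_mem _ _ _ hc, substAlong_of_mem _ _ _ hc']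
  rw [h2] at h1
  obtain ⟨k, hk⟩ := mem_zpowers_conj_mul_of_commute hc hc' hc1 hc1' h1
  refine ⟨k, ?_⟩
  have h3 := congrArg (substAlong (MonoidHom.id _) v (var v * w)) hk
  simpa [substAlong_substAlong v hw, substAlong_of_mem _ _ _ hw, substAlong_of_mem _ _ _ hc,
    substAlong_of_mem _ _ _ hc'] using h3

theorem const_injective : Function.Injective (const : G → GX G m n) :=
  Monoid.Coprod.inl_injective

theorem const_eq_one_iff {g : G} : (const g : GX G m n) = 1 ↔ g = 1 := by
  rw [← (const_injective (m := m) (n := n)).eq_iff (a := g) (b := 1)]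
  simp [const]

theorem var_ne_one (v : QVar m n) : (var v : GX G m n) ≠ 1 := by
  intro h
  have h1 := congrArg (Monoid.Coprod.snd : GX G m n →* _) h
  simp [var, FreeGroup.of_ne_one] at h1

/-- If the element were trivial with `c' ≠ 1`, its centralizer would be cyclic and generated by `1`,
although it contains `v`. -/
theorem conj_var_mul_ne_one {v : QVar m n} {c c' : GX G m n}
    (hc : c ∈ generated G {w | w ≠ v}) (hc' : c' ∈ generated G {w | w ≠ v}) (hc1 : c ≠ 1) :
    (var v)⁻¹ * c * var v * c' ≠ 1 := by
  intro h
  by_cases hc1' : c' = 1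
  · apply hc1
    rw [hc1', mul_one, mul_assoc, inv_mul_eq_one] at h
    simpa using h.symm
  · have h1 := mem_zpowers_conj_mul_of_commute hc hc' hc1 hc1' (γ := var v)
      (by rw [h]; exact Commute.one_right _)
    rw [h, Subgroup.zpowers_one_eq_bot, Subgroup.mem_bot] at h1
    exact var_ne_one v h1

end GX

/-! ### The centralizer of an element of the base group. -/

namespace CentralizerExtension

open HNNExtension

variable {H : Type u} [Group H] {w : H}

/-- Both `v g` and `g v` have reduced spellings, with heads `v h` and `h`; these must lie in the
same coset of the centralizer of `w`. -/
theorem commute_head_of_commute_of {h v : H} {x : ℤˣ × H} {L : List (ℤˣ × H)}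
    (hch : (x :: L).IsChain (fun a b => Commute a.2 w → a.1 = b.1))
    (hc : Commute (of h * ((x :: L).map fun x =>
      (t : CentralizerExtension H w) ^ (x.1 : ℤ) * of x.2).prod) (of v)) :
    Commute (h⁻¹ * v * h) w := by
  obtain ⟨L', y, hL'⟩ : ∃ L' y, x :: L = L' ++ [y] := by
    rcases List.eq_nil_or_concat (x :: L) with h | ⟨L', y, h⟩
    · simp at h
    · exact ⟨L', y, by simpa using h⟩
  have hch' : (L' ++ [(y.1, y.2 * v)]).IsChain (fun a b => Commute a.2 w → a.1 = b.1) := by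
    rw [hL'] at hch
    rw [List.isChain_append] at hch ⊢
    exact ⟨hch.1, List.isChain_singleton _, by simpa using hch.2.2⟩
  have heq : of (v * h) * ((x :: L).map fun x =>
      (t : CentralizerExtension H w) ^ (x.1 : ℤ) * of x.2).prod =
      of h * ((L' ++ [(y.1, y.2 * v)]).map fun x =>
      (t : CentralizerExtension H w) ^ (x.1 : ℤ) * of x.2).prod := by
    rw [map_mul, mul_assoc, ← hc.eq, hL']
    simp [mul_assoc]
  have h1 := (ReducedWord.map_fst_eq_and_of_prod_eq (MulEquiv.refl _)
    (w₁ := ⟨v * h, x :: L, hch.imp fun _ _ h1 h2 => h1 ((mem_toSubgroup _).1 h2)⟩)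
    (w₂ := ⟨h, L' ++ [(y.1, y.2 * v)], hch'.imp fun _ _ h1 h2 => h1 ((mem_toSubgroup _).1 h2)⟩)
    heq).2 x.1 (by simp)
  have h2 := ((mem_toSubgroup _).1 h1).inv_left
  simpa [mul_assoc] using h2

/-- An element `y` commutes with the image of the centralizer of `of v` as soon as it commutes with
the image of the centralizer of `v` and the obvious conjugates of `t`. -/
theorem commute_map_of_commute_of {K : Type*} [Group K] (f : CentralizerExtension H w →* K)
    {v : H} {y : K} (hy : ∀ h, Commute h v → Commute y (f (of h)))
    (ht : ∀ h, Commute (h⁻¹ * v * h) w → Commute ((f (of h))⁻¹ * y * f (of h)) (f t))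
    {g : CentralizerExtension H w} (hg : Commute g (of v)) : Commute y (f g) := by
  obtain ⟨h, L, hch, rfl⟩ := exists_reduced_list g
  induction L generalizing h with
  | nil =>
    simp only [List.map_nil, List.prod_nil, mul_one] at hg ⊢
    exact hy h (commute_of_of_iff.1 hg)
  | cons x L ih =>
    have h1 := commute_head_of_commute_of hch hg
    -- This conjugate of a power of `t` lies in the centralizer and accounts for the first letter of
    -- `g`; it is split off and induction applies to the rest.
    set k : CentralizerExtension H w := of h * t ^ (x.1 : ℤ) * of h⁻¹ with hk
    have h2 : Commute k (of v) := by
      have h3 := (commute_t_zpow_of h1 x.1).eq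
      rw [hk, Commute, SemiconjBy]
      simp only [map_mul, map_inv, mul_assoc] at h3 ⊢
      have h4 := congrArg (fun z => of h * z * (of h)⁻¹) h3
      simpa [mul_assoc] using h4
    have h3 : Commute y (f k) := by
      have h4 := (ht h h1).zpow_right (x.1 : ℤ)
      rw [hk, map_mul, map_mul, map_zpow, map_inv, map_inv, Commute, SemiconjBy]
      have h5 := congrArg (fun z => f (of h) * z * (f (of h))⁻¹) h4.eq
      simpa [mul_assoc] using h5
    have h4 : of h * ((x :: L).map fun x =>
        (t : CentralizerExtension H w) ^ (x.1 : ℤ) * of x.2).prod =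
        k * (of (h * x.2) * (L.map fun x =>
        (t : CentralizerExtension H w) ^ (x.1 : ℤ) * of x.2).prod) := by
      simp [hk, mul_assoc]
    rw [h4] at hg ⊢
    rw [map_mul f k]
    refine h3.mul_right (ih _ (List.isChain_cons.1 hch).2 ?_)
    have := h2.inv_left.mul_left hg
    rwa [inv_mul_cancel_left] at this

end CentralizerExtension

/-! ### The atoms affected by a step. -/

namespace QVar

variable {m n : ℕ}

/-- The index of the atom in which a variable occurs. -/
def pos : QVar m n → ℕ
  | x i => m + i
  | y i => m + i
  | z i => i

end QVar

namespace Move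

variable {m n : ℕ}

/-- The index of the first atom affected by a step. -/
def lo : Move m n → ℕ
  | zz i => i
  | zx _ _ => m - 1
  | twistY i => m + i
  | twistX i => m + i
  | xx i => m + i

/-- The index of the last atom affected by a step. -/
def hi : Move m n → ℕ
  | zz i => i + 1
  | zx _ _ => m
  | twistY i => m + i
  | twistX i => m + i
  | xx i => m + i + 1

theorem act_of_outside {K : Type u} [Group K] (t : K) (v : QVar m n → K) {k : Move m n}
    {w : QVar m n} (hw : w.pos < k.lo ∨ k.hi < w.pos) : k.act t v w = v w := by
  rcases k with i | ⟨hm, hn⟩ | i | i | i <;> rcases w with j | j | j <;>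
    simp only [QVar.pos, lo, hi, act, Fin.ext_iff] at hw ⊢ <;> (repeat' split) <;>
    first | rfl | (exfalso; omega)

theorem act_congr {K : Type u} [Group K] (t : K) {v v' : QVar m n → K} (k : Move m n)
    {w : QVar m n} (hw : v w = v' w) : k.act t v w = k.act t v' w := by
  rcases k with i | ⟨hm, hn⟩ | i | i | i <;> rcases w with j | j | j <;>
    simp only [act, hw]

theorem act_one {K : Type u} [Group K] (v : QVar m n → K) (k : Move m n)
    (w : QVar m n) : k.act 1 v w = v w := by
  rcases k with i | ⟨hm, hn⟩ | i | i | i <;> rcases w with j | j | j <;>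
    simp [act]

theorem map_act {K K' : Type u} [Group K] [Group K'] (f : K →* K') (t : K) (v : QVar m n → K)
    (k : Move m n) (w : QVar m n) : f (k.act t v w) = k.act (f t) (fun w => f (v w)) w := by
  rcases k with i | ⟨hm, hn⟩ | i | i | i <;> rcases w with j | j | j <;>
    simp only [act] <;> (repeat' split) <;> simp

end Move

namespace QuadEq

variable {G : Type u} [Group G] {m n : ℕ} (E : QuadEq G m n)

theorem atom_of_lt {i : ℕ} (hi : i < m) (hi' : i < m + n) :
    E.atom ⟨i, hi'⟩ =
      (GX.var (.z ⟨i, hi⟩))⁻¹ * GX.const (E.c ⟨i, hi⟩) * GX.var (.z ⟨i, hi⟩) :=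
  Fin.append_left _ _ (⟨i, hi⟩ : Fin m)

theorem atom_add {i : ℕ} (hi : i < n) (hi' : m + i < m + n) :
    E.atom ⟨m + i, hi'⟩ = (GX.var (.x ⟨i, hi⟩))⁻¹ * (GX.var (.y ⟨i, hi⟩))⁻¹ *
      GX.var (.x ⟨i, hi⟩) * GX.var (.y ⟨i, hi⟩) :=
  Fin.append_right _ _ (⟨i, hi⟩ : Fin n)

theorem atom_mem_generated (i : Fin (m + n)) : E.atom i ∈ GX.generated G {w | w.pos = i} := by
  obtain ⟨i, hi⟩ := i
  rcases lt_or_ge i m with h | h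
  · rw [E.atom_of_lt h hi]
    have h1 : (GX.var (.z ⟨i, h⟩) : GX G m n) ∈ GX.generated G {w | w.pos = i} :=
      GX.var_mem_generated rfl
    exact mul_mem (mul_mem (inv_mem h1) (GX.const_mem_generated _ _)) h1
  · obtain ⟨j, rfl⟩ := Nat.exists_eq_add_of_le h
    have hj : j < n := by omega
    rw [E.atom_add hj hi]
    have h1 : (GX.var (.x ⟨j, hj⟩) : GX G m n) ∈ GX.generated G {w | w.pos = m + j} :=
      GX.var_mem_generated rfl
    have h2 : (GX.var (.y ⟨j, hj⟩) : GX G m n) ∈ GX.generated G {w | w.pos = m + j} :=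
      GX.var_mem_generated rfl
    exact mul_mem (mul_mem (mul_mem (inv_mem h1) (inv_mem h2)) h1) h2

end QuadEq

namespace Move

variable {G : Type u} [Group G] {m n : ℕ}

theorem period_mem_generated (E : QuadEq G m n) (k : Move m n) :
    k.period E ∈ GX.generated G {w | k.lo ≤ w.pos ∧ w.pos ≤ k.hi} := by
  have hatom : ∀ i : Fin (m + n), k.lo ≤ i → (i : ℕ) ≤ k.hi →
      E.atom i ∈ GX.generated G {w | k.lo ≤ w.pos ∧ w.pos ≤ k.hi} := fun i h1 h2 =>
    GX.generated_mono (fun w (hw : w.pos = i) => by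
      rw [← hw] at h1 h2; exact ⟨h1, h2⟩) (E.atom_mem_generated i)
  have hvar : ∀ w : QVar m n, k.lo ≤ w.pos → w.pos ≤ k.hi →
      (GX.var w : GX G m n) ∈ GX.generated G {w | k.lo ≤ w.pos ∧ w.pos ≤ k.hi} :=
    fun w h1 h2 => GX.var_mem_generated ⟨h1, h2⟩
  cases k with
  | zz i => exact mul_mem (hatom _ le_rfl (Nat.le_succ _)) (hatom _ (Nat.le_succ _) le_rfl)
  | zx hm hn =>
    exact mul_mem (hatom _ le_rfl (Nat.sub_le _ _))
      (inv_mem (hvar _ (by simp [lo, QVar.pos]) (by simp [hi, QVar.pos])))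
  | twistY i => exact hvar _ le_rfl le_rfl
  | twistX i => exact hvar _ le_rfl le_rfl
  | xx i =>
    exact mul_mem (hvar _ le_rfl (Nat.le_succ _))
      (inv_mem (hvar _ (by simp [lo, QVar.pos]) le_rfl))

end Move

/-! ### Comparison of stages by homomorphisms. -/

namespace GX

open HNNExtension

variable {G : Type u} [Group G] {m n : ℕ} {H K : Type u} [Group H] [Group K]

/-- The homomorphism `G[X] → H` with given restriction to `G` and given values of the variables. -/
def eval (ι : G →* H) (v : QVar m n → H) : GX G m n →* H :=
  Monoid.Coprod.lift ι (FreeGroup.lift v)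

variable (ι : G →* H) (v : QVar m n → H)

@[simp]
theorem eval_const (g : G) : eval ι v (const g) = ι g := by simp [eval, const]

@[simp]
theorem eval_var (w : QVar m n) : eval ι v (var w) = v w := by simp [eval, var]

theorem map_eval_of_mem (f : H →* K) {ι' : G →* K} {v' : QVar m n → K} {Y : Set (QVar m n)}
    (hι : ∀ g, f (ι g) = ι' g) (hv : ∀ w ∈ Y, f (v w) = v' w) {γ : GX G m n}
    (hγ : γ ∈ generated G Y) : f (eval ι v γ) = eval ι' v' γ :=
  eq_of_mem_generated (f := f.comp (eval ι v)) (by simpa using hι) (by simpa using hv) hγ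

theorem map_eval (f : H →* K) {ι' : G →* K} {v' : QVar m n → K}
    (hι : ∀ g, f (ι g) = ι' g) (hv : ∀ w, f (v w) = v' w) (γ : GX G m n) :
    f (eval ι v γ) = eval ι' v' γ :=
  map_eval_of_mem ι v f hι (fun w _ => hv w) (Y := Set.univ) (by simp [generated_univ])

/-- The values of the variables after a step that extends the centralizer of `u`. -/
def stepVal (k : Move m n) (u : H) : QVar m n → CentralizerExtension H u :=
  k.act t (fun w => of (v w))

/-- The canonical homomorphism after a step that extends the centralizer of `u`. -/
def stepIncl (u : H) : G →* CentralizerExtension H u := of.comp ι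

@[simp]
theorem stepIncl_apply (u : H) (g : G) : stepIncl ι u g = of (ι g) := rfl

variable {ι v}

theorem eval_step_of_mem {k : Move m n} {u : H} {Y : Set (QVar m n)} {γ : GX G m n}
    (hY : ∀ w ∈ Y, w.pos < k.lo ∨ k.hi < w.pos) (hγ : γ ∈ generated G Y) :
    eval (stepIncl ι u) (stepVal v k u) γ = of (eval ι v γ) :=
  (map_eval_of_mem ι v of (fun _ => rfl)
    (fun w hw => (Move.act_of_outside t (fun w => of (v w)) (hY w hw)).symm) hγ).symm

/-- There is a homomorphism `H → K` compatible with the homomorphisms from `G` and the values of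
the variables. -/
def Dominates (ι : G →* H) (v : QVar m n → H) (ι' : G →* K) (v' : QVar m n → K) : Prop :=
  ∃ f : H →* K, (∀ g, f (ι g) = ι' g) ∧ ∀ w, f (v w) = v' w

theorem Dominates.step {ι' : G →* K} {v' : QVar m n → K} (h : Dominates ι v ι' v') (k : Move m n)
    (γ : GX G m n) : Dominates (stepIncl ι (eval ι v γ)) (stepVal v k (eval ι v γ))
      (stepIncl ι' (eval ι' v' γ)) (stepVal v' k (eval ι' v' γ)) := by
  obtain ⟨f, h1, h2⟩ := h
  refine ⟨CentralizerExtension.lift (of.comp f) t fun h hh =>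
      CentralizerExtension.commute_t_of (by simpa [map_eval ι v f h1 h2] using hh.map f),
    fun g => ?_, fun w => ?_⟩
  · simp [h1]
  · rw [stepVal, Move.map_act, CentralizerExtension.lift_t]
    refine Move.act_congr _ _ ?_
    rw [CentralizerExtension.lift_of, MonoidHom.comp_apply, h2]

/-- Sending the new letter to `1` undoes the step; so leaving a step out can only enlarge the
kernel. -/
theorem step_dominates (k : Move m n) (u : H) : Dominates (stepIncl ι u) (stepVal v k u) ι v := by
  refine ⟨CentralizerExtension.lift (MonoidHom.id _) 1 fun h _ => Commute.one_left _,
    fun g => by simp, fun w => ?_⟩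
  rw [stepVal, Move.map_act, CentralizerExtension.lift_t, Move.act_one,
      CentralizerExtension.lift_of, MonoidHom.id_apply]

/-- The homomorphism exchanges the two new letters. It exists even though the second step extends a
centralizer in the larger group: the centralizer of `u'` in `H(u, t)` is generated by its
centralizer in `H` and the conjugates `h t h⁻¹` for which `h⁻¹ u' h` commutes with `u`, and for
these the commutation can be checked. -/
theorem step_step_dominates {k l : Move m n} (hkl : k.hi < l.lo ∨ l.hi < k.lo) (u u' : H) :
    Dominates (stepIncl (stepIncl ι u) (of u' : CentralizerExtension H u))
      (stepVal (stepVal v k u) l (of u' : CentralizerExtension H u))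
      (stepIncl (stepIncl ι u') (of u : CentralizerExtension H u'))
      (stepVal (stepVal v l u') k (of u : CentralizerExtension H u')) := by
  have ht : ∀ h, Commute h (of u : CentralizerExtension H u') → Commute t (of h) :=
    fun h hh => CentralizerExtension.commute_t_of hh
  let f : CentralizerExtension H u →* CentralizerExtension (CentralizerExtension H u') (of u) :=
    CentralizerExtension.lift (of.comp of) t fun h hh => ht _ (hh.map of)
  let F : CentralizerExtension (CentralizerExtension H u) (of u') →*
      CentralizerExtension (CentralizerExtension H u') (of u) :=
    CentralizerExtension.lift f (of t) fun g hg => by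
      refine CentralizerExtension.commute_map_of_commute_of f (fun h hh => ?_) (fun h hh => ?_) hg
      · rw [CentralizerExtension.lift_of]
        exact (CentralizerExtension.commute_t_of hh).map of
      · rw [CentralizerExtension.lift_of, CentralizerExtension.lift_t]
        have h1 : Commute (h * u * h⁻¹) u' := by
          have h2 := congrArg (fun z => h * z * h⁻¹) hh.symm.eq
          rw [Commute, SemiconjBy]
          simpa [mul_assoc] using h2
        have h2 := (CentralizerExtension.commute_t_of h1).eq
        have h3 : Commute ((of h)⁻¹ * t * of h) (of u : CentralizerExtension H u') := by
          have h4 := congrArg (fun z => (of h)⁻¹ * z * of h) h2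
          rw [Commute, SemiconjBy]
          simpa [mul_assoc] using h4
        simpa using (ht _ h3).symm
  have hdisj : ∀ w : QVar m n, (w.pos < k.lo ∨ k.hi < w.pos) ∨ (w.pos < l.lo ∨ l.hi < w.pos) :=
    fun w => by omega
  refine ⟨F, fun g => ?_, fun w => ?_⟩
  · simp [F, f]
  · have h1 : ∀ w, F (of (stepVal v k u w)) = k.act t (fun w => of (of (v w))) w := by
      intro w
      rw [CentralizerExtension.lift_of, stepVal, Move.map_act, CentralizerExtension.lift_t]
      refine Move.act_congr _ _ ?_
      rw [CentralizerExtension.lift_of]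
      rfl
    have h2 : ∀ w, (of (stepVal v l u' w) : CentralizerExtension _ (of u)) =
        l.act (of t) (fun w => of (of (v w))) w :=
      fun w => by rw [stepVal, Move.map_act]
    rw [stepVal, Move.map_act, CentralizerExtension.lift_t, Move.act_congr _ _ (h1 w)]
    rw [stepVal, Move.act_congr _ k (h2 w)]
    rcases hdisj w with hw | hw
    · rw [Move.act_of_outside _ (fun w => l.act _ _ w) hw]
      exact Move.act_congr _ _ (Move.act_of_outside t (fun w => of (of (v w))) hw)
    · rw [Move.act_of_outside _ (fun w => k.act _ _ w) hw]
      exact Move.act_congr _ _ (Move.act_of_outside (of t) (fun w => of (of (v w))) hw).symm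

end GX

namespace Stage

open HNNExtension

variable {G : Type u} [Group G] {m n : ℕ} (E : QuadEq G m n)

theorem hom_eq_eval (s : Stage G m n) : s.hom = GX.eval s.incl s.val := rfl

/-- There is a homomorphism of the groups of two stages that is compatible with the canonical
homomorphisms and the values of the variables. -/
def MapsTo (s s' : Stage G m n) : Prop := GX.Dominates s.incl s.val s'.incl s'.val

theorem MapsTo.refl (s : Stage G m n) : s.MapsTo s := ⟨MonoidHom.id _, fun _ => rfl, fun _ => rfl⟩

theorem MapsTo.trans {s s' s'' : Stage G m n} (h : s.MapsTo s') (h' : s'.MapsTo s'') :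
    s.MapsTo s'' := by
  obtain ⟨f, h1, h2⟩ := h
  obtain ⟨f', h1', h2'⟩ := h'
  exact ⟨f'.comp f, fun g => by simp [h1, h1'], fun w => by simp [h2, h2']⟩

theorem MapsTo.ker_le {s s' : Stage G m n} (h : s.MapsTo s') : s.hom.ker ≤ s'.hom.ker := by
  obtain ⟨f, h1, h2⟩ := h
  intro γ hγ
  rw [MonoidHom.mem_ker, hom_eq_eval] at hγ ⊢
  rw [← GX.map_eval _ _ f h1 h2, hγ, map_one]

theorem MapsTo.step {s s' : Stage G m n} (h : s.MapsTo s') (k : Move m n) :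
    (s.step E k).MapsTo (s'.step E k) :=
  GX.Dominates.step h k (k.period E)

theorem step_mapsTo (s : Stage G m n) (k : Move m n) : (s.step E k).MapsTo s :=
  GX.step_dominates k _

theorem step_hom_period (s : Stage G m n) {k l : Move m n} (hkl : k.hi < l.lo ∨ l.hi < k.lo) :
    (s.step E k).hom (l.period E) =
      (of (s.hom (l.period E)) : CentralizerExtension s.carrier (s.hom (k.period E))) :=
  GX.eval_step_of_mem (fun w hw => by
    have h1 : l.lo ≤ w.pos := hw.1
    have h2 : w.pos ≤ l.hi := hw.2
    omega) (l.period_mem_generated E)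

theorem step_step_mapsTo (s : Stage G m n) {k l : Move m n} (hkl : k.hi < l.lo ∨ l.hi < k.lo) :
    ((s.step E k).step E l).MapsTo ((s.step E l).step E k) := by
  have h1 := GX.step_step_dominates (ι := s.incl) (v := s.val) hkl (s.hom (k.period E))
    (s.hom (l.period E))
  have h2 := s.step_hom_period E hkl
  have h3 := s.step_hom_period E hkl.symm
  rw [← h2, ← h3] at h1
  exact h1

end Stage

/-! ### Steps preserve the value of the equation. -/

theorem List.prod_ofFn_congr_of_adjacent {M : Type*} [Monoid M] {N : ℕ} {f g : Fin N → M} {i : ℕ}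
    (hi : i + 1 < N) (hfg : ∀ j : Fin N, (j : ℕ) ≠ i → (j : ℕ) ≠ i + 1 → f j = g j)
    (h : f ⟨i, Nat.lt_of_succ_lt hi⟩ * f ⟨i + 1, hi⟩ =
      g ⟨i, Nat.lt_of_succ_lt hi⟩ * g ⟨i + 1, hi⟩) :
    (List.ofFn f).prod = (List.ofFn g).prod := by
  induction N generalizing i with
  | zero => exact absurd hi (Nat.not_lt_zero _)
  | succ N ih =>
    cases i with
    | zero =>
      cases N with
      | zero => omega
      | succ N =>
        rw [List.ofFn_succ, List.ofFn_succ, List.ofFn_succ, List.ofFn_succ]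
        simp only [List.prod_cons, ← mul_assoc]
        have h1 : (fun j : Fin N => f j.succ.succ) = fun j => g j.succ.succ := by
          funext j
          exact hfg _ (by simp) (by simp)
        rw [h1]
        congr 1
    | succ i =>
      rw [List.ofFn_succ, List.ofFn_succ, List.prod_cons, List.prod_cons,
        hfg 0 (by simp) (by simp)]
      congr 1
      exact ih (f := fun j => f j.succ) (g := fun j => g j.succ) (i := i) (by omega)
        (fun j h1 h2 => hfg _ (by simpa using h1) (by simpa using h2)) h

namespace GX

open HNNExtension

variable {G : Type u} [Group G] {m n : ℕ} {H : Type u} [Group H] {ι : G →* H}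
  {v : QVar m n → H} (E : QuadEq G m n)

theorem eval_word (ι : G →* H) (v : QVar m n → H) :
    eval ι v E.word = (List.ofFn fun i => eval ι v (E.atom i)).prod * ι E.d⁻¹ := by
  have : eval ι v (Monoid.Coprod.inl E.d⁻¹) = ι E.d⁻¹ := eval_const ι v _
  simp [QuadEq.word, map_list_prod, List.map_ofFn, Function.comp_def, const]
  simpa using this

theorem eval_atom_of_lt (ι : G →* H) (v : QVar m n → H) {i : ℕ} (hi : i < m) (hi' : i < m + n) :
    eval ι v (E.atom ⟨i, hi'⟩) = (v (.z ⟨i, hi⟩))⁻¹ * ι (E.c ⟨i, hi⟩) * v (.z ⟨i, hi⟩) := by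
  simp [E.atom_of_lt hi hi']

theorem eval_atom_add (ι : G →* H) (v : QVar m n → H) {i : ℕ} (hi : i < n) (hi' : m + i < m + n) :
    eval ι v (E.atom ⟨m + i, hi'⟩) =
      (v (.x ⟨i, hi⟩))⁻¹ * (v (.y ⟨i, hi⟩))⁻¹ * v (.x ⟨i, hi⟩) * v (.y ⟨i, hi⟩) := by
  simp [E.atom_add hi hi']

theorem eval_step_atom_of_outside {k : Move m n} {u : H} {j : Fin (m + n)}
    (hj : (j : ℕ) < k.lo ∨ k.hi < (j : ℕ)) :
    eval (stepIncl ι u) (stepVal v k u) (E.atom j) = of (eval ι v (E.atom j)) :=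
  eval_step_of_mem (fun w (hw : w.pos = j) => by rw [hw]; exact hj) (E.atom_mem_generated j)

/-- In each kind of step the product of the affected atoms contains the period, or a twisted
variable, and `t` acts on this piece by conjugation, which is trivial as `t` commutes with it. For a
handle that is linked on its left one reads `[x, y]` as `x⁻¹ * x ^ y`: the factor `x ^ y` is fixed
by the step, and `x⁻¹` belongs to the period. For a handle that is linked on its right one reads
`[x, y]` as `(x⁻¹ * y⁻¹ * x) * y`. -/
theorem eval_step_word (k : Move m n) :
    eval (stepIncl ι (eval ι v (k.period E))) (stepVal v k (eval ι v (k.period E))) E.word =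
      of (eval ι v E.word) := by
  set u := eval ι v (k.period E) with hu
  have ht : (t : CentralizerExtension H u) * of u = of u * t :=
    (CentralizerExtension.commute_t_of (Commute.refl u)).eq
  have ht' : t⁻¹ * of u * t = (of u : CentralizerExtension H u) := by
    rw [mul_assoc, ← ht, inv_mul_cancel_left]
  have hd : (of (eval ι v E.word) : CentralizerExtension H u) =
      (List.ofFn fun i => of (eval ι v (E.atom i))).prod * stepIncl ι u E.d⁻¹ := by
    rw [eval_word, map_mul, map_list_prod, List.map_ofFn]
    rfl
  rw [hd, eval_word]
  congr 1
  have hmove := fun (j : Fin (m + n)) (hj : (j : ℕ) < k.lo ∨ k.hi < (j : ℕ)) =>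
    eval_step_atom_of_outside (ι := ι) (v := v) E (u := u) hj
  cases k with
  | zz i =>
    have hi : i.1 + 1 < m := by omega
    refine List.prod_ofFn_congr_of_adjacent (i := i) (by omega)
      (fun j h1 h2 => hmove j (by simp only [Move.lo, Move.hi]; omega)) ?_
    have h1 : u = (v (.z ⟨i, by omega⟩))⁻¹ * ι (E.c ⟨i, by omega⟩) * v (.z ⟨i, by omega⟩) *
        ((v (.z ⟨i + 1, hi⟩))⁻¹ * ι (E.c ⟨i + 1, hi⟩) * v (.z ⟨i + 1, hi⟩)) := by
      rw [hu, Move.period, map_mul, eval_atom_of_lt E _ _ hi, eval_atom_of_lt E _ _ (by omega)]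
    simp only [eval_atom_of_lt E _ _ hi, eval_atom_of_lt E _ _ (Nat.lt_of_succ_lt hi)]
    rw [← map_mul, ← h1, ← ht', h1]
    simp [stepVal, Move.act, stepIncl, mul_assoc]
  | zx hm hn =>
    refine List.prod_ofFn_congr_of_adjacent (i := m - 1) (by omega)
      (fun j h1 h2 => hmove j (by simp only [Move.lo, Move.hi]; omega)) ?_
    have hidx : ∀ h : m - 1 + 1 < m + n,
        (⟨m - 1 + 1, h⟩ : Fin (m + n)) = ⟨m + 0, by omega⟩ := fun h => by
      ext; simp only [add_zero]; omega
    have h1 : u = (v (.z ⟨m - 1, by omega⟩))⁻¹ * ι (E.c ⟨m - 1, by omega⟩) *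
        v (.z ⟨m - 1, by omega⟩) * (v (.x ⟨0, hn⟩))⁻¹ := by
      rw [hu, Move.period, map_mul, eval_atom_of_lt E _ _ (by omega), map_inv, eval_var]
    simp only [hidx, eval_atom_add E _ _ hn, eval_atom_of_lt E _ _ (Nat.sub_lt hm one_pos)]
    have h2 := congrArg (fun z => z * of ((v (.y ⟨0, hn⟩))⁻¹ * v (.x ⟨0, hn⟩) * v (.y ⟨0, hn⟩))) ht'
    rw [congrArg of h1] at h2
    simpa [stepVal, Move.act, stepIncl, mul_assoc] using h2
  | twistY i =>
    congr 1
    refine congrArg List.ofFn (funext fun j => ?_)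
    by_cases hj : (j : ℕ) = m + i
    · obtain rfl : j = ⟨m + i, Nat.add_lt_add_left i.2 m⟩ := Fin.ext hj
      have h1 : u = v (.x i) := by rw [hu, Move.period, eval_var]
      rw [congrArg of h1] at ht
      rw [eval_atom_add E _ _ i.2, eval_atom_add E _ _ i.2]
      have h2 : t⁻¹ * (of (v (.x i)) * t) = (of (v (.x i)) : CentralizerExtension H u) := by
        rw [← ht, inv_mul_cancel_left]
      simp only [stepVal, Move.act, if_true, map_mul, map_inv, mul_inv_rev, Fin.eta, mul_assoc]
      rw [← mul_assoc (of (v (.x i))) t, ← mul_assoc t⁻¹, h2]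
    · exact hmove j (by simp only [Move.lo, Move.hi]; omega)
  | twistX i =>
    congr 1
    refine congrArg List.ofFn (funext fun j => ?_)
    by_cases hj : (j : ℕ) = m + i
    · obtain rfl : j = ⟨m + i, Nat.add_lt_add_left i.2 m⟩ := Fin.ext hj
      have h1 : u = v (.y i) := by rw [hu, Move.period, eval_var]
      rw [congrArg of h1] at ht
      rw [eval_atom_add E _ _ i.2, eval_atom_add E _ _ i.2]
      have h2 : t⁻¹ * ((of (v (.y i)))⁻¹ * t) = ((of (v (.y i)))⁻¹ : CentralizerExtension H u) := by
        rw [inv_mul_eq_iff_eq_mul, inv_mul_eq_iff_eq_mul, ← mul_assoc, ← ht, mul_inv_cancel_right]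
      simp only [stepVal, Move.act, if_true, map_mul, map_inv, mul_inv_rev, Fin.eta, mul_assoc]
      rw [← mul_assoc (of (v (.y i)))⁻¹ t, ← mul_assoc t⁻¹, h2]
    · exact hmove j (by simp only [Move.lo, Move.hi]; omega)
  | xx i =>
    have hi : i.1 + 1 < n := by omega
    refine List.prod_ofFn_congr_of_adjacent (i := m + i) (by omega)
      (fun j h1 h2 => hmove j (by simp only [Move.lo, Move.hi]; omega)) ?_
    have h1 : u = v (.y ⟨i, by omega⟩) * (v (.x ⟨i + 1, hi⟩))⁻¹ := by
      rw [hu, Move.period, map_mul, map_inv, eval_var, eval_var]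
    have hidx : ∀ h : m + i + 1 < m + n,
        (⟨m + i + 1, h⟩ : Fin (m + n)) = ⟨m + (i + 1), by omega⟩ := fun h => rfl
    simp only [hidx, eval_atom_add E _ _ hi, eval_atom_add E _ _ (Nat.lt_of_succ_lt hi)]
    have h2 := congrArg (fun z => of ((v (.x ⟨i, by omega⟩))⁻¹ * (v (.y ⟨i, by omega⟩))⁻¹ *
      v (.x ⟨i, by omega⟩)) * z * of ((v (.y ⟨i + 1, hi⟩))⁻¹ * v (.x ⟨i + 1, hi⟩) *
        v (.y ⟨i + 1, hi⟩))) ht'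
    rw [congrArg of h1] at h2
    simpa [stepVal, Move.act, stepIncl, mul_assoc] using h2

end GX

/-! ### Omitting and reordering steps. -/

namespace Stage

open HNNExtension

variable {G : Type u} [Group G] {m n : ℕ} (E : QuadEq G m n)

theorem step_hom_word (s : Stage G m n) (k : Move m n) :
    (s.step E k).hom E.word =
      (of (s.hom E.word) : CentralizerExtension s.carrier (s.hom (k.period E))) :=
  GX.eval_step_word E k

theorem foldl_step_hom_word {s : Stage G m n} (hs : s.hom E.word = 1) (L : List (Move m n)) :
    (L.foldl (step E) s).hom E.word = 1 := by
  induction L generalizing s with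
  | nil => exact hs
  | cons k L ih =>
    refine ih ?_
    rw [step_hom_word, hs]
    exact map_one _

theorem MapsTo.foldl {s s' : Stage G m n} (h : s.MapsTo s') (L : List (Move m n)) :
    (L.foldl (Stage.step E) s).MapsTo (L.foldl (Stage.step E) s') := by
  induction L generalizing s s' with
  | nil => exact h
  | cons k L ih => exact ih (h.step E k)

/-- The result of the first list of steps maps to the result of the second one. -/
def Refines (L L' : List (Move m n)) : Prop :=
  ∀ s : Stage G m n, (L.foldl (step E) s).MapsTo (L'.foldl (step E) s)

variable {E}

theorem Refines.refl (L : List (Move m n)) : Refines E L L := fun _ => MapsTo.refl _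

theorem Refines.trans {L L' L'' : List (Move m n)} (h : Refines E L L') (h' : Refines E L' L'') :
    Refines E L L'' := fun s => (h s).trans (h' s)

theorem Refines.append_left (L₀ : List (Move m n)) {L L' : List (Move m n)} (h : Refines E L L') :
    Refines E (L₀ ++ L) (L₀ ++ L') := fun s => by
  rw [List.foldl_append, List.foldl_append]
  exact h _

theorem Refines.append_right {L L' : List (Move m n)} (h : Refines E L L')
    (L₀ : List (Move m n)) : Refines E (L ++ L₀) (L' ++ L₀) := fun s => by
  rw [List.foldl_append, List.foldl_append]
  exact (h s).foldl E L₀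

theorem refines_of_sublist {L L' : List (Move m n)} (h : L'.Sublist L) : Refines E L L' := by
  induction h with
  | slnil => exact Refines.refl _
  | cons k _ ih => exact fun s => ((step_mapsTo E s k).foldl E _).trans (ih s)
  | cons_cons k _ ih => exact fun s => ih _

theorem refines_cons_append {k : Move m n} {L : List (Move m n)}
    (h : ∀ l ∈ L, k.hi < l.lo ∨ l.hi < k.lo) : Refines E (k :: L) (L ++ [k]) := by
  induction L with
  | nil => exact Refines.refl _
  | cons l L ih =>
    refine Refines.trans (L' := l :: k :: L) (fun s => ?_)
      ((ih fun l' hl' => h l' (List.mem_cons_of_mem _ hl')).append_left [l])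
    exact (step_step_mapsTo E s (h l (List.mem_cons_self ..))).foldl E L

theorem refines_append_comm {L L' : List (Move m n)}
    (h : ∀ k ∈ L, ∀ l ∈ L', k.hi < l.lo ∨ l.hi < k.lo) : Refines E (L ++ L') (L' ++ L) := by
  induction L with
  | nil => simpa using Refines.refl _
  | cons k L ih =>
    have h1 := (ih fun k' hk' => h k' (List.mem_cons_of_mem _ hk')).append_left [k]
    have h2 := (refines_cons_append (E := E) (h k (List.mem_cons_self ..))).append_right L
    simpa using h1.trans h2

/-- The lists `b i` move to the left past every `a j` with `j ≥ i + 2`, so that `b i` ends up right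
after `a (i + 1)`. -/
theorem refines_interleave {a b : ℕ → List (Move m n)}
    (h : ∀ i j, i + 2 ≤ j → ∀ k ∈ a j, ∀ l ∈ b i, k.hi < l.lo ∨ l.hi < k.lo) (N : ℕ) :
    Refines E ((List.range (N + 1)).flatMap a ++ (List.range N).flatMap b)
      (a 0 ++ (List.range N).flatMap fun i => a (i + 1) ++ b i) := by
  induction N with
  | zero => simpa using Refines.refl _
  | succ N ih =>
    have h1 : Refines E (a (N + 1) ++ (List.range N).flatMap b)
        ((List.range N).flatMap b ++ a (N + 1)) := refines_append_comm fun k hk l hl => by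
      obtain ⟨i, hi, hl⟩ := List.mem_flatMap.1 hl
      have := List.mem_range.1 hi
      exact h i (N + 1) (by omega) k hk l hl
    have h2 := (h1.append_left ((List.range (N + 1)).flatMap a)).append_right (b N)
    have h3 := ih.append_right (a (N + 1) ++ b N)
    rw [List.range_succ (n := N + 1), List.range_succ (n := N)] at *
    simp only [List.flatMap_append, List.flatMap_singleton, List.append_assoc] at *
    exact h2.trans h3

end Stage

/-! ### Variants of the injectivity criterion. -/

namespace CentralizerExtension

open HNNExtension

variable {H : Type u} [Group H] {w : H}

/-- A version of the injectivity criterion modulo a normal subgroup. -/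
theorem mem_of_mem_closure_of_map_eq_one {Γ J : Type*} [Group Γ] (N : Subgroup Γ) [N.Normal]
    (f : Γ →* CentralizerExtension H w) (φ : Γ →* H) (hNf : N ≤ f.ker) (hNφ : N ≤ φ.ker)
    (B : Subgroup Γ) (s : J → Γ) (p q : J → H)
    (hB : ∀ b ∈ B, f b = of (φ b)) (hs : ∀ j, f (s j) = of (p j) * t * of (q j))
    (hinj : ∀ b ∈ B, φ b = 1 → b ∈ N)
    (hq : ∀ i j, ∀ b ∈ B, Commute (q i * φ b * (q j)⁻¹) w →
      ∃ b' ∈ B, b'⁻¹ * (s i * b * (s j)⁻¹) ∈ N)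
    (hp : ∀ i j, ∀ b ∈ B, Commute ((p i)⁻¹ * φ b * p j) w →
      ∃ b' ∈ B, b'⁻¹ * ((s i)⁻¹ * b * s j) ∈ N) :
    ∀ γ ∈ Subgroup.closure (B ∪ Set.range s), f γ = 1 → γ ∈ N := by
  intro γ hγ hf
  let π := QuotientGroup.mk' N
  rw [← QuotientGroup.eq_one_iff]
  refine eq_one_of_mem_closure_of_map_eq_one (QuotientGroup.lift N f hNf)
    (QuotientGroup.lift N φ hNφ) (B.map π) (fun j => π (s j)) p q ?_ hs ?_ ?_ ?_ (π γ) ?_ hf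
  · rintro _ ⟨b, hb, rfl⟩
    exact hB b hb
  · rintro _ ⟨b, hb, rfl⟩ h
    exact (QuotientGroup.eq_one_iff b).2 (hinj b hb h)
  · rintro i j _ ⟨b, hb, rfl⟩ h
    obtain ⟨b', hb', h'⟩ := hq i j b hb h
    exact ⟨b', hb', QuotientGroup.eq.2 h'⟩
  · rintro i j _ ⟨b, hb, rfl⟩ h
    obtain ⟨b', hb', h'⟩ := hp i j b hb h
    exact ⟨b', hb', QuotientGroup.eq.2 h'⟩
  · have h1 : Subgroup.closure (B ∪ Set.range s) ≤
        (Subgroup.closure ((B.map π : Set (Γ ⧸ N)) ∪ Set.range fun j => π (s j))).comap π := by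
      rw [Subgroup.closure_le]
      rintro x (hx | ⟨j, rfl⟩)
      · exact Subgroup.subset_closure (Or.inl ⟨x, hx, rfl⟩)
      · exact Subgroup.subset_closure (Or.inr ⟨j, rfl⟩)
    exact h1 hγ

/-- The injectivity criterion for one letter that is free over the subgroup. -/
theorem eq_one_of_mem_closure_insert {Γ : Type*} [Group Γ]
    (f : Γ →* CentralizerExtension H w) (φ : Γ →* H) (B : Subgroup Γ) (s : Γ) (p q : H)
    (hB : ∀ b ∈ B, f b = of (φ b)) (hs : f s = of p * t * of q)
    (hinj : ∀ b ∈ B, φ b = 1 → b = 1)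
    (hq : ∀ b ∈ B, Commute (q * φ b * q⁻¹) w → φ b = 1)
    (hp : ∀ b ∈ B, Commute (p⁻¹ * φ b * p) w → φ b = 1) :
    ∀ γ ∈ Subgroup.closure (B ∪ {s}), f γ = 1 → γ = 1 := by
  intro γ hγ
  refine eq_one_of_mem_closure_of_map_eq_one (J := Unit) f φ B (fun _ => s) (fun _ => p)
    (fun _ => q) hB (fun _ => hs) hinj (fun _ _ b hb h => ?_) (fun _ _ b hb h => ?_) γ
    (by simpa using hγ)
  · simp [hinj b hb (hq b hb h)]
  · simp [hinj b hb (hp b hb h)]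

end CentralizerExtension

/-! ### Making the variables `z_i` free. -/

/-- `H` is fully residually free, and separated by the retractions onto `G`. -/
structure IsSeparated {G H : Type u} [Group G] [Group H] (ι : G →* H) : Prop where
  isFullyResiduallyFree : IsFullyResiduallyFree H
  exists_retraction : ∀ h : H, h ≠ 1 → ∃ r : H →* G, (∀ g, r (ι g) = g) ∧ r h ≠ 1

namespace GX

open HNNExtension CentralizerExtension

variable {G : Type u} [Group G] {m n : ℕ} {H : Type u} [Group H] {ι : G →* H}
  {v : QVar m n → H} (E : QuadEq G m n)

theorem _root_.IsSeparated.step (h : IsSeparated ι) {u : H} (hu : u ≠ 1) :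
    IsSeparated (stepIncl ι u) where
  isFullyResiduallyFree := CentralizerExtension.isFullyResiduallyFree h.1 hu
  exists_retraction := fun x hx => by
    obtain ⟨N, hN⟩ := exists_retraction_ne_one h.1 hu hx
    obtain ⟨r, h1, h2⟩ := h.2 _ hN
    exact ⟨r.comp (retraction u N), fun g => by simp [h1], h2⟩

/-- The homomorphism is injective on the subgroup. -/
def IsFaithfulOn {Γ K : Type*} [Group Γ] [Group K] (f : Γ →* K) (B : Subgroup Γ) : Prop :=
  ∀ b ∈ B, f b = 1 → b = 1

theorem IsFaithfulOn.mono {Γ K : Type*} [Group Γ] [Group K] {f : Γ →* K} {B B' : Subgroup Γ}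
    (h : IsFaithfulOn f B) (hB : B' ≤ B) : IsFaithfulOn f B' := fun b hb => h b (hB hb)

theorem IsFaithfulOn.commute {Γ K : Type*} [Group Γ] [Group K] {f : Γ →* K} {B : Subgroup Γ}
    (h : IsFaithfulOn f B) {a b : Γ} (ha : a ∈ B) (hb : b ∈ B) (hab : Commute (f a) (f b)) :
    Commute a b := by
  rw [← mul_inv_mul_inv_eq_one_iff_commute] at hab ⊢
  exact h _ (mul_mem (mul_mem (mul_mem ha hb) (inv_mem ha)) (inv_mem hb)) (by simpa using hab)

end GX

namespace GX

open HNNExtension CentralizerExtension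

variable {G : Type u} [Group G] {m n : ℕ} {H : Type u} [Group H] {ι : G →* H}
  {v : QVar m n → H} (E : QuadEq G m n)

/-- The invariants of a point of the construction at which the values of the variables of the
first `j` atoms are known to be independent over `G`. -/
structure IsGood (ι : G →* H) (v : QVar m n → H) (j : ℕ) : Prop where
  separated : IsSeparated ι
  faithful : IsFaithfulOn (eval ι v) (generated G {w | w.pos < j})
  handle : ∀ i : Fin n, j ≤ m + i → ¬ Commute (v (.x i)) (v (.y i))
  zz : ∀ h : j + 2 < m, ¬ Commute (eval ι v (E.atom ⟨j + 1, by omega⟩))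
    (eval ι v (E.atom ⟨j + 2, by omega⟩))
  zx : ∀ (h : j + 2 = m) (hn : 0 < n), ¬ Commute (eval ι v (E.atom ⟨j + 1, by omega⟩))
    (v (.x ⟨0, hn⟩))
  zzz : ∀ (_ : n = 0) (h : j + 3 = m), ¬ Commute (eval ι v (E.atom ⟨j, by omega⟩))
    (eval ι v (E.atom ⟨j + 1, by omega⟩) * eval ι v (E.atom ⟨j + 2, by omega⟩))

variable {E}

theorem generated_pos_lt_succ_le {j : ℕ} (hj : j < m) :
    generated G {w : QVar m n | w.pos < j + 1} ≤
      Subgroup.closure (generated G {w : QVar m n | w.pos < j} ∪ {var (.z ⟨j, hj⟩)}) := by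
  refine generated_le (fun g => Subgroup.subset_closure (Or.inl (const_mem_generated g _)))
    fun w hw => ?_
  have hw' : w.pos < j + 1 := hw
  by_cases h : w.pos < j
  · exact Subgroup.subset_closure (Or.inl (var_mem_generated h))
  · rcases w with i | i | i <;> simp only [QVar.pos] at h hw'
    · omega
    · omega
    · obtain rfl : i = ⟨j, hj⟩ := Fin.ext (by simp only; omega)
      exact Subgroup.subset_closure (Or.inr rfl)

theorem stepVal_zz_left {i : ℕ} (hi : i < m - 1) (u : H) (hi' : i < m) :
    stepVal v (.zz ⟨i, hi⟩) u (.z ⟨i, hi'⟩) = of (v (.z ⟨i, hi'⟩)) * t := by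
  simp [stepVal, Move.act]

theorem stepVal_zz_right {i : ℕ} (hi : i < m - 1) (u : H) (hi' : i + 1 < m) :
    stepVal v (.zz ⟨i, hi⟩) u (.z ⟨i + 1, hi'⟩) = of (v (.z ⟨i + 1, hi'⟩)) * t := by
  simp [stepVal, Move.act]

theorem eval_step_atom_of_val_eq {k : Move m n} {u : H} {i : ℕ} (hi : i < m) (hi' : i < m + n)
    (hz : stepVal v k u (.z ⟨i, hi⟩) = of (v (.z ⟨i, hi⟩)) * t) :
    eval (stepIncl ι u) (stepVal v k u) (E.atom ⟨i, hi'⟩) =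
      t⁻¹ * of (eval ι v (E.atom ⟨i, hi'⟩)) * t := by
  rw [eval_atom_of_lt E _ _ hi, eval_atom_of_lt E _ _ hi, hz]
  simp [stepIncl, mul_assoc]

theorem eval_atom_ne_one (hι : Function.Injective ι) (hc : ∀ i, E.c i ≠ 1) {i : ℕ} (hi : i < m)
    (hi' : i < m + n) : eval ι v (E.atom ⟨i, hi'⟩) ≠ 1 := by
  rw [eval_atom_of_lt E _ _ hi]
  intro h
  rw [mul_assoc, inv_mul_eq_one, right_eq_mul] at h
  exact hc _ (hι (h.trans (map_one ι).symm))

theorem IsGood.injective {j : ℕ} (h : IsGood E ι v j) : Function.Injective ι := by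
  refine (injective_iff_map_eq_one ι).2 fun g hg => ?_
  have := h.faithful (const g) (const_mem_generated g _) (by simpa using hg)
  exact const_eq_one_iff.1 this

/-- The element `a * b ^ t` does not commute with elements of the base group, and
extending its centralizer makes the next variable free. -/
theorem IsGood.step_step {j : ℕ} (h : IsGood E ι v j) (hj : j + 1 < m) {k : Move m n} {u : H}
    (hk : j < k.lo) (hz : stepVal v k u (.z ⟨j + 1, hj⟩) = of (v (.z ⟨j + 1, hj⟩)) * t)
    (hu : ¬ Commute (eval ι v (E.atom ⟨j + 1, by omega⟩)) u) {u' : CentralizerExtension H u}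
    (hu' : u' = eval (stepIncl ι u) (stepVal v k u) (Move.period E (.zz ⟨j, by omega⟩))) :
    u' = of (eval ι v (E.atom ⟨j, by omega⟩)) *
      (t⁻¹ * of (eval ι v (E.atom ⟨j + 1, by omega⟩)) * t) ∧
    (∀ g, g ≠ 1 → ¬ Commute (of g) u') ∧
    IsSeparated (stepIncl (stepIncl ι u) u') ∧
    IsFaithfulOn (eval (stepIncl (stepIncl ι u) u')
      (stepVal (stepVal v k u) (.zz ⟨j, by omega⟩) u')) (generated G {w | w.pos < j + 1}) := by
  have h1 : u' = of (eval ι v (E.atom ⟨j, by omega⟩)) *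
      (t⁻¹ * of (eval ι v (E.atom ⟨j + 1, by omega⟩)) * t) := by
    rw [hu', Move.period, map_mul, eval_step_atom_of_val_eq hj _ hz,
      eval_step_atom_of_outside E (Or.inl hk)]
  have h2 : ∀ g, g ≠ 1 → ¬ Commute (of g) u' := fun g hg => by
    rw [h1]
    -- The first step has conjugated only the second factor of the new period by `t`; that is why
    -- the period avoids the centralizers of all non-trivial elements of the base group.
    simpa using not_commute_of_mul_conj h.separated.1 1 hu hg
      (a := eval ι v (E.atom ⟨j, by omega⟩))
  have hu0 : u ≠ 1 := by
    rintro rfl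
    exact hu (Commute.one_right _)
  have hu0' : u' ≠ 1 := fun h0 => h2 u hu0 (by rw [h0]; exact Commute.one_right _)
  have hY : ∀ w : QVar m n, w ∈ {w : QVar m n | w.pos < j} → w.pos < k.lo ∨ k.hi < w.pos :=
    fun w hw => Or.inl (lt_trans hw hk)
  have hY' : ∀ w : QVar m n, w ∈ {w : QVar m n | w.pos < j} →
      w.pos < (Move.zz ⟨j, by omega⟩ : Move m n).lo ∨
        (Move.zz ⟨j, by omega⟩ : Move m n).hi < w.pos := fun w hw => by
    left
    exact hw
  refine ⟨h1, h2, (h.separated.step hu0).step hu0', fun γ hγ => ?_⟩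
  have hB : ∀ b ∈ generated G {w : QVar m n | w.pos < j},
      eval (stepIncl (stepIncl ι u) u') (stepVal (stepVal v k u) (.zz ⟨j, by omega⟩) u') b =
        of (of (eval ι v b)) := fun b hb => by
    rw [eval_step_of_mem hY' hb, eval_step_of_mem hY hb]
  have hs : eval (stepIncl (stepIncl ι u) u') (stepVal (stepVal v k u) (.zz ⟨j, by omega⟩) u')
      (var (.z ⟨j, by omega⟩)) = of (of (v (.z ⟨j, by omega⟩))) * t * of 1 := by
    rw [eval_var, stepVal_zz_left, map_one, mul_one]
    congr 2
    exact Move.act_of_outside t (fun w => of (v w)) (Or.inl hk)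
  refine eq_one_of_mem_closure_insert _ (of.comp (eval ι v)) _ _ _ _ hB hs
    (fun b hb hb1 => h.faithful b hb (of_eq_one_iff.1 hb1)) ?_ ?_ γ
    (generated_pos_lt_succ_le _ hγ)
  · intro b hb hc
    by_contra h3
    exact h2 (eval ι v b) (fun h4 => h3 (by rw [MonoidHom.comp_apply, h4, map_one]))
      (by simpa using hc)
  · intro b hb hc
    by_contra h3
    rw [MonoidHom.comp_apply, ← map_inv, ← map_mul, ← map_mul] at hc
    refine h2 _ (fun h4 => h3 ?_) hc
    have : eval ι v b = 1 := by simpa [mul_assoc, inv_mul_eq_one] using h4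
    rw [MonoidHom.comp_apply, this, map_one]

theorem commute_mul_right_self_iff {K : Type*} [Group K] {a b : K} :
    Commute b (a * b) ↔ Commute b a :=
  ⟨fun h => by simpa using h.mul_right (Commute.refl b).inv_right,
    fun h => h.mul_right (Commute.refl b)⟩

theorem commute_mul_left_self_iff {K : Type*} [Group K] {a b : K} :
    Commute a (a * b) ↔ Commute a b :=
  ⟨fun h => by simpa using (Commute.refl a).inv_right.mul_right h,
    fun h => (Commute.refl a).mul_right h⟩

theorem not_commute_conj_t (hH : IsFullyResiduallyFree H) {u b g : H} (hb : ¬ Commute b u)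
    (hg : g ≠ 1) : ¬ Commute (t⁻¹ * of b * t) (of g : CentralizerExtension H u) := fun hc =>
  not_commute_of_mul_conj (a := 1) hH 1 hb hg (by simpa using hc.symm)

theorem stepVal_of_outside {k : Move m n} {u : H} {w : QVar m n}
    (hw : w.pos < k.lo ∨ k.hi < w.pos) : stepVal v k u w = of (v w) :=
  Move.act_of_outside t (fun w => of (v w)) hw

/-- The first step puts a letter into `r_{j+1}` and `r_{j+2}`, the second one then frees `z_j`. The
invariants reappear one place further: `r_{j+2}` has become a conjugate by `t` of an element outside
the centralizer of `u`, whereas the atom or variable that follows it still has its value in the base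
group, and two such elements cannot commute. -/
theorem IsGood.zz_zz {j : ℕ} (h : IsGood E ι v j) (hc : ∀ i, E.c i ≠ 1) (hj : j + 2 < m) {u : H}
    (hu : u = eval ι v (Move.period E (.zz ⟨j + 1, by omega⟩))) {u' : CentralizerExtension H u}
    (hu' : u' = eval (stepIncl ι u) (stepVal v (.zz ⟨j + 1, by omega⟩) u)
      (Move.period E (.zz ⟨j, by omega⟩))) :
    IsGood E (stepIncl (stepIncl ι u) u')
      (stepVal (stepVal v (.zz ⟨j + 1, by omega⟩) u) (.zz ⟨j, by omega⟩) u') (j + 1) := by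
  have hb := h.zz hj
  rw [Move.period, map_mul] at hu
  have hbu : ¬ Commute (eval ι v (E.atom ⟨j + 1, by omega⟩)) u := by
    rwa [hu, commute_mul_left_self_iff]
  have hcu : ¬ Commute (eval ι v (E.atom ⟨j + 2, by omega⟩)) u := by
    rw [hu, commute_mul_right_self_iff]
    exact fun h' => hb h'.symm
  have hz1 : stepVal v (.zz ⟨j + 1, by omega⟩) u (.z ⟨j + 1, by omega⟩) =
      of (v (.z ⟨j + 1, by omega⟩)) * t := stepVal_zz_left _ _ _
  have hz2 : stepVal v (.zz ⟨j + 1, by omega⟩) u (.z ⟨j + 2, by omega⟩) =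
      of (v (.z ⟨j + 2, by omega⟩)) * t := stepVal_zz_right _ _ _
  obtain ⟨h1, h2, h3, h4⟩ := h.step_step (by omega) (by simp [Move.lo]) hz1 hbu hu'
  have hne : ∀ {i : ℕ} (hi : i < m) (hi' : i < m + n), eval ι v (E.atom ⟨i, hi'⟩) ≠ 1 :=
    fun hi hi' => eval_atom_ne_one h.injective hc hi hi'
  refine ⟨h3, h4, fun i hi => ?_, fun hj' => ?_, fun hj' hn => ?_, fun _ hj' => ?_⟩
  · rw [stepVal_of_outside, stepVal_of_outside, stepVal_of_outside, stepVal_of_outside,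
      commute_of_of_iff, commute_of_of_iff]
    · exact h.handle i (by omega)
    all_goals right; simp only [Move.hi, QVar.pos]; omega
  · rw [eval_step_atom_of_outside (u := u') (j := ⟨j + 1 + 1, _⟩),
      eval_step_atom_of_outside (u := u') (j := ⟨j + 1 + 2, _⟩), commute_of_of_iff,
      eval_step_atom_of_val_eq (by omega) _ hz2, eval_step_atom_of_outside]
    · exact not_commute_conj_t h.separated.1 hcu (hne hj' _)
    all_goals right; simp only [Move.hi]; omega
  · rw [eval_step_atom_of_outside, stepVal_of_outside, stepVal_of_outside, commute_of_of_iff,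
      eval_step_atom_of_val_eq (by omega) _ hz2]
    · refine not_commute_conj_t h.separated.1 hcu fun h0 => h.handle ⟨0, hn⟩ (by omega) ?_
      rw [h0]
      exact Commute.one_left _
    all_goals right; simp only [Move.hi, QVar.pos]; omega
  · rw [eval_step_atom_of_outside (j := ⟨j + 1 + 1, _⟩),
      eval_step_atom_of_outside (j := ⟨j + 1 + 2, _⟩), ← map_mul,
      eval_step_atom_of_val_eq (by omega) _ (stepVal_zz_right _ _ _)]
    · refine not_commute_conj_t (h.separated.step ?_).1 ?_ ?_
      · rintro rfl
        exact hbu (Commute.one_right _)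
      · rw [h1, eval_step_atom_of_val_eq (by omega) _ hz1, commute_mul_right_self_iff]
        exact not_commute_conj_t h.separated.1 hbu (hne (by omega) _)
      · rw [eval_step_atom_of_val_eq (by omega) _ hz2, eval_step_atom_of_outside]
        · intro h0
          refine not_commute_conj_t h.separated.1 hcu
            (hne (i := j + 3) (by omega) (by omega)) ?_
          rw [mul_eq_one_iff_eq_inv.1 h0]
          exact (Commute.refl _).inv_left
        · right; simp only [Move.hi]; omega
    all_goals right; simp only [Move.hi]; omega

theorem stepVal_zx_z (hm : 0 < m) (hn : 0 < n) (u : H) {i : ℕ} (hi : i < m) (hi' : i + 1 = m) :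
    stepVal v (.zx hm hn) u (.z ⟨i, hi⟩) = of (v (.z ⟨i, hi⟩)) * t := by
  have : i = m - 1 := by omega
  simp [stepVal, Move.act, this]

theorem stepVal_zx_handle (hm : 0 < m) (hn : 0 < n) (u : H) (i : Fin n)
    (h : ¬ Commute (v (.x i)) (v (.y i))) :
    ¬ Commute (stepVal v (.zx hm hn) u (.x i)) (stepVal v (.zx hm hn) u (.y i)) := by
  by_cases hi : i.1 = 0
  · intro hc
    refine h (commute_of_commute_conj_inv_mul (w := u) ?_)
    simpa [stepVal, Move.act, hi] using hc
  · simpa [stepVal, Move.act, hi, commute_of_of_iff] using h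

theorem IsGood.zx_zz {j : ℕ} (h : IsGood E ι v j) (hj : j + 2 = m) (hm : 0 < m) (hn : 0 < n)
    {u : H} (hu : u = eval ι v (Move.period E (.zx hm hn))) {u' : CentralizerExtension H u}
    (hu' : u' = eval (stepIncl ι u) (stepVal v (.zx hm hn) u)
      (Move.period E (.zz ⟨j, by omega⟩))) :
    IsGood E (stepIncl (stepIncl ι u) u')
      (stepVal (stepVal v (.zx hm hn) u) (.zz ⟨j, by omega⟩) u') (j + 1) := by
  have hb := h.zx hj hn
  have hbu : ¬ Commute (eval ι v (E.atom ⟨j + 1, by omega⟩)) u := by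
    have : ∀ h' : m - 1 < m + n, (⟨m - 1, h'⟩ : Fin (m + n)) = ⟨j + 1, by omega⟩ := fun h' =>
      Fin.ext (by simp only; omega)
    rw [hu, Move.period, map_mul, map_inv, eval_var, this, commute_mul_left_self_iff]
    exact fun h' => hb (by simpa using h'.inv_right)
  obtain ⟨-, -, h3, h4⟩ := h.step_step (by omega) (by simp only [Move.lo]; omega)
    (stepVal_zx_z hm hn u _ (by omega)) hbu hu'
  refine ⟨h3, h4, fun i hi => ?_, fun hj' => by omega, fun hj' => by omega, fun hn' => by omega⟩
  rw [stepVal_of_outside (u := u'), stepVal_of_outside (u := u'), commute_of_of_iff]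
  · exact stepVal_zx_handle hm hn u i (h.handle i (by omega))
  all_goals right; simp only [Move.hi, QVar.pos]; omega

theorem isFaithfulOn_generated_pos_lt_zero (hι : Function.Injective ι) :
    IsFaithfulOn (eval ι v) (generated G {w : QVar m n | w.pos < 0}) := by
  intro γ hγ hγ1
  have h1 : generated G {w : QVar m n | w.pos < 0} ≤ (Monoid.Coprod.inl : G →* GX G m n).range :=
    generated_le (fun g => ⟨g, rfl⟩) fun w hw => absurd hw (Nat.not_lt_zero _)
  obtain ⟨g, rfl⟩ := h1 hγ
  have h2 : ι g = 1 := (eval_const ι v g).symm.trans hγ1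
  rw [hι (h2.trans (map_one ι).symm), map_one]

theorem isGood_zero (hs : IsSeparated ι) (hι : Function.Injective ι)
    (hh : ∀ i : Fin n, ¬ Commute (v (.x i)) (v (.y i))) (hm : m ≤ 1) : IsGood E ι v 0 := by
  exact ⟨hs, isFaithfulOn_generated_pos_lt_zero hι, fun i _ => hh i, fun hj' => by omega,
    fun hj' => by omega, fun _ hj' => by omega⟩

/-- The only block of links without a predecessor: one step at the first two atoms produces the
non-commutation that the later blocks need, whatever the third atom is. -/
theorem isGood_zz_zero (hs : IsSeparated ι) (hι : Function.Injective ι) (hc : ∀ i, E.c i ≠ 1)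
    (hh : ∀ i : Fin n, ¬ Commute (v (.x i)) (v (.y i))) (hm : 1 < m)
    (h01 : ¬ Commute (eval ι v (E.atom ⟨0, by omega⟩)) (eval ι v (E.atom ⟨1, by omega⟩)))
    (h012 : ∀ (_ : n = 0) (h : 3 = m), eval ι v (E.atom ⟨0, by omega⟩) *
      eval ι v (E.atom ⟨1, by omega⟩) * eval ι v (E.atom ⟨2, by omega⟩) ≠ 1) {u : H}
    (hu : u = eval ι v (Move.period E (.zz ⟨0, by omega⟩))) :
    IsGood E (stepIncl ι u) (stepVal v (.zz ⟨0, by omega⟩) u) 0 := by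
  rw [Move.period, map_mul] at hu
  have hau : ¬ Commute (eval ι v (E.atom ⟨0, by omega⟩)) u := by
    rwa [hu, commute_mul_left_self_iff]
  have hbu : ¬ Commute (eval ι v (E.atom ⟨1, by omega⟩)) u := by
    rw [hu, commute_mul_right_self_iff]
    exact fun h' => h01 h'.symm
  have hu0 : u ≠ 1 := by
    rintro rfl
    exact hau (Commute.one_right _)
  have hz0 : stepVal v (.zz ⟨0, by omega⟩) u (.z ⟨0, by omega⟩) =
      of (v (.z ⟨0, by omega⟩)) * t := stepVal_zz_left _ _ _
  have hz1 : stepVal v (.zz ⟨0, by omega⟩) u (.z ⟨0 + 1, by omega⟩) =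
      of (v (.z ⟨0 + 1, by omega⟩)) * t := stepVal_zz_right _ _ _
  have hne : ∀ {i : ℕ} (hi : i < m) (hi' : i < m + n), eval ι v (E.atom ⟨i, hi'⟩) ≠ 1 :=
    fun hi hi' => eval_atom_ne_one hι hc hi hi'
  refine ⟨hs.step hu0, isFaithfulOn_generated_pos_lt_zero fun a b hab =>
    hι (of_injective (w := u) hab), fun i _ => ?_, fun hj' => ?_, fun hj' hn => ?_,
    fun hn hj' => ?_⟩
  · rw [stepVal_of_outside, stepVal_of_outside, commute_of_of_iff]
    · exact hh i
    all_goals right; simp only [Move.hi, QVar.pos]; omega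
  · rw [eval_step_atom_of_val_eq (by omega) _ hz1, eval_step_atom_of_outside]
    · exact not_commute_conj_t hs.1 hbu (hne hj' _)
    · right; simp only [Move.hi]; omega
  · rw [eval_step_atom_of_val_eq (by omega) _ hz1, stepVal_of_outside]
    · refine not_commute_conj_t hs.1 hbu fun h0 => hh ⟨0, hn⟩ ?_
      rw [h0]
      exact Commute.one_left _
    · right; simp only [Move.hi, QVar.pos]; omega
  -- The total product of the three atoms is unchanged, because `t` commutes with the product `u` of
  -- the first two. So the claim compares the conjugate `r_0 ^ t` with a non-trivial element of the
  -- base group.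
  · have ht : t⁻¹ * of u * t = (of u : CentralizerExtension H u) := by
      rw [mul_assoc, ← (commute_t_of (Commute.refl u)).eq, inv_mul_cancel_left]
    rw [eval_step_atom_of_val_eq (by omega) _ hz0, eval_step_atom_of_val_eq (by omega) _ hz1,
      eval_step_atom_of_outside (j := ⟨0 + 2, _⟩), ← commute_mul_left_self_iff]
    have h1 : t⁻¹ * of (eval ι v (E.atom ⟨0, by omega⟩)) * t *
        (t⁻¹ * of (eval ι v (E.atom ⟨0 + 1, by omega⟩)) * t *
          of (eval ι v (E.atom ⟨0 + 2, by omega⟩))) =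
        (of (u * eval ι v (E.atom ⟨2, by omega⟩)) : CentralizerExtension H u) := by
      rw [map_mul of u, ← ht, congrArg of hu, map_mul]
      simp [mul_assoc]
    · rw [h1]
      exact not_commute_conj_t hs.1 hau (by rw [hu]; exact h012 hn hj')
    · right; simp only [Move.hi]; omega

end GX

/-! ### Making handles free. -/

namespace GX

open HNNExtension CentralizerExtension

variable {G : Type u} [Group G] {m n : ℕ} {H K : Type u} [Group H] [Group K] {ι : G →* H}
  {v : QVar m n → H} {E : QuadEq G m n}

/-- The conjugate `y_i ^ x_i`. -/
def handleConj (G : Type u) [Group G] {m n : ℕ} (i : Fin n) : GX G m n :=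
  (var (.x i))⁻¹ * var (.y i) * var (.x i)

/-- The properties of the three twists of a handle. -/
structure IsTwist (i : Fin n) (ι : G →* H) (v : QVar m n → H) (f : H →* K) (ι' : G →* K)
    (v' : QVar m n → K) : Prop where
  separated : IsSeparated ι'
  injective : Function.Injective f
  map_incl : ∀ g, f (ι g) = ι' g
  map_val : ∀ w : QVar m n, w.pos ≠ m + i → f (v w) = v' w
  not_commute : ¬ Commute (v' (.x i)) (v' (.y i))
  free : ∀ a h, h ≠ 1 → ¬ Commute (f h) (v' (.x i) * f a)
  faithful : ∀ B ≤ generated G {w : QVar m n | w.pos ≠ m + i}, IsFaithfulOn (eval ι v) B →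
    IsFaithfulOn (eval ι' v') (Subgroup.closure (B ∪ {handleConj G i}))

theorem IsTwist.map_eval {i : Fin n} {f : H →* K} {ι' : G →* K} {v' : QVar m n → K}
    (h : IsTwist i ι v f ι' v') {γ : GX G m n}
    (hγ : γ ∈ generated G {w : QVar m n | w.pos ≠ m + i}) :
    f (eval ι v γ) = eval ι' v' γ :=
  map_eval_of_mem ι v f h.map_incl h.map_val hγ

theorem not_commute_t_mul {a b : H} (hab : ¬ Commute a b) :
    ¬ Commute (of a) (t * of b : CentralizerExtension H a) := fun hc =>
  hab (commute_of_commute_t_mul hc).2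

theorem not_commute_of_t_mul (hH : IsFullyResiduallyFree H) {x y g : H} (hxy : ¬ Commute x y)
    (hg : g ≠ 1) : ¬ Commute (of g) (t * of y : CentralizerExtension H x) := fun hc =>
  hxy (hH.commute_trans hg (commute_of_commute_t_mul hc).1.symm
    (commute_of_commute_t_mul hc).2.symm)

/-- Let `t₁, t₂, t₃` be the three letters. The new `x` is `t₂ x`, and an old element commuting with
`t₂ x a` would commute with `t₁ y`, hence with both `x` and `y`. The conjugate `x⁻¹ y x` becomes
`t₃` times an element without `t₂` and `t₃`, since `t₃` commutes with the new `x` and `t₂` with the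
`y` before it; so it is free. This conjugate is used instead of `y` because the later link at `y_i
x_{i+1}⁻¹` leaves it fixed. -/
theorem isTwist (hs : IsSeparated ι) (i : Fin n) (hxy : ¬ Commute (v (.x i)) (v (.y i)))
    {u₁ : H} (h₁ : u₁ = v (.x i)) {u₂ : CentralizerExtension H u₁}
    (h₂ : u₂ = stepVal v (.twistY i) u₁ (.y i)) {u₃ : CentralizerExtension _ u₂}
    (h₃ : u₃ = stepVal (stepVal v (.twistY i) u₁) (.twistX i) u₂ (.x i)) :
    IsTwist i ι v (of.comp (of.comp of)) (stepIncl (stepIncl (stepIncl ι u₁) u₂) u₃)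
      (stepVal (stepVal (stepVal v (.twistY i) u₁) (.twistX i) u₂) (.twistY i) u₃) := by
  set v₁ := stepVal v (.twistY i) u₁ with hv₁
  set v₂ := stepVal v₁ (.twistX i) u₂ with hv₂
  have hx₁ : v₁ (.x i) = of (v (.x i)) := by simp [hv₁, stepVal, Move.act]
  have hy₁ : v₁ (.y i) = t * of (v (.y i)) := by simp [hv₁, stepVal, Move.act]
  have hx₂ : v₂ (.x i) = t * of (v₁ (.x i)) := by simp [hv₂, stepVal, Move.act]
  have hy₂ : v₂ (.y i) = of (v₁ (.y i)) := by simp [hv₂, stepVal, Move.act]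
  have hx₃ : stepVal v₂ (.twistY i) u₃ (.x i) = of (v₂ (.x i)) := by simp [stepVal, Move.act]
  have hy₃ : stepVal v₂ (.twistY i) u₃ (.y i) = t * of (v₂ (.y i)) := by simp [stepVal, Move.act]
  subst h₁
  have hc₁ : ¬ Commute (v₁ (.x i)) (v₁ (.y i)) := by
    rw [hx₁, hy₁]
    exact not_commute_t_mul hxy
  subst h₂
  have hc₂ : ¬ Commute (v₂ (.x i)) (v₂ (.y i)) := by
    rw [hx₂, hy₂]
    exact fun h => not_commute_t_mul (fun h' => hc₁ h'.symm) h.symm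
  subst h₃
  have hs₁ : IsSeparated (stepIncl ι (v (.x i))) := hs.step fun h => hxy (by
    rw [h]; exact Commute.one_left _)
  have hs₂ : IsSeparated (stepIncl (stepIncl ι (v (.x i))) (v₁ (.y i))) := hs₁.step fun h => hc₁ (by
    rw [h]; exact Commute.one_right _)
  have hmove : ∀ {Y : Type u} [Group Y] (w : QVar m n) (k : Move m n) (hk : k.lo = m + i)
      (hk' : k.hi = m + i) (y : QVar m n → Y) (u : Y), w.pos ≠ m + i →
      stepVal y k u w = of (y w) := fun w k hk hk' y u hw => stepVal_of_outside (by omega)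
  have hval₁ : ∀ w : QVar m n, w.pos ≠ m + i → of (v w) = v₁ w := fun w hw =>
    (hmove w _ rfl rfl _ _ hw).symm
  have hval₂ : ∀ w : QVar m n, w.pos ≠ m + i → of (of (v w)) = v₂ w := fun w hw => by
    rw [hval₁ w hw]
    exact (hmove w _ rfl rfl _ _ hw).symm
  have hval₃ : ∀ w : QVar m n, w.pos ≠ m + i → of (of (of (v w))) =
      stepVal v₂ (.twistY i) (v₂ (.x i)) w := fun w hw => by
    rw [hval₂ w hw]
    exact (hmove w _ rfl rfl _ _ hw).symm
  refine ⟨hs₂.step fun h => hc₂ (by rw [h]; exact Commute.one_left _),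
    of_injective.comp (of_injective.comp of_injective), fun g => rfl, hval₃, ?_, ?_, ?_⟩
  · rw [hx₃, hy₃]
    exact not_commute_t_mul hc₂
  · intro a h hh hcomm
    have h1 : Commute (of (of h)) (v₂ (.x i) * of (of a)) := by
      rw [hx₃, MonoidHom.comp_apply, MonoidHom.comp_apply, MonoidHom.comp_apply,
        MonoidHom.comp_apply, ← map_mul, commute_of_of_iff] at hcomm
      exact hcomm
    rw [hx₂, mul_assoc, ← map_mul] at h1
    have h2 := (commute_of_commute_t_mul h1).1
    rw [hy₁] at h2
    exact not_commute_of_t_mul hs.1 hxy hh h2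
  · intro B hB hf
    have hB₂ : ∀ b ∈ B, eval (stepIncl (stepIncl ι (v (.x i))) (v₁ (.y i))) v₂ b =
        of (of (eval ι v b)) := fun b hb =>
      (map_eval_of_mem ι v (of.comp of) (fun _ => rfl) hval₂ (hB hb)).symm
    have hB₃ : ∀ b ∈ B, eval (stepIncl (stepIncl (stepIncl ι (v (.x i))) (v₁ (.y i))) (v₂ (.x i)))
        (stepVal v₂ (.twistY i) (v₂ (.x i))) b = of ((of.comp (of.comp (eval ι v))) b) :=
      fun b hb => (map_eval_of_mem ι v (of.comp (of.comp of)) (fun _ => rfl) hval₃ (hB hb)).symm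
    -- First `t₂` cancels around `v₁ (.y i)`, then `t₃` is moved to the front past the inverse of
    -- the new `x`.
    have hconj : eval (stepIncl (stepIncl (stepIncl ι (v (.x i))) (v₁ (.y i))) (v₂ (.x i)))
        (stepVal v₂ (.twistY i) (v₂ (.x i))) (handleConj G i) =
        of 1 * t * of (of ((v₁ (.x i))⁻¹ * v₁ (.y i) * v₁ (.x i))) := by
      have h1 : (v₂ (.x i))⁻¹ * v₂ (.y i) * v₂ (.x i) =
          of ((v₁ (.x i))⁻¹ * v₁ (.y i) * v₁ (.x i)) := by
        have h2 := (commute_t_of (Commute.refl (v₁ (.y i)))).eq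
        have h3 := congrArg (fun z => (of (v₁ (.x i)))⁻¹ * (t⁻¹ * z * of (v₁ (.x i)))) h2
        rw [hx₂, hy₂]
        simpa [mul_assoc] using h3.symm
      have h2 := (commute_t_of (Commute.refl (v₂ (.x i)))).inv_right.eq
      rw [handleConj, map_mul, map_mul, map_inv, eval_var, eval_var, hx₃, hy₃, ← h1, map_mul,
        map_mul, map_inv, map_one, one_mul, ← mul_assoc, ← mul_assoc, ← mul_assoc, h2]
    have hfree : ∀ g, Commute (of g) (v₂ (.x i)) → g = 1 := fun g hg => by
      by_contra h
      rw [hx₂] at hg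
      exact not_commute_of_t_mul hs₁.1 (fun h => hc₁ h.symm) h hg
    refine eq_one_of_mem_closure_insert _ _ B _ _ _ hB₃ hconj ?_ ?_ ?_
    · intro b hb hb1
      rw [MonoidHom.comp_apply, MonoidHom.comp_apply, of_eq_one_iff, of_eq_one_iff] at hb1
      exact hf b hb hb1
    · intro b hb hc
      rw [MonoidHom.comp_apply, MonoidHom.comp_apply, ← map_inv, ← map_mul, ← map_mul] at hc
      have := hfree _ hc
      rw [mul_inv_eq_one, mul_eq_left] at this
      rw [MonoidHom.comp_apply, MonoidHom.comp_apply, this, map_one]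
    · intro b hb hc
      rw [MonoidHom.comp_apply, MonoidHom.comp_apply, inv_one, one_mul, mul_one] at hc
      rw [MonoidHom.comp_apply, MonoidHom.comp_apply, hfree _ hc, map_one]

/-- If the extended centralizer contains no nontrivial element of the image of `f`, then the
new letter is free over this image. -/
theorem isFaithfulOn_closure_insert {Γ : Type*} [Group Γ] {u : K} {f : H →* K}
    (hfree : ∀ h, h ≠ 1 → ¬ Commute (f h) u) {e : Γ →* CentralizerExtension K u} {φ : Γ →* H}
    {B : Subgroup Γ} (hinj : IsFaithfulOn φ B) (hB : ∀ b ∈ B, e b = of (f (φ b))) {s : Γ} {p : H}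
    (hs : e s = of (f p) * t) : IsFaithfulOn e (Subgroup.closure (B ∪ {s})) := by
  have hfree' : ∀ h, Commute (f h) u → h = 1 := fun h hc => by
    by_contra h1
    exact hfree h h1 hc
  refine eq_one_of_mem_closure_insert e (f.comp φ) B s (f p) 1 hB (by simpa using hs) ?_ ?_ ?_
  · intro b hb hb1
    refine hinj b hb (hfree' _ ?_)
    have : f (φ b) = 1 := hb1
    rw [this]
    exact Commute.one_left _
  · intro b hb hc
    rw [inv_one, one_mul, mul_one, MonoidHom.comp_apply] at hc
    rw [MonoidHom.comp_apply, hfree' _ hc, map_one]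
  · intro b hb hc
    rw [MonoidHom.comp_apply, ← map_inv, ← map_mul, ← map_mul] at hc
    have : φ b = 1 := by simpa [mul_assoc, inv_mul_eq_one] using hfree' _ hc
    rw [MonoidHom.comp_apply, this, map_one]

/-- The twists make the value of `x_1` independent of everything older, so the period `r_m x_1⁻¹`
commutes with no non-trivial old element, and `z_m ↦ z_m t` is free. -/
theorem IsGood.twist_zx {j : ℕ} (h : IsGood E ι v j) (hj : j + 1 = m) (hm : 0 < m) (hn : 0 < n)
    {f : H →* K} {ι' : G →* K} {v' : QVar m n → K} (hf : IsTwist ⟨0, hn⟩ ι v f ι' v') {u : K}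
    (hu : u = eval ι' v' (Move.period E (.zx hm hn))) :
    IsGood E (stepIncl ι' u) (stepVal v' (.zx hm hn) u) (j + 1) := by
  have hxy := h.handle ⟨0, hn⟩ (by omega)
  have hfree : ∀ g, g ≠ 1 → ¬ Commute (f g) u := by
    intro g hg hc
    refine hf.free (eval ι v (E.atom ⟨m - 1, by omega⟩))⁻¹ g hg ?_
    have h1 := hc.inv_right
    rw [hu, Move.period, map_mul, map_inv, eval_var, mul_inv_rev, inv_inv] at h1
    rw [map_inv, hf.map_eval]
    · exact h1
    · have h2 : {w : QVar m n | w.pos = m - 1} ⊆ {w : QVar m n | w.pos ≠ m + 0} := by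
        intro w hw
        have hw : w.pos = m - 1 := hw
        show w.pos ≠ m + 0
        omega
      exact generated_mono h2 (E.atom_mem_generated ⟨m - 1, by omega⟩)
  have hu1 : u ≠ 1 := fun hu1 => hfree (v (.x ⟨0, hn⟩))
    (fun h0 => hxy (by rw [h0]; exact Commute.one_left _)) (by rw [hu1]; exact Commute.one_right _)
  refine ⟨hf.separated.step hu1, ?_, fun i hi => ?_, fun hj' => by omega, fun hj' => by omega,
    fun _ hj' => by omega⟩
  · refine (isFaithfulOn_closure_insert hfree h.faithful (fun b hb => ?_)
      (p := v (.z ⟨j, by omega⟩)) ?_).mono (generated_pos_lt_succ_le (by omega))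
    · rw [hf.map_eval, eval_step_of_mem _ hb]
      · intro w hw
        have hw : w.pos < j := hw
        left
        simp only [Move.lo]
        omega
      · refine generated_mono (fun w (hw : w.pos < j) => ?_) hb
        show w.pos ≠ m + 0
        omega
    · rw [eval_var, stepVal_zx_z hm hn u _ hj, hf.map_val]
      show j ≠ m + 0
      omega
  · refine stepVal_zx_handle hm hn u i ?_
    by_cases hi0 : i = ⟨0, hn⟩
    · rw [hi0]
      exact hf.not_commute
    · have : i.1 ≠ 0 := fun h0 => hi0 (Fin.ext h0)
      have hpos : m + i.1 ≠ m + 0 := by omega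
      rw [← hf.map_val _ (by exact hpos), ← hf.map_val _ (by exact hpos)]
      intro hc
      exact h.handle i (by omega) (hf.injective (by simpa using hc.eq))

/-- The handle is generated by `y ^ x` and `x⁻¹`, which is the order in which the two letters are
shown to be free: the first by the twists, the second by the link. -/
theorem generated_pos_lt_handle_succ_le {l : ℕ} (hl : l < n) :
    generated G {w : QVar m n | w.pos < m + l + 1} ≤ Subgroup.closure
      ((Subgroup.closure (generated G {w : QVar m n | w.pos < m + l} ∪ {handleConj G ⟨l, hl⟩}) :
        Subgroup (GX G m n)) ∪ {(var (.x ⟨l, hl⟩))⁻¹}) := by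
  set B : Subgroup (GX G m n) :=
    Subgroup.closure (generated G {w : QVar m n | w.pos < m + l} ∪ {handleConj G ⟨l, hl⟩})
  have hD : generated G {w : QVar m n | w.pos < m + l} ≤ Subgroup.closure
      (B ∪ {(var (.x ⟨l, hl⟩))⁻¹}) := fun γ hγ =>
    Subgroup.subset_closure (Or.inl (Subgroup.subset_closure (Or.inl hγ)))
  have hp : handleConj G ⟨l, hl⟩ ∈ Subgroup.closure
      ((B : Set (GX G m n)) ∪ {(var (.x ⟨l, hl⟩))⁻¹}) :=
    Subgroup.subset_closure (Or.inl (Subgroup.subset_closure (Or.inr rfl)))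
  have hx : (var (.x ⟨l, hl⟩) : GX G m n) ∈ Subgroup.closure
      ((B : Set (GX G m n)) ∪ {(var (.x ⟨l, hl⟩))⁻¹}) :=
    inv_mem_iff.1 (Subgroup.subset_closure (Or.inr rfl))
  refine generated_le (fun g => hD (const_mem_generated g _)) fun w hw => ?_
  have hw' : w.pos < m + l + 1 := hw
  by_cases h : w.pos < m + l
  · exact hD (var_mem_generated h)
  · rcases w with i | i | i <;> simp only [QVar.pos] at h hw'
    · obtain rfl : i = ⟨l, hl⟩ := Fin.ext (by simp only; omega)
      exact hx
    · obtain rfl : i = ⟨l, hl⟩ := Fin.ext (by simp only; omega)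
      have := mul_mem (mul_mem hx hp) (inv_mem hx)
      simpa [handleConj, mul_assoc] using this
    · omega

theorem stepVal_xx_handle (l : Fin (n - 1)) (u : H) (i : Fin n) (hi : l.1 < i.1)
    (h : ¬ Commute (v (.x i)) (v (.y i))) :
    ¬ Commute (stepVal v (.xx l) u (.x i)) (stepVal v (.xx l) u (.y i)) := by
  have hi' : i.1 ≠ l.1 := hi.ne'
  by_cases hi1 : i.1 = l.1 + 1
  · intro hc
    refine h (commute_of_commute_conj_inv_mul (w := u) ?_)
    simpa [stepVal, Move.act, hi1] using hc
  · simpa [stepVal, Move.act, hi', hi1, commute_of_of_iff] using h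

/-- The twists of handle `l` free `y ^ x`. Those of handle `l + 1` make the period independent of
all that precedes them, and the link then sends `x⁻¹` to `x⁻¹ t` while it fixes `y ^ x`. -/
theorem IsGood.twist_xx {l : ℕ} (h : IsGood E ι v (m + l)) (hl : l + 1 < n) {K' : Type u}
    [Group K'] {f : H →* K} {ι₁ : G →* K} {v₁ : QVar m n → K}
    (hf : IsTwist ⟨l, by omega⟩ ι v f ι₁ v₁) {f' : K →* K'} {ι₂ : G →* K'} {v₂ : QVar m n → K'}
    (hf' : IsTwist ⟨l + 1, hl⟩ ι₁ v₁ f' ι₂ v₂) {u : K'}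
    (hu : u = eval ι₂ v₂ (Move.period E (.xx ⟨l, by omega⟩))) :
    IsGood E (stepIncl ι₂ u) (stepVal v₂ (.xx ⟨l, by omega⟩) u) (m + l + 1) := by
  have hpos : ∀ w : QVar m n, w.pos < m + l + 1 → w.pos ≠ m + (l + 1) := fun w hw => by omega
  have hx₂ : f' (v₁ (.x ⟨l, by omega⟩)) = v₂ (.x ⟨l, by omega⟩) :=
    hf'.map_val _ (hpos _ (Nat.lt_succ_self _))
  have hy₂ : f' (v₁ (.y ⟨l, by omega⟩)) = v₂ (.y ⟨l, by omega⟩) :=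
    hf'.map_val _ (hpos _ (Nat.lt_succ_self _))
  have hfree : ∀ g, g ≠ 1 → ¬ Commute (f' g) u := by
    intro g hg hc
    refine hf'.free (v₁ (.y ⟨l, by omega⟩))⁻¹ g hg ?_
    have h1 := hc.inv_right
    rw [hu, Move.period, map_mul, map_inv, eval_var, eval_var, mul_inv_rev, inv_inv] at h1
    rwa [map_inv, hy₂]
  have hu1 : u ≠ 1 := fun hu1 => hfree (v₁ (.x ⟨l, by omega⟩))
    (fun h0 => hf.not_commute (by rw [h0]; exact Commute.one_left _))
    (by rw [hu1]; exact Commute.one_right _)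
  refine ⟨hf'.separated.step hu1, ?_, fun i hi => ?_, fun hj' => by omega, fun hj' => by omega,
    fun _ hj' => by omega⟩
  · have hD : generated G {w : QVar m n | w.pos < m + l} ≤
        generated G {w : QVar m n | w.pos ≠ m + l} := generated_mono fun w hw => ne_of_lt hw
    have hB : ∀ b ∈ Subgroup.closure ((generated G {w : QVar m n | w.pos < m + l} :
          Set (GX G m n)) ∪ {handleConj G ⟨l, by omega⟩}),
        eval (stepIncl ι₂ u) (stepVal v₂ (.xx ⟨l, by omega⟩) u) b = of (f' (eval ι₁ v₁ b)) := by
      intro b hb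
      have h1 : Subgroup.closure ((generated G {w : QVar m n | w.pos < m + l} :
          Set (GX G m n)) ∪ {handleConj G ⟨l, by omega⟩}) ≤ MonoidHom.eqLocus
          (eval (stepIncl ι₂ u) (stepVal v₂ (.xx ⟨l, by omega⟩) u))
          (of.comp (f'.comp (eval ι₁ v₁))) := by
        rw [Subgroup.closure_le]
        rintro x (hx | rfl)
        · have h2 : ∀ w ∈ {w : QVar m n | w.pos < m + l},
              w.pos < (Move.xx ⟨l, by omega⟩ : Move m n).lo ∨
                (Move.xx ⟨l, by omega⟩ : Move m n).hi < w.pos := fun w hw => by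
            left
            exact hw
          have h3 : f' (eval ι₁ v₁ x) = eval ι₂ v₂ x :=
            hf'.map_eval (generated_mono (fun w hw => hpos w (Nat.lt_succ_of_lt hw)) hx)
          show eval _ _ x = of (f' (eval ι₁ v₁ x))
          rw [eval_step_of_mem h2 hx, h3]
        · show eval _ _ _ = of (f' (eval ι₁ v₁ _))
          simp only [handleConj, map_mul, map_inv, eval_var, hx₂, hy₂]
          simp [stepVal, Move.act, mul_assoc]
      exact h1 hb
    refine (isFaithfulOn_closure_insert hfree (hf.faithful _ hD h.faithful) hB
      (p := (v₁ (.x ⟨l, by omega⟩))⁻¹) ?_).mono (generated_pos_lt_handle_succ_le (by omega))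
    rw [map_inv, eval_var, map_inv, hx₂]
    simp [stepVal, Move.act]
  · refine stepVal_xx_handle _ u i (by simp only; omega) ?_
    by_cases hi0 : i = ⟨l + 1, hl⟩
    · rw [hi0]
      exact hf'.not_commute
    · have h0 : i.1 ≠ l + 1 := fun h0 => hi0 (Fin.ext h0)
      have hpos₁ : m + i.1 ≠ m + l := by omega
      have hpos₂ : m + i.1 ≠ m + (l + 1) := by omega
      rw [← hf'.map_val _ (by exact hpos₂), ← hf'.map_val _ (by exact hpos₂),
        ← hf.map_val _ (by exact hpos₁), ← hf.map_val _ (by exact hpos₁)]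
      intro hc
      exact h.handle i (by omega) (hf.injective (hf'.injective (by simpa using hc.eq)))

end GX

/-! ### The last steps: only consequences of the equation are killed. -/

namespace QuadEq

variable {G : Type u} [Group G] {m n : ℕ} (E : QuadEq G m n)

/-- The product of the first `k` atoms. -/
def partialProd (k : ℕ) (hk : k ≤ m + n) : GX G m n :=
  (List.ofFn fun i : Fin k => E.atom ⟨i, i.2.trans_le hk⟩).prod

theorem partialProd_succ (k : ℕ) (hk : k + 1 ≤ m + n) :
    E.partialProd (k + 1) hk = E.partialProd k (Nat.le_of_succ_le hk) * E.atom ⟨k, hk⟩ := by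
  rw [partialProd, List.ofFn_succ', List.concat_eq_append, List.prod_append, List.prod_singleton]
  rfl

theorem word_eq_partialProd {k : ℕ} (hk : k = m + n) :
    E.word = E.partialProd k hk.le * GX.const E.d⁻¹ := by
  subst hk
  rfl

theorem partialProd_mem {k : ℕ} (hk : k ≤ m + n) :
    E.partialProd k hk ∈ GX.generated G {w : QVar m n | w.pos < k} := by
  refine Subgroup.list_prod_mem _ fun x hx => ?_
  obtain ⟨i, rfl⟩ := List.mem_ofFn.1 hx
  have h : {w : QVar m n | w.pos = i} ⊆ {w : QVar m n | w.pos < k} := fun w hw => by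
    have hw : w.pos = i := hw
    show w.pos < k
    omega
  exact GX.generated_mono h (E.atom_mem_generated ⟨i, i.2.trans_le hk⟩)

/-- What the product of the atoms after the first `k` ones is equal to modulo the equation. -/
def tail (k : ℕ) (hk : k ≤ m + n) : GX G m n := (E.partialProd k hk)⁻¹ * GX.const E.d

theorem tail_mem {k : ℕ} (hk : k ≤ m + n) :
    E.tail k hk ∈ GX.generated G {w : QVar m n | w.pos < k} :=
  mul_mem (inv_mem (E.partialProd_mem hk)) (GX.const_mem_generated _ _)

theorem tail_succ {k : ℕ} (hk : k < m) :
    E.tail (k + 1) (by omega) = (GX.var (.z ⟨k, hk⟩))⁻¹ * GX.const (E.c ⟨k, hk⟩)⁻¹ *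
      GX.var (.z ⟨k, hk⟩) * E.tail k (by omega) := by
  rw [tail, tail, partialProd_succ, E.atom_of_lt hk]
  simp [GX.const, mul_assoc]

theorem generated_pos_lt_le_ne {w : QVar m n} {k : ℕ} (hw : k ≤ w.pos) :
    GX.generated G {w : QVar m n | w.pos < k} ≤ GX.generated G {w' | w' ≠ w} :=
  GX.generated_mono fun w' (hw' : w'.pos < k) => by
    rintro rfl
    omega

theorem tail_ne_one (hc : ∀ i, E.c i ≠ 1) (hd : E.d ≠ 1) {k : ℕ} (hk : k ≤ m) :
    E.tail k (by omega) ≠ 1 := by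
  cases k with
  | zero =>
    intro h
    refine hd (GX.const_eq_one_iff (m := m) (n := n).1 ?_)
    simpa [tail, partialProd] using h
  | succ k =>
    rw [tail_succ E hk]
    exact GX.conj_var_mul_ne_one (GX.const_mem_generated _ _)
      (generated_pos_lt_le_ne le_rfl (E.tail_mem _))
      fun h => hc _ (inv_eq_one.1 (GX.const_eq_one_iff.1 h))

/-- The tail is `z⁻¹ c⁻¹ z` times the previous tail, with `z` new and both factors non-trivial, so
the computation of centralizers in `G[X]` applies. -/
theorem mem_zpowers_tail (hc : ∀ i, E.c i ≠ 1) (hd : E.d ≠ 1) {k : ℕ} (hk : k < m)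
    {γ : GX G m n} (h : Commute γ (E.tail (k + 1) (by omega))) :
    γ ∈ Subgroup.zpowers (E.tail (k + 1) (by omega)) := by
  rw [tail_succ E hk] at h ⊢
  exact GX.mem_zpowers_conj_mul_of_commute (GX.const_mem_generated _ _)
    (generated_pos_lt_le_ne le_rfl (E.tail_mem _))
    (fun h => hc _ (inv_eq_one.1 (GX.const_eq_one_iff.1 h))) (E.tail_ne_one hc hd hk.le) h

end QuadEq

namespace GX

open HNNExtension CentralizerExtension

variable {G : Type u} [Group G] {m n : ℕ} {H : Type u} [Group H] {ι : G →* H}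
  {v : QVar m n → H} {E : QuadEq G m n}

theorem normalClosure_word_le_ker {K : Type*} [Group K] {f : GX G m n →* K} (hf : f E.word = 1) :
    Subgroup.normalClosure {E.word} ≤ f.ker :=
  Subgroup.normalClosure_le_normal (by simpa using hf)

theorem mk_zpow_conj_inv_mem {Γ : Type*} [Group Γ] {N : Subgroup Γ} [N.Normal] {a b s : Γ}
    (h : a⁻¹ * (s * b * s⁻¹) ∈ N) (k : ℤ) : (a ^ k)⁻¹ * (s * b ^ k * s⁻¹) ∈ N := by
  rw [← QuotientGroup.eq] at h ⊢
  rw [← conj_zpow]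
  simpa using congrArg (· ^ k) h

/-- Modulo the equation, `Y` is a stable letter over `B`, which is generated by the older variables
and `X`, with `Y⁻¹ X Y = X w`. The first two twists make the values faithful on `B`; the third one
sends `Y` to `t Y`. A pinch comes from an element of `B` commuting with `X` or with `X w`, hence
from a power of it, and the relation rewrites the conjugate of this power by `Y` inside `B`. -/
theorem IsGood.mem_of_twist {l : ℕ} (h : IsGood E ι v (m + l)) (hl : l + 1 = n)
    (hw : eval ι v E.word = 1) {u₁ : H}
    (h₁ : u₁ = eval ι v (Move.period E (.twistY ⟨l, by omega⟩))) {u₂ : CentralizerExtension H u₁}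
    (h₂ : u₂ = eval (stepIncl ι u₁) (stepVal v (.twistY ⟨l, by omega⟩) u₁)
      (Move.period E (.twistX ⟨l, by omega⟩))) {u₃ : CentralizerExtension _ u₂}
    (h₃ : u₃ = eval (stepIncl (stepIncl ι u₁) u₂)
      (stepVal (stepVal v (.twistY ⟨l, by omega⟩) u₁) (.twistX ⟨l, by omega⟩) u₂)
      (Move.period E (.twistY ⟨l, by omega⟩))) {γ : GX G m n}
    (hγ : eval (stepIncl (stepIncl (stepIncl ι u₁) u₂) u₃)
      (stepVal (stepVal (stepVal v (.twistY ⟨l, by omega⟩) u₁) (.twistX ⟨l, by omega⟩) u₂)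
        (.twistY ⟨l, by omega⟩) u₃) γ = 1) : γ ∈ Subgroup.normalClosure {E.word} := by
  have hln : l < n := by omega
  have hxy := h.handle ⟨l, hln⟩ le_rfl
  set ι₁ := stepIncl ι u₁ with hι₁
  set v₁ := stepVal v (.twistY ⟨l, hln⟩) u₁ with hv₁
  set ι₂ := stepIncl ι₁ u₂ with hι₂
  set v₂ := stepVal v₁ (.twistX ⟨l, hln⟩) u₂ with hv₂
  have hw₁ : eval ι₁ v₁ E.word = 1 := by
    have := eval_step_word (ι := ι) (v := v) E (.twistY ⟨l, hln⟩)
    rw [← h₁, hw, map_one] at this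
    exact this
  have hw₂ : eval ι₂ v₂ E.word = 1 := by
    have := eval_step_word (ι := ι₁) (v := v₁) E (.twistX ⟨l, hln⟩)
    rw [← h₂, hw₁, map_one] at this
    exact this
  have hw₃ : eval (stepIncl ι₂ u₃) (stepVal v₂ (.twistY ⟨l, hln⟩) u₃) E.word = 1 := by
    have := eval_step_word (ι := ι₂) (v := v₂) E (.twistY ⟨l, hln⟩)
    rw [← h₃, hw₂, map_one] at this
    exact this
  replace h₁ : u₁ = v (.x ⟨l, hln⟩) := h₁.trans (eval_var _ _ _)
  replace h₂ : u₂ = v₁ (.y ⟨l, hln⟩) := h₂.trans (eval_var _ _ _)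
  replace h₃ : u₃ = v₂ (.x ⟨l, hln⟩) := h₃.trans (eval_var _ _ _)
  have hx₁ : v₁ (.x ⟨l, hln⟩) = of (v (.x ⟨l, hln⟩)) := by simp [hv₁, stepVal, Move.act]
  have hy₁ : v₁ (.y ⟨l, hln⟩) = t * of (v (.y ⟨l, hln⟩)) := by simp [hv₁, stepVal, Move.act]
  have hx₂ : v₂ (.x ⟨l, hln⟩) = t * of (v₁ (.x ⟨l, hln⟩)) := by simp [hv₂, stepVal, Move.act]
  set D : Subgroup (GX G m n) := generated G {w : QVar m n | w.pos < m + l} with hD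
  have houtY : ∀ w ∈ {w : QVar m n | w.pos < m + l},
      w.pos < (Move.twistY ⟨l, hln⟩ : Move m n).lo ∨
        (Move.twistY ⟨l, hln⟩ : Move m n).hi < w.pos := fun w hw => by
    left
    exact hw
  have houtX : ∀ w ∈ {w : QVar m n | w.pos < m + l},
      w.pos < (Move.twistX ⟨l, hln⟩ : Move m n).lo ∨
        (Move.twistX ⟨l, hln⟩ : Move m n).hi < w.pos := fun w hw => by
    left
    exact hw
  have hD₂ : ∀ b ∈ D, eval ι₂ v₂ b = of ((of.comp (eval ι v)) b) := fun b hb => by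
    rw [hι₂, hv₂, eval_step_of_mem houtX hb, hι₁, hv₁, eval_step_of_mem houtY hb]
    rfl
  have hfree : ∀ g, Commute (of g) u₂ → g = 1 := fun g hg => by
    by_contra hg1
    rw [h₂, hy₁] at hg
    subst h₁
    exact not_commute_of_t_mul h.separated.1 hxy hg1 hg
  set X : GX G m n := var (.x ⟨l, hln⟩) with hX
  set Y : GX G m n := var (.y ⟨l, hln⟩) with hY
  set B : Subgroup (GX G m n) := Subgroup.closure (D ∪ {X}) with hB
  have hDB : D ≤ B := fun b hb => Subgroup.subset_closure (Or.inl hb)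
  have hXB : X ∈ B := Subgroup.subset_closure (Or.inr rfl)
  have hfaith : IsFaithfulOn (eval ι₂ v₂) B := by
    refine eq_one_of_mem_closure_insert _ _ D X 1 (v₁ (.x ⟨l, hln⟩)) hD₂ ?_ ?_ ?_ ?_
    · rw [hX, eval_var, hx₂, map_one, one_mul]
    · intro b hb hb1
      exact h.faithful b hb (of_eq_one_iff.1 hb1)
    · intro b hb hc
      rw [hx₁, MonoidHom.comp_apply, ← map_inv, ← map_mul, ← map_mul] at hc
      have := hfree _ hc
      rw [mul_inv_eq_one, mul_eq_left] at this
      rw [MonoidHom.comp_apply, this, map_one]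
    · intro b hb hc
      rw [inv_one, one_mul, mul_one, MonoidHom.comp_apply] at hc
      rw [MonoidHom.comp_apply, hfree _ hc, map_one]
  set N := Subgroup.normalClosure {E.word} with hN
  set w : GX G m n := E.tail (m + l) (by omega) with hw'
  have hwD : w ∈ D := E.tail_mem _
  have hXw : X * w ∈ B := mul_mem hXB (hDB hwD)
  have hrel : X⁻¹ * (Y * (X * w) * Y⁻¹) ∈ N := by
    have h4 : E.word ∈ N := Subgroup.subset_normalClosure rfl
    rw [E.word_eq_partialProd (k := m + l + 1) (by omega), QuadEq.partialProd_succ,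
      E.atom_add hln] at h4
    rw [← QuotientGroup.eq_one_iff] at h4 ⊢
    simp only [hw', QuadEq.tail, const, map_inv, QuotientGroup.mk_mul, QuotientGroup.mk_inv] at h4 ⊢
    rw [mul_inv_eq_one, ← eq_inv_mul_iff_mul_eq] at h4
    rw [← h4]
    simp [hX, hY, mul_assoc]
  have hrel' : (X * w)⁻¹ * (Y⁻¹ * X * Y) ∈ N := by
    rw [← QuotientGroup.eq] at hrel ⊢
    simp only [QuotientGroup.mk_mul, QuotientGroup.mk_inv] at hrel ⊢
    simpa [mul_assoc] using (congrArg (fun z => (Y⁻¹ : GX G m n ⧸ N) * z * Y) hrel).symm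
  have hφN : N ≤ (eval ι₂ v₂).ker := normalClosure_word_le_ker hw₂
  -- The relation already holds before the last twist; it converts a pinch on the right of `Y` into
  -- commutation with `X * w`, an element of `B`, where values are faithful.
  have hφrel : (eval ι₂ v₂ Y)⁻¹ * v₂ (.x ⟨l, hln⟩) * eval ι₂ v₂ Y = eval ι₂ v₂ (X * w) := by
    have h5 := hφN hrel'
    have h6 : eval ι₂ v₂ X = v₂ (.x ⟨l, hln⟩) := eval_var _ _ _
    rw [MonoidHom.mem_ker, map_mul, map_inv, inv_mul_eq_one] at h5
    rw [h5, map_mul, map_mul, map_inv, h6]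
  have hXne : ∀ b ∈ D, b ∈ generated G {w' | w' ≠ .x ⟨l, hln⟩} := fun b hb =>
    QuadEq.generated_pos_lt_le_ne (w := .x ⟨l, hln⟩) le_rfl hb
  refine mem_of_mem_closure_of_map_eq_one (J := Unit) N _ (eval ι₂ v₂)
    (normalClosure_word_le_ker hw₃) hφN B (fun _ => Y) (fun _ => 1) (fun _ => eval ι₂ v₂ Y)
    ?_ ?_ (fun b hb hb1 => by rw [hfaith b hb hb1]; exact one_mem _) ?_ ?_ γ ?_ hγ
  · intro b hb
    have h6 : B ≤ MonoidHom.eqLocus (eval (stepIncl ι₂ u₃) (stepVal v₂ (.twistY ⟨l, hln⟩) u₃))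
        (of.comp (eval ι₂ v₂)) := by
      rw [hB, Subgroup.closure_le]
      rintro x (hx | rfl)
      · exact eval_step_of_mem houtY hx
      · show eval _ _ X = of (eval ι₂ v₂ X)
        rw [hX, eval_var, eval_var]
        simp [stepVal, Move.act]
    exact h6 hb
  · intro _
    rw [hY, eval_var, eval_var]
    simp [stepVal, Move.act]
  · intro _ _ b hb hc
    have hc' : Commute (eval ι₂ v₂ b) (eval ι₂ v₂ (X * w)) := by
      rw [← hφrel]
      rw [h₃] at hc
      have := congrArg (fun z => (eval ι₂ v₂ Y)⁻¹ * z * eval ι₂ v₂ Y) hc.eq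
      rw [Commute, SemiconjBy]
      simpa [mul_assoc] using this
    obtain ⟨k, rfl⟩ := mem_zpowers_var_mul_of_commute (hXne w hwD) (hfaith.commute hb hXw hc')
    exact ⟨X ^ k, zpow_mem hXB k, mk_zpow_conj_inv_mem hrel k⟩
  · intro _ _ b hb hc
    rw [inv_one, one_mul, mul_one, h₃, ← eval_var ι₂ v₂] at hc
    obtain ⟨k, rfl⟩ := mem_zpowers_var_of_commute (hfaith.commute hb hXB hc)
    have h6 : (X * w)⁻¹ * (Y⁻¹ * X * Y⁻¹⁻¹) ∈ N := by rwa [inv_inv]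
    have h7 := mk_zpow_conj_inv_mem h6 k
    rw [inv_inv] at h7
    exact ⟨(X * w) ^ k, zpow_mem hXw k, h7⟩
  · have h7 : (⊤ : Subgroup (GX G m n)) ≤
        Subgroup.closure ((B : Set (GX G m n)) ∪ Set.range fun _ : Unit => Y) := by
      have hBc : B ≤ Subgroup.closure ((B : Set (GX G m n)) ∪ Set.range fun _ : Unit => Y) :=
        fun b hb => Subgroup.subset_closure (Or.inl hb)
      rw [← generated_univ]
      refine generated_le (fun g => hBc (hDB (const_mem_generated g _))) fun w _ => ?_
      by_cases hlt : w.pos < m + l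
      · exact hBc (hDB (var_mem_generated hlt))
      · rcases w with i | i | i <;> simp only [QVar.pos] at hlt
        · obtain rfl : i = ⟨l, hln⟩ := Fin.ext (by simp only; omega)
          exact hBc hXB
        · obtain rfl : i = ⟨l, hln⟩ := Fin.ext (by simp only; omega)
          exact Subgroup.subset_closure (Or.inr ⟨(), rfl⟩)
        · omega
    exact h7 (Subgroup.mem_top γ)

end GX

namespace CentralizerExtension

open HNNExtension

variable {H : Type u} [Group H] {w : H}

/-- Conjugation by `t` and passage to the inverse turn this into `not_commute_of_mul_conj` with the
opposite sign. -/
theorem not_commute_conj_of_mul_conj (hH : IsFullyResiduallyFree H) {a b g : H}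
    (ha : ¬ Commute a w) (hg : g ≠ 1) :
    ¬ Commute (t⁻¹ * of g * t : CentralizerExtension H w) (of a * (t⁻¹ * of b * t)) := by
  intro hc
  refine not_commute_of_mul_conj (a := b⁻¹) hH (-1) (b := a⁻¹) (w := w)
    (fun h => ha (by simpa using h.inv_left)) hg ?_
  have h1 := congrArg (fun z => (t : CentralizerExtension H w) * z * t⁻¹) hc.inv_right.eq
  rw [Commute, SemiconjBy]
  simpa [mul_assoc] using h1

end CentralizerExtension

namespace GX

open HNNExtension CentralizerExtension

variable {G : Type u} [Group G] {m n : ℕ} {H : Type u} [Group H] {ι : G →* H}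
  {v : QVar m n → H} {E : QuadEq G m n}

/-- The variable `z_i` and the quotient `z_{i+1} z_{i+2}⁻¹`. -/
def lastLetters (G : Type u) [Group G] {m n i : ℕ} (hi : i + 3 = m) : Bool → GX G m n
  | false => var (.z ⟨i, by omega⟩)
  | true => var (.z ⟨i + 1, by omega⟩) * (var (.z ⟨i + 2, by omega⟩))⁻¹

/-- The two letters are sent to `z_i t'` and `z_{i+1} t t' (z_{i+2} t)⁻¹`. Equal letters lead to
pinches by elements `g` or `t⁻¹ g t` of the previous group, different letters to `g t` or `t⁻¹ g`.
None of these commutes with the period `a (t⁻¹ b t)` unless it is trivial; it is here that `a` must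
not commute with `u`, which is the invariant `zzz`. -/
theorem IsGood.isFaithfulOn_lastLetters {i : ℕ} (h : IsGood E ι v i) (hi : i + 3 = m)
    (hn : n = 0) {u : H} (hu : u = eval ι v (Move.period E (.zz ⟨i + 1, by omega⟩)))
    {u' : CentralizerExtension H u}
    (hu' : u' = eval (stepIncl ι u) (stepVal v (.zz ⟨i + 1, by omega⟩) u)
      (Move.period E (.zz ⟨i, by omega⟩))) :
    IsFaithfulOn (eval (stepIncl (stepIncl ι u) u')
      (stepVal (stepVal v (.zz ⟨i + 1, by omega⟩) u) (.zz ⟨i, by omega⟩) u'))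
      (Subgroup.closure (generated G {w : QVar m n | w.pos < i} ∪
        Set.range (lastLetters G hi))) := by
  rw [Move.period, map_mul] at hu
  have hau : ¬ Commute (eval ι v (E.atom ⟨i, by omega⟩)) u := by
    rw [hu]
    exact h.zzz hn hi
  have hbu : ¬ Commute (eval ι v (E.atom ⟨i + 1, by omega⟩)) u := by
    rw [hu, commute_mul_left_self_iff]
    exact h.zz (by omega)
  have hz1 : stepVal v (.zz ⟨i + 1, by omega⟩) u (.z ⟨i + 1, by omega⟩) =
      of (v (.z ⟨i + 1, by omega⟩)) * t := stepVal_zz_left _ _ _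
  have hz2 : stepVal v (.zz ⟨i + 1, by omega⟩) u (.z ⟨i + 2, by omega⟩) =
      of (v (.z ⟨i + 2, by omega⟩)) * t := stepVal_zz_right _ _ _
  obtain ⟨h1, h2, -, -⟩ := h.step_step (by omega) (by simp [Move.lo]) hz1 hbu hu'
  have hz0 : stepVal v (.zz ⟨i + 1, by omega⟩) u (.z ⟨i, by omega⟩) =
      of (v (.z ⟨i, by omega⟩)) := stepVal_of_outside (Or.inl (Nat.lt_succ_self _))
  have hA : ∀ g, Commute (of g) u' → g = 1 := fun g hg => by
    by_contra hg1
    exact h2 g hg1 hg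
  have hT : ∀ g, Commute (t⁻¹ * of g * t) u' → g = 1 := fun g hg => by
    by_contra hg1
    rw [h1] at hg
    exact not_commute_conj_of_mul_conj h.separated.1 hau hg1 hg
  have hO : ∀ g, ¬ Commute (of g * t) u' := fun g hg => by
    rw [h1] at hg
    exact not_commute_of_mul_t hau hbu hg
  have hO' : ∀ g, ¬ Commute (t⁻¹ * of g) u' := fun g hg => by
    refine hO g⁻¹ ?_
    simpa using hg.inv_left
  have hout₁ : ∀ w ∈ {w : QVar m n | w.pos < i},
      w.pos < (Move.zz ⟨i + 1, by omega⟩ : Move m n).lo ∨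
        (Move.zz ⟨i + 1, by omega⟩ : Move m n).hi < w.pos := fun w hw => by
    left
    exact Nat.lt_succ_of_lt hw
  have hout₂ : ∀ w ∈ {w : QVar m n | w.pos < i},
      w.pos < (Move.zz ⟨i, by omega⟩ : Move m n).lo ∨
        (Move.zz ⟨i, by omega⟩ : Move m n).hi < w.pos := fun w hw => by
    left
    exact hw
  have hB : ∀ b ∈ generated G {w : QVar m n | w.pos < i},
      eval (stepIncl (stepIncl ι u) u')
        (stepVal (stepVal v (.zz ⟨i + 1, by omega⟩) u) (.zz ⟨i, by omega⟩) u') b =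
        of ((of.comp (eval ι v)) b) := fun b hb => by
    rw [eval_step_of_mem hout₂ hb, eval_step_of_mem hout₁ hb]
    rfl
  let p : Bool → CentralizerExtension H u
    | false => of (v (.z ⟨i, by omega⟩))
    | true => of (v (.z ⟨i + 1, by omega⟩)) * t
  let q : Bool → CentralizerExtension H u
    | false => 1
    | true => (of (v (.z ⟨i + 2, by omega⟩)) * t)⁻¹
  refine eq_one_of_mem_closure_of_map_eq_one _ (of.comp (eval ι v)) _ _ p q hB ?_ ?_ ?_ ?_
  · rintro (_ | _)
    · rw [lastLetters, eval_var, stepVal_zz_left, hz0]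
      simp [p, q]
    · have hz2' : stepVal (stepVal v (.zz ⟨i + 1, by omega⟩) u) (.zz ⟨i, by omega⟩) u'
          (.z ⟨i + 2, by omega⟩) = of (of (v (.z ⟨i + 2, by omega⟩)) * t) := by
        rw [stepVal_of_outside (u := u'), hz2]
        right
        exact Nat.lt_succ_self _
      rw [lastLetters, map_mul, map_inv, eval_var, eval_var, stepVal_zz_right, hz1, hz2', ← map_inv]
  · intro b hb hb1
    exact h.faithful b hb (of_eq_one_iff.1 hb1)
  · rintro (_ | _) (_ | _) b hb hc
    · have : eval ι v b = 1 := hA _ (by simpa [q] using hc)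
      simp [h.faithful b hb this]
    · refine absurd ?_ (hO (eval ι v b * v (.z ⟨i + 2, by omega⟩)))
      simpa [q, mul_assoc] using hc
    · refine absurd ?_ (hO' ((v (.z ⟨i + 2, by omega⟩))⁻¹ * eval ι v b))
      simpa [q, mul_assoc] using hc
    · have := hT ((v (.z ⟨i + 2, by omega⟩))⁻¹ * eval ι v b * v (.z ⟨i + 2, by omega⟩))
        (by simpa [q, mul_assoc] using hc)
      simp [h.faithful b hb (by simpa [mul_assoc, inv_mul_eq_one] using this)]
  · rintro (_ | _) (_ | _) b hb hc
    · have := hA ((v (.z ⟨i, by omega⟩))⁻¹ * eval ι v b * v (.z ⟨i, by omega⟩))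
        (by simpa [p, mul_assoc] using hc)
      simp [h.faithful b hb (by simpa [mul_assoc, inv_mul_eq_one] using this)]
    · refine absurd ?_ (hO ((v (.z ⟨i, by omega⟩))⁻¹ * eval ι v b * v (.z ⟨i + 1, by omega⟩)))
      simpa [p, mul_assoc] using hc
    · refine absurd ?_ (hO' ((v (.z ⟨i + 1, by omega⟩))⁻¹ * eval ι v b * v (.z ⟨i, by omega⟩)))
      simpa [p, mul_assoc] using hc
    · have := hT ((v (.z ⟨i + 1, by omega⟩))⁻¹ * eval ι v b * v (.z ⟨i + 1, by omega⟩))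
        (by simpa [p, mul_assoc] using hc)
      simp [h.faithful b hb (by simpa [mul_assoc, inv_mul_eq_one] using this)]

/-- Both `z_{i+1}` and `z_{i+2}` are multiplied by `t` on the right, so their quotient `q` is fixed
and `z = z_{i+2}` is the only variable that moves. With `Q = q⁻¹ c_{i+1} q c_{i+2}`, the equation
says `z⁻¹ Q z = g` with `Q` and `g` in `B`, so `z` is a stable letter; both elements have cyclic
centralizers. -/
theorem ne_one_and_mem_of_isFaithfulOn_lastLetters {i : ℕ} (hi : i + 3 = m) (hn : n = 0)
    (hc : ∀ i, E.c i ≠ 1) (hd : E.d ≠ 1)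
    (h : IsFaithfulOn (eval ι v) (Subgroup.closure (generated G {w : QVar m n | w.pos < i} ∪
        Set.range (lastLetters G hi)))) (hw : eval ι v E.word = 1) {u : H}
    (hu : u = eval ι v (Move.period E (.zz ⟨i + 1, by omega⟩))) :
    u ≠ 1 ∧ ∀ γ, eval (stepIncl ι u) (stepVal v (.zz ⟨i + 1, by omega⟩) u) γ = 1 →
      γ ∈ Subgroup.normalClosure {E.word} := by
  have him : i < m := by omega
  set B : Subgroup (GX G m n) := Subgroup.closure (generated G {w : QVar m n | w.pos < i} ∪
        Set.range (lastLetters G hi)) with hB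
  set N := Subgroup.normalClosure {E.word} with hN
  have hφN : N ≤ (eval ι v).ker := normalClosure_word_le_ker hw
  have hw' : eval (stepIncl ι u) (stepVal v (.zz ⟨i + 1, by omega⟩) u) E.word = 1 := by
    have := eval_step_word (ι := ι) (v := v) E (.zz ⟨i + 1, by omega⟩)
    rw [← hu, hw, map_one] at this
    exact this
  have hDB : generated G {w : QVar m n | w.pos < i} ≤ B :=
    fun b hb => Subgroup.subset_closure (Or.inl hb)
  have hletter : ∀ j, lastLetters G hi j ∈ B := fun j => Subgroup.subset_closure (Or.inr ⟨j, rfl⟩)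
  have hz : (var (.z ⟨i, by omega⟩) : GX G m n) ∈ B := hletter false
  set q : GX G m n := var (.z ⟨i + 1, by omega⟩) * (var (.z ⟨i + 2, by omega⟩))⁻¹ with hq
  have hqB : q ∈ B := hletter true
  set g : GX G m n := E.tail (i + 1) (by omega) with hg
  have hgB : g ∈ B := by
    rw [hg, E.tail_succ (by omega)]
    exact mul_mem (mul_mem (mul_mem (inv_mem hz) (hDB (const_mem_generated _ _))) hz)
      (hDB (E.tail_mem _))
  set Q : GX G m n := q⁻¹ * const (E.c ⟨i + 1, by omega⟩) * q * const (E.c ⟨i + 2, by omega⟩)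
    with hQ
  have hQB : Q ∈ B := mul_mem (mul_mem (mul_mem (inv_mem hqB) (hDB (const_mem_generated _ _))) hqB)
    (hDB (const_mem_generated _ _))
  set z : GX G m n := var (.z ⟨i + 2, by omega⟩) with hz2
  have hper : Move.period E (.zz ⟨i + 1, by omega⟩) = z⁻¹ * Q * z := by
    have h1 : Move.period E (.zz ⟨i + 1, by omega⟩) =
      E.atom ⟨i + 1, by omega⟩ * E.atom ⟨i + 2, by omega⟩ := rfl
    rw [h1, E.atom_of_lt (by omega), E.atom_of_lt (by omega), hQ, hq]
    simp [hz2, mul_assoc]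
  have hrel : g⁻¹ * (z⁻¹ * Q * z) ∈ N := by
    have h4 : E.word ∈ N := Subgroup.subset_normalClosure rfl
    have h5 : z⁻¹ * Q * z = E.atom ⟨i + 1, by omega⟩ * E.atom ⟨i + 2, by omega⟩ := hper.symm
    rw [E.word_eq_partialProd (k := i + 1 + 1 + 1) (by omega), QuadEq.partialProd_succ,
      QuadEq.partialProd_succ] at h4
    rw [h5, hg, QuadEq.tail]
    rw [← QuotientGroup.eq_one_iff] at h4 ⊢
    simp only [const, map_inv, QuotientGroup.mk_mul, QuotientGroup.mk_inv] at h4 ⊢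
    rw [mul_inv_eq_one] at h4
    rw [← h4]
    simp [mul_assoc]
  have hrel' : Q⁻¹ * (z * g * z⁻¹) ∈ N := by
    rw [← QuotientGroup.eq] at hrel ⊢
    simp only [QuotientGroup.mk_mul, QuotientGroup.mk_inv] at hrel ⊢
    simp [hrel, mul_assoc]
  have hu1 : u = (eval ι v z)⁻¹ * eval ι v Q * eval ι v z := by
    rw [hu, hper, map_mul, map_mul, map_inv]
  have hu2 : u = eval ι v g := by
    have h5 := hφN hrel
    rw [MonoidHom.mem_ker, map_mul, map_inv, inv_mul_eq_one] at h5
    rw [h5, hu, hper]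
  refine ⟨fun hu0 => E.tail_ne_one hc hd him (h g hgB (hu2.symm.trans hu0)), fun γ hγ => ?_⟩
  have hzv : eval ι v z = v (.z ⟨i + 2, by omega⟩) := eval_var _ _ _
  refine mem_of_mem_closure_of_map_eq_one (J := Unit) N _ (eval ι v)
    (normalClosure_word_le_ker hw') hφN B (fun _ => z) (fun _ => eval ι v z) (fun _ => 1)
    ?_ ?_ (fun b hb hb1 => by rw [h b hb hb1]; exact one_mem _) ?_ ?_ γ ?_ hγ
  · intro b hb
    have h6 : B ≤ MonoidHom.eqLocus
        (eval (stepIncl ι u) (stepVal v (.zz ⟨i + 1, by omega⟩) u)) (of.comp (eval ι v)) := by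
      rw [hB, Subgroup.closure_le]
      rintro x (hx | ⟨j, rfl⟩)
      · have hout : ∀ w ∈ {w : QVar m n | w.pos < i},
            w.pos < (Move.zz ⟨i + 1, by omega⟩ : Move m n).lo ∨
              (Move.zz ⟨i + 1, by omega⟩ : Move m n).hi < w.pos := fun w hw => by
          left
          exact Nat.lt_succ_of_lt hw
        exact eval_step_of_mem hout hx
      · show eval _ _ _ = of (eval ι v _)
        cases j with
        | false =>
          rw [lastLetters, eval_var, eval_var]
          exact stepVal_of_outside (Or.inl (Nat.lt_succ_self _))
        | true =>
          rw [lastLetters, map_mul, map_mul, map_inv, map_inv, eval_var, eval_var, eval_var,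
            eval_var, stepVal_zz_left, stepVal_zz_right]
          simp
    exact h6 hb
  · intro _
    rw [hzv, hz2, eval_var, stepVal_zz_right, map_one, mul_one]
  · intro _ _ b hb hcomm
    rw [one_mul, inv_one, mul_one, hu2] at hcomm
    obtain ⟨k, rfl⟩ := E.mem_zpowers_tail hc hd him (h.commute hb hgB hcomm)
    exact ⟨Q ^ k, zpow_mem hQB k, mk_zpow_conj_inv_mem hrel' k⟩
  · intro _ _ b hb hcomm
    have hcomm' : Commute (eval ι v b) (eval ι v Q) := by
      rw [hu1] at hcomm
      have := congrArg (fun x => eval ι v z * x * (eval ι v z)⁻¹) hcomm.eq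
      rw [Commute, SemiconjBy]
      simpa [mul_assoc] using this
    -- The centralizer of `Q` is computed with `z_{i+1}` as the free letter, `q` being `z_{i+1}`
    -- times a word without it.
    have hzne : z⁻¹ ∈ generated G {w : QVar m n | w ≠ .z ⟨i + 1, by omega⟩} :=
      inv_mem (var_mem_generated (by simp))
    obtain ⟨k, rfl⟩ := mem_zpowers_conj_var_mul_of_commute hzne (const_mem_generated _ _)
      (const_mem_generated _ _) (fun h => hc _ (const_eq_one_iff.1 h))
      (fun h => hc _ (const_eq_one_iff.1 h)) (h.commute hb hQB hcomm')
    have h6 : g⁻¹ * (z⁻¹ * Q * z⁻¹⁻¹) ∈ N := by rwa [inv_inv]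
    have h7 := mk_zpow_conj_inv_mem h6 k
    rw [inv_inv] at h7
    exact ⟨g ^ k, zpow_mem hgB k, h7⟩
  · have h7 : (⊤ : Subgroup (GX G m n)) ≤
        Subgroup.closure ((B : Set (GX G m n)) ∪ Set.range fun _ : Unit => z) := by
      have hBc : B ≤ Subgroup.closure ((B : Set (GX G m n)) ∪ Set.range fun _ : Unit => z) :=
        fun b hb => Subgroup.subset_closure (Or.inl hb)
      have hzc : z ∈ Subgroup.closure ((B : Set (GX G m n)) ∪ Set.range fun _ : Unit => z) :=
        Subgroup.subset_closure (Or.inr ⟨(), rfl⟩)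
      rw [← generated_univ]
      refine generated_le (fun g => hBc (hDB (const_mem_generated g _))) fun w _ => ?_
      by_cases hlt : w.pos < i
      · exact hBc (hDB (var_mem_generated hlt))
      · rcases w with j | j | ⟨j, hj⟩ <;> simp only [QVar.pos] at hlt
        · omega
        · omega
        · obtain rfl | rfl | rfl : j = i ∨ j = i + 1 ∨ j = i + 2 := by omega
          · exact hBc hz
          · have := mul_mem (hBc hqB) hzc
            simpa [hq, hz2] using this
          · exact hzc
    exact h7 (Subgroup.mem_top γ)

end GX

/-! ### Regrouping the two rounds into blocks. -/

namespace Move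

variable {m n : ℕ}

/-- The three twists of the handle that is the atom of index `j`, if there is one. -/
def handleTwists (m n j : ℕ) : List (Move m n) :=
  if h : m ≤ j ∧ j < m + n then
    [twistY ⟨j - m, by omega⟩, twistX ⟨j - m, by omega⟩, twistY ⟨j - m, by omega⟩]
  else []

/-- The step that links the atoms of index `j` and `j + 1`, if there is one. -/
def links (m n j : ℕ) : List (Move m n) :=
  if h : j + 1 < m then [zz ⟨j, by omega⟩]
  else if h : j + 1 = m ∧ 0 < n then [zx (by omega) h.2]
  else if h : m ≤ j ∧ j + 1 < m + n then [xx ⟨j - m, by omega⟩]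
  else []

/-- The links of the first round that are kept. -/
def firstLinks (m n j : ℕ) : List (Move m n) :=
  if j < m ∧ 2 ≤ m then links m n j else []

/-- The steps from one point of the construction to the next one. -/
def block (m n j : ℕ) : List (Move m n) :=
  handleTwists m n j ++ firstLinks m n (j + 1) ++ handleTwists m n (j + 1) ++ links m n j

theorem handleTwists_of_lt {j : ℕ} (h : j < m) : handleTwists m n j = [] :=
  dif_neg (by omega)

theorem handleTwists_add (i : Fin n) :
    handleTwists m n (m + i) = [twistY i, twistX i, twistY i] := by
  have h : (⟨m + i - m, by omega⟩ : Fin n) = i := Fin.ext (by simp only; omega)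
  rw [handleTwists, dif_pos (by omega), h]

theorem links_of_lt {j : ℕ} (h : j + 1 < m) : links m n j = [zz ⟨j, by omega⟩] := dif_pos h

theorem links_of_eq {j : ℕ} (h : j + 1 = m) (hm : 0 < m) (hn : 0 < n) :
    links m n j = [zx hm hn] := by
  rw [links, dif_neg (by omega), dif_pos ⟨h, hn⟩]

theorem links_add (i : ℕ) (hi : i < n - 1) : links m n (m + i) = [xx ⟨i, hi⟩] := by
  have h : ∀ h, (⟨m + i - m, h⟩ : Fin (n - 1)) = ⟨i, hi⟩ := fun h => Fin.ext (by simp only; omega)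
  rw [links, dif_neg (by omega), dif_neg (by omega), dif_pos (by omega), h]

theorem links_eq_nil {j : ℕ} (h : m + n ≤ j + 1) : links m n j = [] := by
  rw [links, dif_neg (by omega), dif_neg (by omega), dif_neg (by omega)]

theorem lo_hi_of_mem_handleTwists {j : ℕ} {k : Move m n} (hk : k ∈ handleTwists m n j) :
    k.lo = j ∧ k.hi = j := by
  rw [handleTwists] at hk
  split at hk
  · simp only [List.mem_cons, List.not_mem_nil, or_false] at hk
    rcases hk with rfl | rfl | rfl <;> simp only [lo, hi] <;> omega
  · simp at hk

theorem lo_hi_of_mem_links {j : ℕ} {k : Move m n} (hk : k ∈ links m n j) :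
    k.lo = j ∧ k.hi = j + 1 := by
  rw [links] at hk
  split at hk
  · obtain rfl := List.mem_singleton.1 hk
    exact ⟨rfl, rfl⟩
  · split at hk
    · obtain rfl := List.mem_singleton.1 hk
      simp only [lo, hi]
      omega
    · split at hk
      · obtain rfl := List.mem_singleton.1 hk
        simp only [lo, hi]
        omega
      · simp at hk

theorem mem_links_of_mem_firstLinks {j : ℕ} {k : Move m n} (hk : k ∈ firstLinks m n j) :
    k ∈ links m n j := by
  rw [firstLinks] at hk
  split at hk
  · exact hk
  · simp at hk

theorem round_eq (m n : ℕ) :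
    round m n = (List.range (m + n)).flatMap fun j => handleTwists m n j ++ links m n j := by
  rw [List.range_add, List.flatMap_append, round]
  congr 1
  · cases m with
    | zero => simp
    | succ k =>
      rw [List.range_succ, List.flatMap_append, List.flatMap_singleton,
        handleTwists_of_lt (Nat.lt_succ_self k), List.nil_append]
      congr 1
      · rw [← List.map_coe_finRange_eq_range, List.flatMap_map, List.map_eq_flatMap]
        refine List.flatMap_congr fun i _ => ?_
        have hi : i.1 < k := i.2
        rw [handleTwists_of_lt (by omega), links_of_lt (by omega), List.nil_append]
      · by_cases hn : 0 < n
        · rw [dif_pos ⟨Nat.succ_pos k, hn⟩, links_of_eq rfl (Nat.succ_pos k) hn]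
        · rw [dif_neg (by omega), links_eq_nil (by omega)]
  · rw [← List.map_coe_finRange_eq_range, List.flatMap_map, List.flatMap_map]
    refine List.flatMap_congr fun i _ => ?_
    rw [handleTwists_add]
    congr 1
    by_cases hi : i.1 < n - 1
    · rw [dif_pos hi, links_add]
    · rw [dif_neg hi, links_eq_nil (by omega)]

theorem flatMap_append_succ {α : Type*} (a b : ℕ → List α) (k : ℕ) :
    (List.range (k + 1)).flatMap (fun j => a j ++ b j) =
      a 0 ++ (List.range k).flatMap (fun j => b j ++ a (j + 1)) ++ b k := by
  induction k with
  | zero => simp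
  | succ k ih =>
    rw [List.range_succ, List.flatMap_append, ih, List.range_succ, List.flatMap_append]
    simp

/-- The interleaved list is bracketed anew: the twists of the atom `i + 1` that end one group of the
second round become the beginning of the next block, and the twists of the last atom remain over. -/
theorem flatMap_block (k : ℕ) :
    (firstLinks m n 0 ++ handleTwists m n 0) ++ (List.range k).flatMap (fun i =>
      (firstLinks m n (i + 1) ++ handleTwists m n (i + 1)) ++
        (links m n i ++ handleTwists m n (i + 1))) =
      firstLinks m n 0 ++ (List.range k).flatMap (block m n) ++ handleTwists m n k := by
  induction k with
  | zero => simp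
  | succ k ih =>
    rw [List.range_succ, List.flatMap_append, ← List.append_assoc, ih, List.flatMap_append]
    simp [block]

end Move

namespace Stage

variable {G : Type u} [Group G] {m n : ℕ} (E : QuadEq G m n)

/-- From the first round the twists and the links that start at a `z`-atom (for `m ≥ 2`) are kept,
from the second one all but the twists of the first atom and the empty link of the last one. Then
the second round is interleaved with the first, one atom behind it. -/
theorem refines_round_append_round {N : ℕ} (hN : m + n = N + 1) :
    Refines E (Move.round m n ++ Move.round m n)
      (Move.firstLinks m n 0 ++ (List.range N).flatMap (Move.block m n) ++
        Move.handleTwists m n N) := by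
  have h1 : ((List.range (N + 1)).flatMap fun j =>
      Move.firstLinks m n j ++ Move.handleTwists m n j).Sublist (Move.round m n) := by
    rw [Move.round_eq, hN]
    refine List.Sublist.flatMap_right _ fun j _ => ?_
    -- The order of twists and links is reversed compared to a round, but at each atom one of the
    -- two lists is empty.
    by_cases hj : j < m
    · rw [Move.handleTwists_of_lt hj, List.append_nil, List.nil_append, Move.firstLinks]
      split
      · exact List.Sublist.refl _
      · exact List.nil_sublist _
    · rw [Move.firstLinks, if_neg (by omega), List.nil_append]
      exact List.sublist_append_left _ _
  have h2 : ((List.range N).flatMap fun j =>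
      Move.links m n j ++ Move.handleTwists m n (j + 1)).Sublist (Move.round m n) := by
    rw [Move.round_eq, hN, Move.flatMap_append_succ]
    exact (List.sublist_append_right _ _).trans (List.sublist_append_left _ _)
  refine (refines_of_sublist (h1.append h2)).trans ?_
  rw [← Move.flatMap_block]
  refine refines_interleave (fun i j hij k hk l hl => Or.inr ?_) N
  have hk' : k.lo = j := by
    rcases List.mem_append.1 hk with hk | hk
    · exact (Move.lo_hi_of_mem_links (Move.mem_links_of_mem_firstLinks hk)).1
    · exact (Move.lo_hi_of_mem_handleTwists hk).1
  have hl' : l.hi = i + 1 := by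
    rcases List.mem_append.1 hl with hl | hl
    · exact (Move.lo_hi_of_mem_links hl).2
    · exact (Move.lo_hi_of_mem_handleTwists hl).2
  omega

end Stage

/-! ### Passing through the blocks. -/

namespace Stage

open GX

variable {G : Type u} [Group G] {m n : ℕ} (E : QuadEq G m n)

/-- The stage satisfies the invariants of a point of index `j`. -/
def IsGood (s : Stage G m n) (j : ℕ) : Prop := GX.IsGood E s.incl s.val j

variable {E}

theorem isTwist_of_not_commute {s : Stage G m n} (hs : IsSeparated s.incl) (i : Fin n)
    (hxy : ¬ Commute (s.val (.x i)) (s.val (.y i))) :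
    ∃ f, GX.IsTwist i s.incl s.val f
      (((s.step E (.twistY i)).step E (.twistX i)).step E (.twistY i)).incl
      (((s.step E (.twistY i)).step E (.twistX i)).step E (.twistY i)).val :=
  ⟨_, GX.isTwist hs i hxy (eval_var _ _ _) (eval_var _ _ _) (eval_var _ _ _)⟩

/-- Three kinds of blocks, according to whether the atoms `j` and `j + 1` are both of the form `z⁻¹
c z`, the first a `z`-atom and the second a handle, or both handles. -/
theorem IsGood.foldl_block {s : Stage G m n} {j : ℕ} (h : IsGood E s j) (hc : ∀ i, E.c i ≠ 1)
    (hj : j + 1 < m + n) (hj' : 0 < n ∨ j + 2 < m) :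
    IsGood E ((Move.block m n j).foldl (step E) s) (j + 1) := by
  rcases lt_trichotomy (j + 1) m with hm | hm | hm
  · rw [Move.block, Move.handleTwists_of_lt (by omega), Move.handleTwists_of_lt hm,
      Move.links_of_lt hm, Move.firstLinks, if_pos ⟨hm, by omega⟩]
    rcases Nat.lt_or_ge (j + 2) m with hm2 | hm2
    · rw [Move.links_of_lt hm2]
      exact GX.IsGood.zz_zz h hc hm2 rfl rfl
    · have hn : 0 < n := by omega
      have hj2 : j + 2 = m := by omega
      have hm0 : 0 < m := by omega
      rw [Move.links_of_eq hj2 hm0 hn]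
      have key := GX.IsGood.zx_zz h hj2 hm0 hn (u := s.hom (Move.period E (.zx hm0 hn))) rfl
        (u' := (s.step E (.zx hm0 hn)).hom (Move.period E (.zz ⟨j, by omega⟩))) rfl
      exact key
  · have hn : 0 < n := by omega
    have h0 := h.handle ⟨0, hn⟩ (by simp only; omega)
    obtain ⟨f, hf⟩ := isTwist_of_not_commute (E := E) h.separated ⟨0, hn⟩ h0
    have hH : Move.handleTwists m n (j + 1) =
        [.twistY ⟨0, hn⟩, .twistX ⟨0, hn⟩, .twistY ⟨0, hn⟩] := by
      rw [← Move.handleTwists_add, hm]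
      rfl
    rw [Move.block, Move.handleTwists_of_lt (by omega), hH,
      Move.links_of_eq hm (by omega) hn, Move.firstLinks, if_neg (by omega)]
    exact GX.IsGood.twist_zx h hm (by omega) hn hf rfl
  · obtain ⟨l, rfl⟩ := Nat.exists_eq_add_of_le (Nat.lt_succ_iff.1 hm)
    have hl : l + 1 < n := by omega
    have h0 := h.handle ⟨l, by omega⟩ le_rfl
    obtain ⟨f, hf⟩ := isTwist_of_not_commute (E := E) h.separated ⟨l, by omega⟩ h0
    have h1 := h.handle ⟨l + 1, hl⟩ (Nat.le_succ _)
    have hpos : m + (l + 1) ≠ m + l := by omega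
    obtain ⟨f', hf'⟩ := isTwist_of_not_commute (E := E) hf.separated ⟨l + 1, hl⟩ (by
      rw [← hf.map_val _ (by exact hpos), ← hf.map_val _ (by exact hpos)]
      exact fun hc => h1 (hc.of_map hf.injective))
    have hH : Move.handleTwists m n (m + l) =
        [.twistY ⟨l, by omega⟩, .twistX ⟨l, by omega⟩, .twistY ⟨l, by omega⟩] :=
      Move.handleTwists_add ⟨l, by omega⟩
    have hH' : Move.handleTwists m n (m + l + 1) =
        [.twistY ⟨l + 1, hl⟩, .twistX ⟨l + 1, hl⟩, .twistY ⟨l + 1, hl⟩] :=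
      Move.handleTwists_add ⟨l + 1, hl⟩
    rw [Move.block, hH, hH', Move.links_add l (by omega), Move.firstLinks, if_neg (by omega)]
    exact GX.IsGood.twist_xx h hl hf hf' rfl

theorem IsGood.foldl_blocks {s : Stage G m n} (h : IsGood E s 0) (hc : ∀ i, E.c i ≠ 1)
    {k : ℕ} (hk : k < m + n) (hk' : 0 < n ∨ k + 2 < m) :
    IsGood E (((List.range k).flatMap (Move.block m n)).foldl (step E) s) k := by
  induction k with
  | zero => exact h
  | succ k ih =>
    rw [List.range_succ, List.flatMap_append, List.flatMap_singleton, List.foldl_append]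
    exact (ih (by omega) (by omega)).foldl_block hc hk (by omega)

theorem isGood_foldl_firstLinks {s : Stage G m n} (hs : IsSeparated s.incl)
    (hι : Function.Injective s.incl) (hc : ∀ i, E.c i ≠ 1)
    (hh : ∀ i : Fin n, ¬ Commute (s.val (.x i)) (s.val (.y i)))
    (h01 : ∀ hm : 1 < m, ¬ Commute (s.hom (E.atom ⟨0, by omega⟩)) (s.hom (E.atom ⟨1, by omega⟩)))
    (h012 : ∀ (_ : n = 0) (h : 3 = m), s.hom (E.atom ⟨0, by omega⟩) *
      s.hom (E.atom ⟨1, by omega⟩) * s.hom (E.atom ⟨2, by omega⟩) ≠ 1) :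
    IsGood E ((Move.firstLinks m n 0).foldl (step E) s) 0 := by
  rcases Nat.lt_or_ge 1 m with hm | hm
  · rw [Move.firstLinks, if_pos (by omega), Move.links_of_lt hm]
    exact GX.isGood_zz_zero hs hι hc hh hm (h01 hm) h012 rfl
  · rw [Move.firstLinks, if_neg (by omega)]
    exact GX.isGood_zero hs hι hh hm

/-- At the end of the construction, only consequences of the equation are killed. -/
theorem IsGood.isSeparated_and_ker_le {s : Stage G m n} (h : IsGood E s 0) (hE : E.IsStandard)
    (hw : s.hom E.word = 1) (hm : n = 0 → 3 ≤ m) {N : ℕ} (hN : m + n = N + 1) :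
    IsSeparated (((List.range N).flatMap (Move.block m n) ++
      Move.handleTwists m n N).foldl (step E) s).incl ∧
    (((List.range N).flatMap (Move.block m n) ++
      Move.handleTwists m n N).foldl (step E) s).hom.ker ≤ Subgroup.normalClosure {E.word} := by
  obtain ⟨hc, hd⟩ := hE
  rcases Nat.eq_zero_or_pos n with hn | hn
  · have hd' : E.d ≠ 1 := by
      rcases hd with hd | hd
      · exact hd.1
      · omega
    obtain ⟨i, hi⟩ := Nat.exists_eq_add_of_le' (hm hn)
    obtain rfl : N = i + 2 := by omega
    -- Without handles the last two blocks consist of three links in all: two to make the last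
    -- letters free, and one that realizes the HNN extension.
    have hlist : (List.range (i + 2)).flatMap (Move.block m n) ++ Move.handleTwists m n (i + 2) =
        (List.range i).flatMap (Move.block m n) ++
          [.zz ⟨i + 1, by omega⟩, .zz ⟨i, by omega⟩, .zz ⟨i + 1, by omega⟩] := by
      have h1 : Move.block m n i = [.zz ⟨i + 1, by omega⟩, .zz ⟨i, by omega⟩] := by
        rw [Move.block, Move.handleTwists_of_lt (by omega), Move.handleTwists_of_lt (by omega),
          Move.links_of_lt (by omega), Move.firstLinks, if_pos (by omega),
          Move.links_of_lt (by omega)]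
        rfl
      have h2 : Move.block m n (i + 1) = [.zz ⟨i + 1, by omega⟩] := by
        rw [Move.block, Move.handleTwists_of_lt (by omega), Move.handleTwists_of_lt (by omega),
          Move.links_of_lt (by omega), Move.firstLinks, if_pos (by omega),
          Move.links_eq_nil (by omega)]
        rfl
      rw [List.range_succ, List.range_succ, Move.handleTwists_of_lt (by omega)]
      simp [h1, h2]
    rw [hlist, List.foldl_append]
    have hgood := h.foldl_blocks hc (k := i) (by omega) (by omega)
    have hw' := foldl_step_hom_word E hw ((List.range i).flatMap (Move.block m n))
    set s' := ((List.range i).flatMap (Move.block m n)).foldl (step E) s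
    have hw'' := foldl_step_hom_word E hw' [.zz ⟨i + 1, by omega⟩, .zz ⟨i, by omega⟩]
    have hgood' := GX.IsGood.zz_zz hgood hc (by omega) rfl rfl
    have hfaith := GX.IsGood.isFaithfulOn_lastLetters hgood hi.symm hn rfl rfl
    have hlast := GX.ne_one_and_mem_of_isFaithfulOn_lastLetters hi.symm hn hc hd' hfaith hw'' rfl
    exact ⟨hgood'.separated.step hlast.1, fun γ hγ => hlast.2 γ hγ⟩
  · obtain ⟨l, hl⟩ : ∃ l, l + 1 = n := ⟨n - 1, by omega⟩
    obtain rfl : N = m + l := by omega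
    have hgood := h.foldl_blocks hc (k := m + l) (by omega) (by omega)
    have hw' := foldl_step_hom_word E hw ((List.range (m + l)).flatMap (Move.block m n))
    have hH : Move.handleTwists m n (m + l) =
        [.twistY ⟨l, by omega⟩, .twistX ⟨l, by omega⟩, .twistY ⟨l, by omega⟩] :=
      Move.handleTwists_add ⟨l, by omega⟩
    rw [List.foldl_append, hH]
    set s' := ((List.range (m + l)).flatMap (Move.block m n)).foldl (step E) s
    obtain ⟨f, hf⟩ := isTwist_of_not_commute (E := E) hgood.separated ⟨l, by omega⟩
      (hgood.handle _ le_rfl)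
    exact ⟨hf.separated, fun γ hγ => GX.IsGood.mem_of_twist hgood hl hw' rfl rfl rfl hγ⟩

end Stage

/-! ### The radical, general position and the conclusion. -/

namespace QuadEq

open GX

variable {G : Type u} [Group G] {m n : ℕ} {E : QuadEq G m n} {β : GX G m n →* G}

theorem start_hom (hβ : ∀ g : G, β (GX.const g) = g) : (Stage.start β).hom = β :=
  GX.hom_ext (fun a => (GX.eval_const _ _ a).trans (hβ a).symm) fun w => GX.eval_var _ _ w

/-- An element with a non-trivial value is detected by a retraction onto `G`, and this retraction
makes the stage into a solution of `S = 1` in `G`. -/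
theorem radical_le_ker {s : Stage G m n} (hs : IsSeparated s.incl) (hw : s.hom E.word = 1) :
    E.radical ≤ s.hom.ker := by
  intro γ hγ
  rw [MonoidHom.mem_ker]
  by_contra h
  obtain ⟨r, h1, h2⟩ := hs.exists_retraction _ h
  refine h2 ?_
  have h3 : E.IsSolution (r.comp s.hom) := by
    refine ⟨fun g => ?_, ?_⟩
    · exact (congrArg r (GX.eval_const s.incl s.val g)).trans (h1 g)
    · rw [MonoidHom.comp_apply, hw, map_one]
  exact (Subgroup.mem_iInf.1 hγ) ⟨_, h3⟩

theorem normalClosure_le_radical : Subgroup.normalClosure {E.word} ≤ E.radical := by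
  refine Subgroup.normalClosure_le_normal ?_
  rw [Set.singleton_subset_iff]
  exact Subgroup.mem_iInf.2 fun β => β.2.2

/-- If `x_i` and `y_i` had commuting values, their atom would be trivial and would commute with its
neighbours. There is no neighbour only for the equation `[x, y] = d`, and then `d = 1`, which
regularity excludes. -/
theorem not_commute_of_inGeneralPosition (hE : E.IsRegular) (hβ : E.IsSolution β)
    (hgen : E.InGeneralPosition β) (i : Fin n) :
    ¬ Commute (β (GX.var (.x i))) (β (GX.var (.y i))) := by
  intro hc
  have hi : m + i.1 < m + n := by omega
  have h1 : β (E.atom ⟨m + i, hi⟩) = 1 := by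
    rw [E.atom_add i.2]
    have := hc.eq
    simp only [map_mul, map_inv, Fin.eta]
    rw [mul_assoc, this]
    simp
  by_cases hi1 : m + i.1 + 1 < m + n
  · refine hgen _ hi1 ?_
    rw [h1]
    exact Commute.one_left _
  by_cases hi0 : m + i.1 = 0
  · have hm : m = 0 := by omega
    have hn : n = 1 := by omega
    have hd : E.d ≠ 1 := by
      rcases hE.2 with ⟨h2, -⟩ | ⟨-, -, h2⟩
      · intro hd
        rw [kappa, if_pos hd] at h2
        omega
      · exact h2
    apply hd
    have h3 := hβ.2
    rw [E.word_eq_partialProd (k := m + i + 1) (by omega), partialProd_succ, map_mul, map_mul, h1,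
      hβ.1] at h3
    have h4 : E.partialProd (m + i) hi.le = 1 := by
      rw [partialProd, List.prod_eq_one]
      intro x hx
      obtain ⟨a, -⟩ := List.mem_ofFn.1 hx
      exact absurd a.2 (by omega)
    rw [h4] at h3
    simpa using h3
  · refine hgen (m + i.1 - 1) (by omega) ?_
    have h2 : ∀ h, (⟨m + i.1 - 1 + 1, h⟩ : Fin (m + n)) = ⟨m + i, hi⟩ := fun h =>
      Fin.ext (by simp only; omega)
    rw [h2, h1]
    exact Commute.one_right _

end QuadEq

theorem mainTheorem9 {G : Type u} [Group G] [Group.FG G] (hG : IsFullyResiduallyFree G)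
    {m n : ℕ} (E : QuadEq G m n) (hE : E.IsRegular)
    (β : GX G m n →* G) (hβ : E.IsSolution β) (hgen : E.InGeneralPosition β) :
    ∃ lam : E.CoordinateGroup →* E.GUT β,
      lam.comp (QuotientGroup.mk' E.radical) = E.lambdaHom β ∧
      Function.Injective lam := by
  have hstart : (Stage.start β).hom = β := QuadEq.start_hom hβ.1
  have hw : (Stage.start β).hom E.word = 1 := by rw [hstart]; exact hβ.2
  have hpos : 0 < m + n := by
    rcases hE.1.2 with h | h
    · exact h.2
    · omega
  have hm : n = 0 → 3 ≤ m := by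
    intro hn
    rcases hE.2 with ⟨h, -⟩ | h
    · rw [QuadEq.kappa] at h
      split at h <;> omega
    · omega
  have hsep : IsSeparated (Stage.start β).incl :=
    ⟨hG, fun h hh => ⟨MonoidHom.id G, fun _ => rfl, hh⟩⟩
  obtain ⟨N, hN⟩ : ∃ N, m + n = N + 1 := ⟨m + n - 1, by omega⟩
  have hgood := Stage.isGood_foldl_firstLinks (E := E) hsep (fun _ _ h => h) hE.1.1
    (QuadEq.not_commute_of_inGeneralPosition hE hβ hgen)
    (fun hm => by rw [hstart]; exact hgen 0 (by omega))
    -- For three atoms and no handles the product of the atoms has the value `d`, which is not `1`.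
    (fun hn h3 => by
      have hd : E.d ≠ 1 := by
        rcases hE.1.2 with h | h
        · exact h.1
        · omega
      intro h
      apply hd
      have h4 := hβ.2
      rw [hstart] at h
      rw [E.word_eq_partialProd (k := 0 + 1 + 1 + 1) (by omega), QuadEq.partialProd_succ,
        QuadEq.partialProd_succ, QuadEq.partialProd_succ, map_mul, map_mul, map_mul, map_mul,
        hβ.1] at h4
      have h5 : E.partialProd 0 (Nat.zero_le _) = 1 := rfl
      rw [h5, map_one, one_mul] at h4
      have h6 := h.symm.trans (mul_inv_eq_one.1 h4)
      exact h6.symm)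
  obtain ⟨h1, h2⟩ := hgood.isSeparated_and_ker_le hE.1 (Stage.foldl_step_hom_word E hw _) hm hN
  -- The two full rounds map to the rearranged list, so their kernel is contained in the kernel
  -- there.
  have hfull : (E.lambdaHom β).ker ≤ Subgroup.normalClosure {E.word} := by
    have h3 := ((Stage.refines_round_append_round E hN) (Stage.start β)).ker_le
    rw [List.append_assoc, List.foldl_append (l := Move.firstLinks m n 0)] at h3
    exact h3.trans h2
  -- Separation by retractions is available at the end of the rearranged list, which therefore kills
  -- the radical; its kernel is already known to lie in the normal closure of `S`.
  have hrad : E.radical ≤ Subgroup.normalClosure {E.word} :=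
    (QuadEq.radical_le_ker h1 (Stage.foldl_step_hom_word E
      (Stage.foldl_step_hom_word E hw _) _)).trans h2
  have hker : Subgroup.normalClosure {E.word} ≤ (E.lambdaHom β).ker :=
    GX.normalClosure_word_le_ker (Stage.foldl_step_hom_word E hw _)
  refine ⟨QuotientGroup.lift E.radical (E.lambdaHom β) (hrad.trans hker), ?_, ?_⟩
  · ext <;> rfl
  · rw [injective_iff_map_eq_one]
    intro x hx
    obtain ⟨γ, rfl⟩ := QuotientGroup.mk_surjective x
    exact (QuotientGroup.eq_one_iff γ).2 (QuadEq.normalClosure_le_radical (hfull hx))
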